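/- **Setting.** Let $d\ge 1$, $\Omega=[0,1]^d$, $\beta>0$, $C_\beta>0$, $0<\mu_{\min}<\mu_{\max}<\infty$, $\sigma\ge 0$, $1\le q\le\infty$, and let $\lfloor\beta\rfloor$ denote the greatest integer strictly less than $\beta$. Let $\mathcal P(\beta)$ be the class of laws of pairs $(X,Y)\in\mathbb R^d\times\mathbb R$ such that: $X$ is supported on $\Omega$ with a Lebesgue density $\mu$ satisfying $\mu_{\min}<\mu(x)<\mu_{\max}$ on $\Omega$; the regression function $f(x)=\mathbb E(Y\mid X=x)$ has continuous partial derivatives of order $\lfloor\beta\rfloor$ on $\Omega$ with $$\max_{|s|\le\lfloor\beta\rfloor}\sup_{x\in\Omega}|D^sf(x)|+\max_{|s|=\lfloor\beta\rfloor}\sup_{x\ne z\in\Omega}\frac{|D^sf(x)-D^sf(z)|}{\|x-z\|^{\beta-\lfloor\beta\rfloor}}\le C_\beta;$$ and the error $\xi=Y-f(X)$ satisfies $\mathbb E[e^{t\xi}\mid X]\le e^{t^2\sigma^2/2}$ a.s. for all $t\in\mathbb R$. The sample $Z_n=((X_1,Y_1),\dots,(X_n,Y_n))$ consists of independent copies of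 $(X,Y)$ and is independent of $(X,Y)$. For $r\ge0$ let $\mathcal T'(r)$ be the class of maps $A$ assigning to each $x\in\Omega$ a measurable set $A(x)$ with $x\in A(x)\subseteq\Omega$ and $\|x'-x\|\le r$ for all $x'\in A(x)$. The adversarial $L_q$-risk of an estimator $\hat f=\hat f(\cdot,Z_n)$ is $$R_{A,q}(\hat f,f)=\mathbb E\sup_{x'\in A(X)}|\hat f(x')-f(X)|^q\ (1\le q<\infty),\qquad R_{A,\infty}(\hat f,f)=\mathbb E\sup_{x\in\Omega}\sup_{x'\in A(x)}|\hat f(x')-f(x)|,$$ where expectations are upper (outer) expectations whenever the supremum is not measurable. **Estimator.** Let $K:\mathbb R^d\to[0,\infty)$ be measurable with $K_{\min}1_{\{\|u\|\le\Delta\}}\le K(u)\le K_{\max}1_{\{\|u\|\le1\}}$ for all $u$, for some $0<K_{\min}<K_{\max}<\infty$ and $0<\Delta<1$. For an integer $\ell\ge0$ put $U(x)=(x^s/s!)_{s\in\mathbb N^d,\,|s|\le\ell}$. For $h,\tau>0$ and $u\in\mathbb R^d$ put $$B_{uh}=\frac1{nh^d}\sum_{i=1}^nU\!\left(\tfrac{X_i-u}h\right)U^\top\!\left(\tfrac{X_i-u}h\right)K\!\left(\tfrac{X_i-u}h\right),\quad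 a_{uh}=\frac1{nh^d}\sum_{i=1}^nY_i\,U\!\left(\tfrac{X_i-u}h\right)K\!\left(\tfrac{X_i-u}h\right),$$ $\tilde B_{uh}=B_{uh}+\tau I\,1_{\{\lambda_{\min}(B_{uh})<\tau\}}$, and $\tilde f_{uh}(x)=U^\top(\frac{x-u}h)\tilde B_{uh}^{-1}a_{uh}$ if some $X_i$ lies in the closed Euclidean ball $B(u,h)$, $\tilde f_{uh}(x)=0$ otherwise. For an integer $M\ge1$ let $\Lambda_M=\{(\frac{2k_1+1}{2M},\dots,\frac{2k_d+1}{2M}):0\le k_i\le M-1\}$ and let $u_x$ be the point of $\Lambda_M$ closest to $x$ in Euclidean norm (in case of ties, the one closest to $0$). The piecewise estimator $\mathrm{PP}(M,\ell,h,\tau)$ is $\hat f_{\mathrm{PP}}(x)=\tilde f_{u_xh}(x)$. **Theorem (Minimax upper bound).** Let $\ell\ge\lfloor\beta\rfloor$, let $r=r_n\ge0$, and let $h=h_n>0$, integers $M=M_n\ge1$, and $\tau=\tau_n>0$ satisfy $$h\asymp\begin{cases}r\vee n^{-1/(2\beta+d)},&1\le q<\infty,\\ r\vee(n/\log n)^{-1/(2\beta+d)},&q=\infty,\end{cases}\qquad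 M\asymp 1/h,\qquad\tau\to0,\qquad n^\gamma\tau\to\infty\text{ for some fixed }\gamma>0.$$ Then there are $C>0$ and $N$ such that, for all $n\ge N$, $$\sup_{\mathbb P_{(X,Y)}\in\mathcal P(\beta)}\ \sup_{A\in\mathcal T'(r)}R_{A,q}(\hat f_{\mathrm{PP}},f)\le C\cdot\begin{cases}r^{q(1\wedge\beta)}+n^{-q\beta/(2\beta+d)},&1\le q<\infty,\\ r^{1\wedge\beta}+(n/\log n)^{-\beta/(2\beta+d)},&q=\infty.\end{cases}$$ Here $a_n\asymp b_n$ means that each of the two positive sequences is, for all large $n$, at most a constant multiple of the other. -/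

import Mathlib

open MeasureTheory ProbabilityTheory Filter Topology
open scoped ENNReal NNReal

noncomputable section

namespace AdvReg

/-- The Euclidean space `ℝ^d`. -/
abbrev E (d : ℕ) : Type := EuclideanSpace ℝ (Fin d)

/-- The unit cube `Ω = [0,1]^d`. -/
def cube (d : ℕ) : Set (E d) := {x | ∀ i, x i ∈ Set.Icc (0 : ℝ) 1}

/-- The greatest integer strictly less than `β` (for `β > 0`), e.g. `0` for `β = 1`. -/
def floorLT (β : ℝ) : ℕ := ⌈β⌉₊ - 1

/-! ### The class of data distributions -/

/-- The partial derivative `∂_{j 0} ⋯ ∂_{j (k-1)} f` of order `k` at a point of the cube (one-sided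
on the boundary of the cube). As `j` ranges over all `k`-tuples of coordinates, this ranges over all
`D^s f` with `|s| = k`. -/
def partialD {d k : ℕ} (f : E d → ℝ) (j : Fin k → Fin d) (x : E d) : ℝ :=
  iteratedFDerivWithin ℝ k f (cube d) x (fun m => EuclideanSpace.single (j m) (1 : ℝ))

/-- The Hölder class `F(β, C)` on `[0,1]^d` (values outside of the cube are irrelevant). The numbers
`a` and `b` bound the two maxima whose sum is the Hölder norm. -/
def IsHolder {d : ℕ} (β C : ℝ) (f : E d → ℝ) : Prop :=
  ContDiffOn ℝ (floorLT β : ℕ) f (cube d) ∧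
  ∃ a b : ℝ, a + b ≤ C ∧
    (∀ k ≤ floorLT β, ∀ j : Fin k → Fin d, ∀ x ∈ cube d, |partialD f j x| ≤ a) ∧
    (∀ j : Fin (floorLT β) → Fin d, ∀ x ∈ cube d, ∀ z ∈ cube d,
      |partialD f j x - partialD f j z| ≤ b * ‖x - z‖ ^ (β - floorLT β))

/-- The marginal law `ν` of `X` is supported on `[0,1]^d` and has there a Lebesgue density with
values strictly between `μmin` and `μmax`. -/
def HasBoundedDensity {d : ℕ} (μmin μmax : ℝ) (ν : Measure (E d)) : Prop :=
  ∃ p : E d → ℝ, Measurable p ∧ (∀ x ∈ cube d, μmin < p x ∧ p x < μmax) ∧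
    ν = (volume.restrict (cube d)).withDensity (fun x => ENNReal.ofReal (p x))

/-- The sigma-algebra generated by `X` on the space of pairs `(X, Y)`. -/
abbrev sigmaX (d : ℕ) : MeasurableSpace (E d × ℝ) :=
  MeasurableSpace.comap Prod.fst inferInstance

/-- The law `P` of `(X, Y)` belongs to `P(β, Cβ, μmin, μmax, σ)` and has regression function `f`. -/
structure InClass {d : ℕ} (β Cβ μmin μmax : ℝ) (σ : ℝ≥0) (P : Measure (E d × ℝ))
    [IsProbabilityMeasure P] (f : E d → ℝ) : Prop where
  /-- `Y` is integrable -/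
  integrable : Integrable (fun w : E d × ℝ => w.2) P
  /-- `f(X) = E(Y | X)` -/
  regression : P[(fun w : E d × ℝ => w.2) | sigmaX d] =ᵐ[P] fun w => f w.1
  /-- `f` is Hölder smooth -/
  holder : IsHolder β Cβ f
  /-- the law of `X` has a bounded density on the cube -/
  density : HasBoundedDensity μmin μmax (P.map Prod.fst)
  /-- the error `ξ = Y - f(X)` satisfies `E[exp (t ξ) | X] ≤ exp (t² σ² / 2)` a.s., for all `t` -/
  subgaussian : HasCondSubgaussianMGF (sigmaX d) measurable_fst.comap_le
    (fun w : E d × ℝ => w.2 - f w.1) (σ ^ 2) P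

/-! ### Attacks and adversarial risks -/

/-- The class `T'(r)` of attacks of magnitude at most `r`; only `A x` with `x ∈ [0,1]^d` matters. -/
def IsAttack {d : ℕ} (r : ℝ) (A : E d → Set (E d)) : Prop :=
  ∀ x ∈ cube d, MeasurableSet (A x) ∧ x ∈ A x ∧ A x ⊆ cube d ∧ ∀ x' ∈ A x, ‖x' - x‖ ≤ r

/-- The expectation of a nonnegative function that need not be measurable: the infimum of the
expectations of its measurable majorants (a supremum over an arbitrary set-valued `A` need not be
measurable). It is the Lebesgue integral for (a.e.) measurable functions, see below. -/
def upperExp {α : Type*} [MeasurableSpace α] (μ : Measure α) (F : α → ℝ≥0∞) : ℝ≥0∞ :=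
  ⨅ (g : α → ℝ≥0∞) (_ : Measurable g) (_ : ∀ a, F a ≤ g a), ∫⁻ a, g a ∂μ

theorem upperExp_eq_lintegral {α : Type*} [MeasurableSpace α] (μ : Measure α) {F : α → ℝ≥0∞}
    (hF : Measurable F) : upperExp μ F = ∫⁻ a, F a ∂μ := by
  apply le_antisymm
  · exact iInf_le_of_le F (iInf_le_of_le hF (iInf_le _ (fun a => le_rfl)))
  · exact le_iInf fun g => le_iInf fun _ => le_iInf fun hg => lintegral_mono hg

/-- The law of the sample `Z_n = ((X_1, Y_1), …, (X_n, Y_n))`. -/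
abbrev sampleLaw {d : ℕ} (P : Measure (E d × ℝ)) (n : ℕ) : Measure (Fin n → E d × ℝ) :=
  Measure.pi fun _ => P

/-- The adversarial `L_q`-risk `R_{A,q}(fhat, f)`, `1 ≤ q ≤ ∞`, of an estimator `fhat` that maps a
sample and a point to a real number. -/
def advRisk {d n : ℕ} (q : ℝ≥0∞) (P : Measure (E d × ℝ)) (A : E d → Set (E d))
    (fhat : (Fin n → E d × ℝ) → E d → ℝ) (f : E d → ℝ) : ℝ≥0∞ :=
  if q = ⊤ then
    upperExp (sampleLaw P n)
      (fun Z => ⨆ x ∈ cube d, ⨆ x' ∈ A x, ENNReal.ofReal |fhat Z x' - f x|)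
  else
    upperExp (P.prod (sampleLaw P n))
      (fun w => ⨆ x' ∈ A w.1.1, ENNReal.ofReal (|fhat w.2 x' - f w.1.1| ^ q.toReal))

/-! ### The regularized local polynomial estimator -/

/-- The multi-indices `s ∈ ℕ^d` with `|s| ≤ ℓ`. -/
abbrev MIdx (d ℓ : ℕ) : Type := {s : Fin d → Fin (ℓ + 1) // ∑ i, (s i : ℕ) ≤ ℓ}

/-- The vector `U(x) = (x^s / s!)_{|s| ≤ ℓ}`. -/
def monoVec {d : ℕ} (ℓ : ℕ) (x : E d) : MIdx d ℓ → ℝ :=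
  fun s => ∏ i, x i ^ (s.1 i : ℕ) / ((s.1 i : ℕ).factorial : ℝ)

/-- The matrix `B_{uh}`. -/
def matB {d n : ℕ} (K : E d → ℝ) (ℓ : ℕ) (h : ℝ) (Z : Fin n → E d × ℝ) (u : E d) :
    Matrix (MIdx d ℓ) (MIdx d ℓ) ℝ :=
  (1 / (n * h ^ d)) • ∑ i, K (h⁻¹ • ((Z i).1 - u)) •
    Matrix.vecMulVec (monoVec ℓ (h⁻¹ • ((Z i).1 - u))) (monoVec ℓ (h⁻¹ • ((Z i).1 - u)))

/-- The vector `a_{uh}`. -/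
def vecA {d n : ℕ} (K : E d → ℝ) (ℓ : ℕ) (h : ℝ) (Z : Fin n → E d × ℝ) (u : E d) :
    MIdx d ℓ → ℝ :=
  (1 / (n * h ^ d)) • ∑ i, ((Z i).2 * K (h⁻¹ • ((Z i).1 - u))) •
    monoVec ℓ (h⁻¹ • ((Z i).1 - u))

/-- The smallest (real) eigenvalue of a matrix; it is only used for the symmetric matrix `B_{uh}`,
whose spectrum is a nonempty finite set of reals. -/
def lambdaMin {ι : Type*} [Fintype ι] [DecidableEq ι] (B : Matrix ι ι ℝ) : ℝ :=
  sInf (spectrum ℝ B)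

open Classical in
/-- The regularized matrix `B_{uh} + τ I 1{λ_min(B_{uh}) < τ}`. -/
def matBReg {d n : ℕ} (K : E d → ℝ) (ℓ : ℕ) (h τ : ℝ) (Z : Fin n → E d × ℝ) (u : E d) :
    Matrix (MIdx d ℓ) (MIdx d ℓ) ℝ :=
  matB K ℓ h Z u + if lambdaMin (matB K ℓ h Z u) < τ then τ • 1 else 0

open Classical in
/-- The regularized local polynomial estimator `LP(ℓ,h,τ)` with base point `u`, at `x`: it is `0`
when there is no design point in the closed ball `B(u,h)`. -/
def lpEst {d n : ℕ} (K : E d → ℝ) (ℓ : ℕ) (h τ : ℝ) (Z : Fin n → E d × ℝ) (u x : E d) : ℝ :=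
  if ∃ i, (Z i).1 ∈ Metric.closedBall u h then
    monoVec ℓ (h⁻¹ • (x - u)) ⬝ᵥ ((matBReg K ℓ h τ Z u)⁻¹.mulVec (vecA K ℓ h Z u))
  else 0

/-! ### The piecewise estimator -/

/-- The discretization points `Λ_M`. -/
def grid (d M : ℕ) : Set (E d) :=
  Set.range fun k : Fin d → Fin M => WithLp.toLp 2 fun i => (2 * ((k i : ℕ) : ℝ) + 1) / (2 * M)

/-- `u` is a point of `Λ_M` closest to `x` and, among those, one closest to `0`. -/
def IsNearest {d : ℕ} (M : ℕ) (x u : E d) : Prop :=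
  u ∈ grid d M ∧ (∀ v ∈ grid d M, ‖x - u‖ ≤ ‖x - v‖) ∧
    ∀ v ∈ grid d M, ‖x - v‖ = ‖x - u‖ → ‖u‖ ≤ ‖v‖

theorem exists_isNearest {d M : ℕ} (hM : 1 ≤ M) (x : E d) : ∃ u, IsNearest M x u := by
  have hfin : (grid d M).Finite := Set.finite_range _
  have hne : (grid d M).Nonempty := ⟨_, ⟨fun _ => ⟨0, hM⟩, rfl⟩⟩
  obtain ⟨u₀, hu₀, hmin⟩ := Set.exists_min_image (grid d M) (fun v => ‖x - v‖) hfin hne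
  obtain ⟨u, ⟨hu, hux⟩, hmin'⟩ := Set.exists_min_image
    {v ∈ grid d M | ‖x - v‖ = ‖x - u₀‖} (fun v => ‖v‖) (hfin.subset (Set.sep_subset _ _))
    ⟨u₀, hu₀, rfl⟩
  exact ⟨u, hu, fun v hv => hux ▸ hmin v hv, fun v hv h => hmin' v ⟨hv, h.trans hux⟩⟩

open Classical in
/-- The discretization point `u_x` (for `M ≥ 1`). -/
def nearest {d : ℕ} (M : ℕ) (x : E d) : E d :=
  if H : ∃ u, IsNearest M x u then H.choose else 0

theorem nearest_spec {d M : ℕ} (hM : 1 ≤ M) (x : E d) : IsNearest M x (nearest M x) := by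
  have H := exists_isNearest hM x
  rw [nearest, dif_pos H]
  exact H.choose_spec

/-- The piecewise estimator `PP(M,ℓ,h,τ)`. -/
def ppEst {d n : ℕ} (K : E d → ℝ) (M ℓ : ℕ) (h τ : ℝ) (Z : Fin n → E d × ℝ) (x : E d) : ℝ :=
  lpEst K ℓ h τ Z (nearest M x) x

/-- The assumption on the kernel. -/
def IsKernel {d : ℕ} (K : E d → ℝ) : Prop :=
  Measurable K ∧ ∃ Kmin Kmax Δ : ℝ, 0 < Kmin ∧ Kmin < Kmax ∧ 0 < Δ ∧ Δ < 1 ∧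
    ∀ u, (Metric.closedBall (0 : E d) Δ).indicator (fun _ => Kmin) u ≤ K u ∧
      K u ≤ (Metric.closedBall (0 : E d) 1).indicator (fun _ => Kmax) u

/-! ### Bandwidth and rate -/

/-- `n^{-1/(2β+d)}` for `q < ∞` and `(n / log n)^{-1/(2β+d)}` for `q = ∞`. -/
def critBandwidth (d : ℕ) (β : ℝ) (q : ℝ≥0∞) (n : ℕ) : ℝ :=
  if q = ⊤ then ((n : ℝ) / Real.log n) ^ (-(1 / (2 * β + d)))
  else (n : ℝ) ^ (-(1 / (2 * β + d)))

/-- `r^{q(1∧β)} + n^{-qβ/(2β+d)}` for `q < ∞` and `r^{1∧β} + (n / log n)^{-β/(2β+d)}` for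
`q = ∞`. -/
def rate (d : ℕ) (β : ℝ) (q : ℝ≥0∞) (r : ℝ) (n : ℕ) : ℝ :=
  if q = ⊤ then r ^ min 1 β + ((n : ℝ) / Real.log n) ^ (-(β / (2 * β + d)))
  else r ^ (q.toReal * min 1 β) + (n : ℝ) ^ (-(q.toReal * β / (2 * β + d)))

end AdvReg

end

/-! An attack moves `x` to a point `x'` with `‖x' - x‖ ≤ r`, so the error splits into `|f x' - f
x|`, of order `r ^ min 1 β`, and the ordinary error of the estimator at `x'`. The latter is uniform
in `x'` almost for free. The piecewise estimator is one polynomial per grid cell, with coefficients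
that depend only on the grid point `u`, and `‖x' - u‖` is of order `h`. A supremum over the attack
thus reduces to coefficient errors at the grid points that the attack can reach.

At one grid point let `θ` be the rescaled Taylor coefficients of `f`. If `B w = a`, then `B (w - θ)
= a - B θ`, whose right-hand side is a weighted residual sum plus Taylor remainders of order `h ^ β`
(`abs_lpEst_sub_le`). Inverting `B` costs a constant as long as `B` is near its mean `gram`. That
mean is coercive uniformly in `P`, `u` and `h`, because some orthant box at `u`, with sides of order
`h`, lies in the cube (`exists_gram_coercive`). If `B` is far from its mean, the regularization
still bounds the estimator by a multiple of `1 / τ` (`abs_lpEst_le`); this happens with probability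
exponentially small in `n * h ^ d`, while `1 / τ` grows only polynomially.

Noise and Gram deviations are sums of independent terms that vanish off a ball of mass of order `h ^
d`, so their logarithmic exponential moments are of order `n * h ^ d * t ^ 2` for `t ≤ 1`. This
gives noise `(n * h ^ d) ^ (-1/2)` at a fixed grid point, and `√(log n / (n * h ^ d))` for the
maximum over the grid. For `q < ∞` no maximum is needed: `X` is independent of the sample, the
attack reaches only cells within distance of order `r + h` of `X`, and `r` is at most of order `h`.
Summing (mass of order `h ^ d`) times (expected error) over order `h ^ (-d)` cells leaves a constant
and no logarithm.

Events are replaced throughout by exponential majorants, which are measurable and can be integrated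
directly; this also takes care of the upper expectation. Finally `h` is of order `max r w`, with `w`
the critical bandwidth at which `w ^ β` matches the noise level; the rate follows since `r` is
bounded, so that `r ^ β` is at most of order `r ^ min 1 β`. -/

namespace AdvReg

/-! ### Coercive matrices and the least eigenvalue. -/

section LinearAlgebra

/-- A coercive linear system has solutions controlled in `ℓ¹` by the right-hand side. -/
theorem sum_abs_le_of_coercive {ι : Type*} [Fintype ι] {B : Matrix ι ι ℝ} {c : ℝ} (hc : 0 < c)
    (hB : ∀ v, c * (v ⬝ᵥ v) ≤ v ⬝ᵥ B.mulVec v) (w a : ι → ℝ) (h : B.mulVec w = a) :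
    ∑ s, |w s| ≤ Fintype.card ι / c * ∑ s, |a s| := by
  set S := ∑ s, |w s|
  set T := ∑ s, |a s|
  have hS : 0 ≤ S := Finset.sum_nonneg fun _ _ => abs_nonneg _
  have h1 : S ^ 2 ≤ Fintype.card ι * (w ⬝ᵥ w) := by
    have := sq_sum_le_card_mul_sum_sq (s := Finset.univ) (f := fun s => |w s|)
    simpa [dotProduct, sq_abs, pow_two] using this
  have h2 : w ⬝ᵥ a ≤ S * T := by
    rw [Finset.sum_mul]
    refine Finset.sum_le_sum fun s _ => (le_abs_self _).trans ?_
    rw [abs_mul]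
    gcongr
    exact Finset.single_le_sum (f := fun s => |a s|) (fun _ _ => abs_nonneg _) (Finset.mem_univ s)
  have h3 : c * S ^ 2 ≤ Fintype.card ι * (S * T) := by
    have := hB w
    rw [h] at this
    calc c * S ^ 2 ≤ c * (Fintype.card ι * (w ⬝ᵥ w)) := by gcongr
      _ = Fintype.card ι * (c * (w ⬝ᵥ w)) := by ring
      _ ≤ _ := mul_le_mul_of_nonneg_left (this.trans h2) (by positivity)
  rcases hS.eq_or_lt with h0 | h0
  · rw [← h0]
    have : 0 ≤ T := Finset.sum_nonneg fun _ _ => abs_nonneg _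
    positivity
  · have : c * S ≤ Fintype.card ι * T := by
      by_contra! hlt
      have := mul_lt_mul_of_pos_left hlt h0
      nlinarith
    rw [div_mul_eq_mul_div, le_div_iff₀ hc]
    linarith

variable {ι : Type*} [Fintype ι] [DecidableEq ι]

theorem isUnit_of_coercive {B : Matrix ι ι ℝ} {c : ℝ} (hc : 0 < c)
    (hB : ∀ v, c * (v ⬝ᵥ v) ≤ v ⬝ᵥ B.mulVec v) : IsUnit B := by
  rw [← Matrix.mulVec_injective_iff_isUnit]
  refine (injective_iff_map_eq_zero B.mulVecLin).2 fun w hw => ?_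
  have h := sum_abs_le_of_coercive hc hB w 0 hw
  simp only [Pi.zero_apply, abs_zero, Finset.sum_const_zero, mul_zero] at h
  have h0 := (Finset.sum_eq_zero_iff_of_nonneg (s := Finset.univ) (f := fun s => |w s|)
    (fun _ _ => abs_nonneg _)).1 (le_antisymm h (Finset.sum_nonneg fun _ _ => abs_nonneg _))
  funext s
  simpa using h0 s (Finset.mem_univ s)

theorem mulVec_inv_mulVec_of_coercive {B : Matrix ι ι ℝ} {c : ℝ} (hc : 0 < c)
    (hB : ∀ v, c * (v ⬝ᵥ v) ≤ v ⬝ᵥ B.mulVec v) (a : ι → ℝ) : B.mulVec (B⁻¹.mulVec a) = a := by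
  rw [Matrix.mulVec_mulVec, Matrix.mul_nonsing_inv _
    ((Matrix.isUnit_iff_isUnit_det _).1 (isUnit_of_coercive hc hB)), Matrix.one_mulVec]

/-- Test the quadratic form on an eigenvector. Nonemptiness of `ι` makes the spectrum nonempty; the
infimum over an empty spectrum would be `0`. -/
theorem le_lambdaMin_of_coercive [Nonempty ι] {B : Matrix ι ι ℝ} {c : ℝ} (hs : B.IsHermitian)
    (hB : ∀ v, c * (v ⬝ᵥ v) ≤ v ⬝ᵥ B.mulVec v) : c ≤ lambdaMin B := by
  unfold lambdaMin
  refine le_csInf ?_ fun μ hμ => ?_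
  · rw [hs.spectrum_real_eq_range_eigenvalues]
    exact Set.range_nonempty _
  · rw [← Matrix.spectrum_toLin', ← Module.End.hasEigenvalue_iff_mem_spectrum] at hμ
    obtain ⟨v, hv⟩ := hμ.exists_hasEigenvector
    have h1 := hv.apply_eq_smul
    rw [Matrix.toLin'_apply] at h1
    have h2 := hB v
    rw [h1, dotProduct_smul, smul_eq_mul] at h2
    have h3 : 0 < v ⬝ᵥ v := by
      have := Matrix.dotProduct_star_self_pos_iff (v := v)
      simpa using this.2 hv.2
    exact le_of_mul_le_mul_right h2 h3

/-- After subtraction of `c` the spectrum is nonnegative, and a symmetric matrix with nonnegative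
spectrum is positive semidefinite. -/
theorem coercive_of_le_lambdaMin {B : Matrix ι ι ℝ} {c : ℝ} (hs : B.IsHermitian)
    (hB : c ≤ lambdaMin B) (v : ι → ℝ) : c * (v ⬝ᵥ v) ≤ v ⬝ᵥ B.mulVec v := by
  have h1 : (B - algebraMap ℝ _ c).PosSemidef := by
    rw [Matrix.posSemidef_iff_isHermitian_and_spectrum_nonneg]
    refine ⟨hs.sub ?_, fun x hx => ?_⟩
    · rw [Matrix.algebraMap_eq_diagonal]
      exact Matrix.isHermitian_diagonal _
    · have h2 : c + x ∈ spectrum ℝ B := by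
        rwa [add_comm, spectrum.add_mem_iff, neg_add_eq_sub]
      have h3 : c ≤ c + x := hB.trans (csInf_le (Matrix.finite_real_spectrum).bddBelow h2)
      simpa using h3
  have := h1.dotProduct_mulVec_nonneg v
  rw [Matrix.sub_mulVec, dotProduct_sub, Algebra.algebraMap_eq_smul_one, Matrix.smul_mulVec,
    Matrix.one_mulVec, dotProduct_smul, smul_eq_mul] at this
  simpa using this

end LinearAlgebra

/-! ### The empirical Gram matrix and its regularization. -/

section Gram

variable {d n ℓ : ℕ} {K : E d → ℝ} {h τ : ℝ} {Z : Fin n → E d × ℝ} {u : E d}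

instance : Nonempty (MIdx d ℓ) := ⟨⟨0, by simp⟩⟩

/-- The quadratic form is a weighted sum of squares, hence nonnegative for a nonnegative kernel. -/
theorem dotProduct_matB_mulVec (v : MIdx d ℓ → ℝ) :
    v ⬝ᵥ (matB K ℓ h Z u).mulVec v = (1 / (n * h ^ d)) * ∑ i, K (h⁻¹ • ((Z i).1 - u)) *
      (monoVec ℓ (h⁻¹ • ((Z i).1 - u)) ⬝ᵥ v) ^ 2 := by
  simp only [matB, Matrix.smul_mulVec, Matrix.sum_mulVec, dotProduct_smul, dotProduct_sum,
    Matrix.vecMulVec_mulVec, smul_eq_mul]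
  congr 1
  refine Finset.sum_congr rfl fun i _ => ?_
  simp only [op_smul_eq_smul, smul_eq_mul]
  rw [dotProduct_comm v]
  ring

theorem isHermitian_matB : (matB K ℓ h Z u).IsHermitian := by
  ext s t
  simp [matB, Matrix.sum_apply, Matrix.vecMulVec_apply, mul_comm]

theorem matB_apply (s t : MIdx d ℓ) : matB K ℓ h Z u s t = (1 / (n * h ^ d)) *
    ∑ i, K (h⁻¹ • ((Z i).1 - u)) * (monoVec ℓ (h⁻¹ • ((Z i).1 - u)) s *
      monoVec ℓ (h⁻¹ • ((Z i).1 - u)) t) := by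
  simp [matB, Matrix.sum_apply, Matrix.vecMulVec_apply]

theorem vecA_apply (s : MIdx d ℓ) : vecA K ℓ h Z u s = (1 / (n * h ^ d)) *
    ∑ i, (Z i).2 * K (h⁻¹ • ((Z i).1 - u)) * monoVec ℓ (h⁻¹ • ((Z i).1 - u)) s := by
  simp [vecA, Finset.sum_apply]

/-- Either `τ • 1` was added to a positive semidefinite matrix, or the least eigenvalue was already
at least `τ`. This holds for every sample, and it is what makes the crude bound deterministic. -/
theorem matBReg_coercive (hK : ∀ x, 0 ≤ K x) (hh : 0 < h) (v : MIdx d ℓ → ℝ) :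
    τ * (v ⬝ᵥ v) ≤ v ⬝ᵥ (matBReg K ℓ h τ Z u).mulVec v := by
  unfold matBReg
  split_ifs with hlt
  · rw [Matrix.add_mulVec, dotProduct_add, Matrix.smul_mulVec, Matrix.one_mulVec, dotProduct_smul,
      smul_eq_mul, dotProduct_matB_mulVec]
    have : 0 ≤ (1 / (n * h ^ d)) * ∑ i, K (h⁻¹ • ((Z i).1 - u)) *
        (monoVec ℓ (h⁻¹ • ((Z i).1 - u)) ⬝ᵥ v) ^ 2 :=
      mul_nonneg (by positivity) (Finset.sum_nonneg fun i _ => mul_nonneg (hK _) (sq_nonneg _))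
    linarith
  · rw [add_zero]
    exact coercive_of_le_lambdaMin isHermitian_matB (not_lt.1 hlt) v

/-- The regularization is inactive once `B` is well conditioned and `τ` is small, so it adds no bias
there. -/
theorem matBReg_eq_matB {c : ℝ} (hτ : τ ≤ c)
    (hB : ∀ v, c * (v ⬝ᵥ v) ≤ v ⬝ᵥ (matB K ℓ h Z u).mulVec v) :
    matBReg K ℓ h τ Z u = matB K ℓ h Z u := by
  rw [matBReg, if_neg (not_lt.2 (hτ.trans (le_lambdaMin_of_coercive isHermitian_matB hB))),
    add_zero]

/-- Coercivity is stable under entrywise perturbations. -/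
theorem coercive_of_entrywise_close {ι : Type*} [Fintype ι] {B G : Matrix ι ι ℝ} {c ε : ℝ}
    (hε : Fintype.card ι * ε ≤ c / 2) (hBG : ∀ s t, |B s t - G s t| ≤ ε)
    (hG : ∀ v, c * (v ⬝ᵥ v) ≤ v ⬝ᵥ G.mulVec v) (v : ι → ℝ) :
    c / 2 * (v ⬝ᵥ v) ≤ v ⬝ᵥ B.mulVec v := by
  have h1 : v ⬝ᵥ B.mulVec v - v ⬝ᵥ G.mulVec v = ∑ s, ∑ t, v s * v t * (B s t - G s t) := by
    simp only [dotProduct, Matrix.mulVec, Finset.mul_sum, ← Finset.sum_sub_distrib]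
    refine Finset.sum_congr rfl fun s _ => Finset.sum_congr rfl fun t _ => by ring
  have h2 : |∑ s, ∑ t, v s * v t * (B s t - G s t)| ≤ ε * (∑ s, |v s|) ^ 2 := by
    rw [pow_two, Finset.sum_mul_sum, Finset.mul_sum]
    refine (Finset.abs_sum_le_sum_abs _ _).trans (Finset.sum_le_sum fun s _ => ?_)
    rw [Finset.mul_sum]
    refine (Finset.abs_sum_le_sum_abs _ _).trans (Finset.sum_le_sum fun t _ => ?_)
    rw [abs_mul, abs_mul, mul_comm]
    gcongr
    exact hBG s t
  have h3 : (∑ s, |v s|) ^ 2 ≤ Fintype.card ι * (v ⬝ᵥ v) := by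
    have := sq_sum_le_card_mul_sum_sq (s := Finset.univ) (f := fun s => |v s|)
    simpa [dotProduct, sq_abs, pow_two] using this
  have hvv : 0 ≤ v ⬝ᵥ v := Finset.sum_nonneg fun s _ => mul_self_nonneg _
  rcases isEmpty_or_nonempty ι with hι | ⟨⟨s0⟩⟩
  · simp
  have hε0 : 0 ≤ ε := (abs_nonneg _).trans (hBG s0 s0)
  have h4 : ε * (∑ s, |v s|) ^ 2 ≤ c / 2 * (v ⬝ᵥ v) := by
    calc _ ≤ ε * (Fintype.card ι * (v ⬝ᵥ v)) := by gcongr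
      _ = (Fintype.card ι * ε) * (v ⬝ᵥ v) := by ring
      _ ≤ _ := by gcongr
  have h5 := (abs_le.1 h2).1
  have h6 := hG v
  linarith

end Gram

/-! ### Geometry of the cube. -/

section Cube

variable {d : ℕ}

theorem convex_cube : Convex ℝ (cube d) := by
  intro x hx y hy a b ha hb hab i
  exact (convex_Icc (0 : ℝ) 1) (hx i) (hy i) ha hb hab

theorem isClosed_cube : IsClosed (cube d) := by
  have : cube d = ⋂ i, {x | x i ∈ Set.Icc (0 : ℝ) 1} := by ext; simp [cube]
  rw [this]
  exact isClosed_iInter fun i => isClosed_Icc.preimage (by fun_prop)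

theorem measurableSet_cube : MeasurableSet (cube d) := isClosed_cube.measurableSet

theorem zero_mem_cube : (0 : E d) ∈ cube d := fun i => by simp

theorem uniqueDiffOn_cube : UniqueDiffOn ℝ (cube d) := by
  refine uniqueDiffOn_convex convex_cube ⟨WithLp.toLp 2 fun _ => 1 / 2, ?_⟩
  have hopen : IsOpen {x : E d | ∀ i, x i ∈ Set.Ioo (0 : ℝ) 1} := by
    have : {x : E d | ∀ i, x i ∈ Set.Ioo (0 : ℝ) 1} = ⋂ i, {x | x i ∈ Set.Ioo (0 : ℝ) 1} := by
      ext; simp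
    rw [this]
    exact isOpen_iInter_of_finite fun i => isOpen_Ioo.preimage (by fun_prop)
  have hsub : {x : E d | ∀ i, x i ∈ Set.Ioo (0 : ℝ) 1} ⊆ cube d :=
    fun x hx i => Set.Ioo_subset_Icc_self (hx i)
  refine interior_maximal hsub hopen ?_
  intro i
  norm_num

end Cube

/-! ### Taylor expansion along segments in the cube. -/

section Taylor

variable {d : ℕ}

/-- A Taylor estimate for a chain of successive derivatives on `[0, 1]`. -/
theorem abs_sub_taylor_le (k : ℕ) : ∀ (Φ : ℕ → ℝ → ℝ) {A : ℝ},
    (∀ j < k, ∀ t ∈ Set.Icc (0 : ℝ) 1, HasDerivWithinAt (Φ j) (Φ (j + 1) t) (Set.Icc 0 1) t) →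
    (∀ t ∈ Set.Icc (0 : ℝ) 1, |Φ k t - Φ k 0| ≤ A) → ∀ t ∈ Set.Icc (0 : ℝ) 1,
    |Φ 0 t - ∑ j ∈ Finset.range (k + 1), Φ j 0 * t ^ j / j.factorial| ≤ A := by
  induction k with
  | zero =>
    intro Φ A _ hA t ht
    simpa using hA t ht
  | succ k ih =>
    intro Φ A hd hA t ht
    have hA0 : 0 ≤ A := (abs_nonneg _).trans (hA t ht)
    -- The shifted chain starts at `Φ 1`, and its Taylor remainder is the derivative of `g`. As `g 0
    -- = 0` and `t ≤ 1`, the mean value inequality keeps the same bound `A`.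
    have h1 := ih (fun j => Φ (j + 1)) (fun j hj => hd (j + 1) (by omega)) hA
    set g : ℝ → ℝ := fun t =>
      Φ 0 t - ∑ j ∈ Finset.range (k + 2), Φ j 0 * t ^ j / j.factorial with hg
    have hder : ∀ s ∈ Set.Icc (0 : ℝ) 1, HasDerivWithinAt g
        (Φ 1 s - ∑ j ∈ Finset.range (k + 1), Φ (j + 1) 0 * s ^ j / j.factorial)
        (Set.Icc 0 1) s := by
      intro s hs
      refine (hd 0 (by omega) s hs).sub ?_
      have hsum : HasDerivAt (fun t : ℝ => ∑ j ∈ Finset.range (k + 2),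
          Φ j 0 * t ^ j / j.factorial)
          (∑ j ∈ Finset.range (k + 2), Φ j 0 * (j * s ^ (j - 1)) / j.factorial) s := by
        refine HasDerivAt.fun_sum fun j _ => ?_
        exact ((hasDerivAt_pow j s).const_mul (Φ j 0)).div_const _
      convert! hsum.hasDerivWithinAt using 1
      rw [Finset.sum_range_succ' _ (k + 1)]
      simp only [Nat.cast_zero, zero_mul, mul_zero, zero_div, add_zero]
      refine Finset.sum_congr rfl fun j _ => ?_
      rw [Nat.factorial_succ, Nat.add_sub_cancel]
      push_cast
      have : (j.factorial : ℝ) ≠ 0 := by positivity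
      field_simp
    have hg0 : g 0 = 0 := by
      simp [hg, Finset.sum_range_succ' _ (k + 1)]
    have h2 := Convex.norm_image_sub_le_of_norm_hasDerivWithin_le hder h1
      (convex_Icc (0 : ℝ) 1) (Set.left_mem_Icc.2 zero_le_one) ht
    rw [hg0, sub_zero, sub_zero, Real.norm_eq_abs, Real.norm_eq_abs, abs_of_nonneg ht.1] at h2
    exact h2.trans (mul_le_of_le_one_right hA0 ht.2)

/-- The `j`-th derivative within the cube, evaluated on the diagonal in direction `v`. -/
noncomputable def lineD (f : E d → ℝ) (j : ℕ) (x v : E d) : ℝ :=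
  iteratedFDerivWithin ℝ j f (cube d) x fun _ => v

theorem lineD_zero (f : E d → ℝ) (x v : E d) : lineD f 0 x v = f x := by
  simp [lineD]

/-- Multilinearity passes from directional derivatives to the partial derivatives that the Hölder
class controls. -/
theorem lineD_eq_sum (f : E d → ℝ) (j : ℕ) (x v : E d) :
    lineD f j x v = ∑ i : Fin j → Fin d, (∏ m, v (i m)) * partialD f i x := by
  have hv : v = ∑ i, v i • EuclideanSpace.single i (1 : ℝ) := by
    ext k
    simp [Finset.sum_apply, Pi.single_apply]
  unfold lineD
  conv_lhs => rw [hv]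
  rw [ContinuousMultilinearMap.map_sum]
  refine Finset.sum_congr rfl fun i _ => ?_
  rw [ContinuousMultilinearMap.map_smul_univ]
  rfl

theorem abs_prod_coord_le {j : ℕ} (v : E d) (i : Fin j → Fin d) :
    |∏ m, v (i m)| ≤ ‖v‖ ^ j := by
  rw [Finset.abs_prod]
  calc ∏ m, |v (i m)| ≤ ∏ _m : Fin j, ‖v‖ :=
        Finset.prod_le_prod (fun _ _ => abs_nonneg _) fun m _ => PiLp.norm_apply_le v (i m)
    _ = ‖v‖ ^ j := by simp

theorem abs_lineD_le {f : E d → ℝ} {j : ℕ} {x v : E d} {a : ℝ}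
    (ha : ∀ i : Fin j → Fin d, |partialD f i x| ≤ a) : |lineD f j x v| ≤ d ^ j * (‖v‖ ^ j * a) := by
  rw [lineD_eq_sum]
  refine (Finset.abs_sum_le_sum_abs _ _).trans ?_
  calc _ ≤ ∑ _i : Fin j → Fin d, ‖v‖ ^ j * a := by
        refine Finset.sum_le_sum fun i _ => ?_
        rw [abs_mul]
        exact mul_le_mul (abs_prod_coord_le v i) (ha i) (abs_nonneg _) (by positivity)
    _ = _ := by simp

theorem abs_lineD_sub_le {f : E d → ℝ} {j : ℕ} {x z v : E d} {a : ℝ}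
    (ha : ∀ i : Fin j → Fin d, |partialD f i x - partialD f i z| ≤ a) :
    |lineD f j x v - lineD f j z v| ≤ d ^ j * (‖v‖ ^ j * a) := by
  rw [lineD_eq_sum, lineD_eq_sum, ← Finset.sum_sub_distrib]
  refine (Finset.abs_sum_le_sum_abs _ _).trans ?_
  calc _ ≤ ∑ _i : Fin j → Fin d, ‖v‖ ^ j * a := by
        refine Finset.sum_le_sum fun i _ => ?_
        rw [← mul_sub, abs_mul]
        exact mul_le_mul (abs_prod_coord_le v i) (ha i) (abs_nonneg _) (by positivity)
    _ = _ := by simp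

theorem segment_mem_cube {u v : E d} (hu : u ∈ cube d) (huv : u + v ∈ cube d) {t : ℝ}
    (ht : t ∈ Set.Icc (0 : ℝ) 1) : u + t • v ∈ cube d := by
  have := convex_cube hu huv (sub_nonneg.2 ht.2) ht.1 (sub_add_cancel 1 t)
  convert! this using 1
  module

/-- The iterated derivative of order `j + 1` is the derivative of the one of order `j`, with the new
direction in the first slot. Evaluation on the constant tuple `v` is linear and continuous, so the
chain rule along the segment applies. -/
theorem hasDerivWithinAt_lineD {f : E d → ℝ} {j k : ℕ} (hf : ContDiffOn ℝ k f (cube d))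
    (hj : j < k) {u v : E d} (hu : u ∈ cube d) (huv : u + v ∈ cube d) {t : ℝ}
    (ht : t ∈ Set.Icc (0 : ℝ) 1) :
    HasDerivWithinAt (fun t : ℝ => lineD f j (u + t • v) v) (lineD f (j + 1) (u + t • v) v)
      (Set.Icc 0 1) t := by
  have h1 := (hf.differentiableOn_iteratedFDerivWithin (m := j) (by exact_mod_cast hj)
    uniqueDiffOn_cube (u + t • v) (segment_mem_cube hu huv ht)).hasFDerivWithinAt
  have hline : HasDerivWithinAt (fun t : ℝ => u + t • v) v (Set.Icc 0 1) t := by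
    simpa using (((hasDerivAt_id t).smul_const v).const_add u).hasDerivWithinAt
  have h2 := h1.comp_hasDerivWithinAt t hline fun s hs => segment_mem_cube hu huv hs
  have h3 := (ContinuousMultilinearMap.apply ℝ (fun _ : Fin j => E d) ℝ
    (fun _ => v)).hasFDerivAt.comp_hasDerivWithinAt t h2
  exact h3

end Taylor

/-! ### Homogeneous products of coordinates in the monomial basis. -/

section Monomials

variable {d : ℕ}

/-- Group the factors by coordinate: the exponents are the sizes of the fibres of `i`, and `c`
undoes the factorials. -/
theorem exists_prod_coord_eq_monoVec {ℓ j : ℕ} (hj : j ≤ ℓ) (i : Fin j → Fin d) :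
    ∃ (s : MIdx d ℓ) (c : ℝ), ∀ v : E d, ∏ m, v (i m) = c * monoVec ℓ v s := by
  set a : Fin d → ℕ := fun k => (Finset.univ.filter fun m => i m = k).card with ha
  have hsum : ∑ k, a k = j := by
    have := Finset.card_eq_sum_card_fiberwise (f := i) (s := Finset.univ) (t := Finset.univ)
      (fun _ _ => Finset.mem_coe.2 (Finset.mem_univ _))
    simpa using this.symm
  have hle : ∀ k, a k ≤ ℓ := fun k =>
    (Finset.single_le_sum (fun _ _ => Nat.zero_le _) (Finset.mem_univ k)).trans (hsum.trans_le hj)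
  refine ⟨⟨fun k => ⟨a k, Nat.lt_succ_of_le (hle k)⟩, hsum.trans_le hj⟩,
    ∏ k, ((a k).factorial : ℝ), fun v => ?_⟩
  unfold monoVec
  rw [← Finset.prod_mul_distrib, ← Finset.prod_fiberwise' Finset.univ i (fun k => v k)]
  refine Finset.prod_congr rfl fun k _ => ?_
  simp only [Finset.prod_const, ha]
  field_simp

/-- The functions `v ↦ U(v / h) ⬝ θ`. -/
noncomputable def polySpace (d ℓ : ℕ) (h : ℝ) : Submodule ℝ (E d → ℝ) where
  carrier := {g | ∃ θ : MIdx d ℓ → ℝ, ∀ v, g v = monoVec ℓ (h⁻¹ • v) ⬝ᵥ θ}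
  add_mem' := by
    rintro a b ⟨θ, hθ⟩ ⟨η, hη⟩
    exact ⟨θ + η, fun v => by simp [hθ, hη, dotProduct_add]⟩
  zero_mem' := ⟨0, fun v => by simp⟩
  smul_mem' := by
    rintro c a ⟨θ, hθ⟩
    exact ⟨c • θ, fun v => by simp [hθ, dotProduct_smul]⟩

/-- Replacing `v` by `h⁻¹ • v` costs `h ^ (-j)`, which the coefficient restores. -/
theorem prod_coord_mem_polySpace {ℓ j : ℕ} {h : ℝ} (hh : 0 < h) (hj : j ≤ ℓ) (i : Fin j → Fin d) :
    (fun v : E d => ∏ m, v (i m)) ∈ polySpace d ℓ h := by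
  obtain ⟨s, c, hs⟩ := exists_prod_coord_eq_monoVec hj i
  refine ⟨Pi.single s (h ^ j * c), fun v => ?_⟩
  have := hs (h⁻¹ • v)
  simp only [PiLp.smul_apply, smul_eq_mul, Finset.prod_mul_distrib, Finset.prod_const,
    Finset.card_univ, Fintype.card_fin] at this
  rw [dotProduct_single, mul_comm, mul_assoc, ← this, inv_pow, mul_inv_cancel_left₀]
  positivity

end Monomials

/-! ### Hölder functions: modulus of continuity and local polynomial approximation. -/

section Holder

variable {d : ℕ} {β C : ℝ} {f : E d → ℝ}

theorem floorLT_lt (hβ : 0 < β) : (floorLT β : ℝ) < β := by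
  have h1 : 0 < ⌈β⌉₊ := Nat.ceil_pos.2 hβ
  have h2 := Nat.ceil_lt_add_one hβ.le
  unfold floorLT
  rw [Nat.cast_pred h1]
  linarith

/-- A priori only the sum of the two bounds is at most `C`. Each is nonnegative, the second by
testing on two points of the cube at distance 1, which needs `1 ≤ d`; hence each is at most `C`. -/
theorem IsHolder.exists_bounds (hd : 1 ≤ d) (hf : IsHolder β C f) :
    0 ≤ C ∧ (∀ k ≤ floorLT β, ∀ j : Fin k → Fin d, ∀ x ∈ cube d, |partialD f j x| ≤ C) ∧
    (∀ j : Fin (floorLT β) → Fin d, ∀ x ∈ cube d, ∀ z ∈ cube d,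
      |partialD f j x - partialD f j z| ≤ C * ‖x - z‖ ^ (β - floorLT β)) := by
  obtain ⟨_, a, b, hab, ha, hb⟩ := hf
  have ha0 : 0 ≤ a :=
    (abs_nonneg _).trans (ha 0 (Nat.zero_le _) Fin.elim0 0 zero_mem_cube)
  have hb0 : 0 ≤ b := by
    set e : E d := EuclideanSpace.single ⟨0, hd⟩ 1
    have he : e ∈ cube d := by
      intro i
      simp only [e, PiLp.single_apply, Set.mem_Icc]
      split_ifs <;> norm_num
    have := (abs_nonneg _).trans (hb (fun _ => ⟨0, hd⟩) e he 0 zero_mem_cube)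
    simpa [e] using this
  refine ⟨by linarith, fun k hk j x hx => (ha k hk j x hx).trans (by linarith),
    fun j x hx z hz => (hb j x hx z hz).trans ?_⟩
  gcongr
  linarith

theorem IsHolder.abs_le (hd : 1 ≤ d) (hf : IsHolder β C f) {x : E d} (hx : x ∈ cube d) :
    |f x| ≤ C := by
  have := (hf.exists_bounds hd).2.1 0 (Nat.zero_le _) Fin.elim0 x hx
  simpa [partialD] using this

/-- For `β ≤ 1` this is the Hölder condition of order zero. For `β > 1` the `d` first partial
derivatives are bounded, whence the factor `d`, and smoothness beyond order 1 does not improve the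
exponent. This is the source of `min 1 β` in the rate. -/
theorem IsHolder.abs_sub_le (hd : 1 ≤ d) (hf : IsHolder β C f) {x y : E d} (hx : x ∈ cube d)
    (hy : y ∈ cube d) : |f x - f y| ≤ d * C * ‖x - y‖ ^ min 1 β := by
  obtain ⟨hC, h1, h2⟩ := hf.exists_bounds hd
  have hd' : (1 : ℝ) ≤ d := by exact_mod_cast hd
  rcases le_or_gt β 1 with hβ | hβ
  · have h0 : floorLT β = 0 := by
      unfold floorLT
      have : ⌈β⌉₊ ≤ 1 := Nat.ceil_le.2 (by simpa using hβ)
      omega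
    rw [h0] at h2
    have := h2 Fin.elim0 x hx y hy
    simp only [partialD, iteratedFDerivWithin_zero_apply, Nat.cast_zero, sub_zero] at this
    rw [min_eq_right hβ]
    refine this.trans ?_
    gcongr
    exact le_mul_of_one_le_left hC hd'
  · have h0 : 1 ≤ floorLT β := by
      unfold floorLT
      have : 1 < ⌈β⌉₊ := Nat.lt_ceil.2 (by simpa using hβ)
      omega
    have hxy : y + (x - y) ∈ cube d := by simpa using hx
    have h3 := Convex.norm_image_sub_le_of_norm_hasDerivWithin_le (C := d * (‖x - y‖ * C))
      (fun t ht => hasDerivWithinAt_lineD hf.1 (by omega : 0 < floorLT β) hy hxy ht)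
      (fun t ht => by
        simpa using abs_lineD_le (v := x - y)
          (fun i => h1 1 h0 i _ (segment_mem_cube hy hxy ht)))
      (convex_Icc (0 : ℝ) 1) (Set.left_mem_Icc.2 zero_le_one) (Set.right_mem_Icc.2 zero_le_one)
    simp only [lineD_zero, one_smul, zero_smul, add_zero, sub_zero, norm_one, mul_one,
      Real.norm_eq_abs, add_sub_cancel] at h3
    rw [min_eq_left hβ.le, Real.rpow_one]
    linarith

/-- Approximation of a Hölder function by a polynomial in the monomial basis. -/
theorem IsHolder.exists_taylor (hd : 1 ≤ d) (hβ : 0 < β) (hf : IsHolder β C f) {ℓ : ℕ}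
    (hℓ : floorLT β ≤ ℓ) {h : ℝ} (hh : 0 < h) {u : E d} (hu : u ∈ cube d) :
    ∃ θ : MIdx d ℓ → ℝ, ∀ x ∈ cube d,
      |f x - monoVec ℓ (h⁻¹ • (x - u)) ⬝ᵥ θ| ≤ d ^ floorLT β * (C * ‖x - u‖ ^ β) := by
  obtain ⟨hC, -, h2⟩ := hf.exists_bounds hd
  set k := floorLT β with hk
  -- The Taylor polynomial is a combination of coordinate products of degree at most `ℓ`, so
  -- membership in a subspace yields `θ` without writing out its entries.
  have hmem : (fun v : E d => ∑ j ∈ Finset.range (k + 1), lineD f j u v / j.factorial) ∈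
      polySpace d ℓ h := by
    have : (fun v : E d => ∑ j ∈ Finset.range (k + 1), lineD f j u v / j.factorial) =
        ∑ j ∈ Finset.range (k + 1), ∑ i : Fin j → Fin d,
          (partialD f i u / j.factorial) • fun v : E d => ∏ m, v (i m) := by
      funext v
      simp only [Finset.sum_apply, Pi.smul_apply, smul_eq_mul, lineD_eq_sum, Finset.sum_div]
      refine Finset.sum_congr rfl fun j _ => Finset.sum_congr rfl fun i _ => by ring
    rw [this]
    refine Submodule.sum_mem _ fun j hj => Submodule.sum_mem _ fun i _ =>
      Submodule.smul_mem _ _ (prod_coord_mem_polySpace hh ?_ i)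
    have := Finset.mem_range.1 hj
    omega
  obtain ⟨θ, hθ⟩ := hmem
  refine ⟨θ, fun x hx => ?_⟩
  rw [← hθ]
  set v := x - u
  have hv : u + v ∈ cube d := by simpa [v] using hx
  -- Along the segment the derivative of order `k` varies by at most a multiple of `‖v‖ ^ k * ‖v‖ ^
  -- (β - k) = ‖v‖ ^ β`.
  have h3 := abs_sub_taylor_le k (fun j t => lineD f j (u + t • v) v)
    (A := d ^ k * (C * ‖v‖ ^ β))
    (fun j hj t ht => hasDerivWithinAt_lineD hf.1 hj hu hv ht)
    (fun t ht => by
      have h4 := abs_lineD_sub_le (v := v) (a := C * ‖v‖ ^ (β - k))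
        (fun i => (h2 i _ (segment_mem_cube hu hv ht) _
          (segment_mem_cube hu hv (Set.left_mem_Icc.2 zero_le_one))).trans (by
            gcongr
            · have := floorLT_lt hβ
              linarith
            · rw [zero_smul, add_zero, add_sub_cancel_left, norm_smul, Real.norm_eq_abs,
                abs_of_nonneg ht.1]
              exact mul_le_of_le_one_left (norm_nonneg _) ht.2))
      refine h4.trans_eq ?_
      have h5 : ‖v‖ ^ β = ‖v‖ ^ k * ‖v‖ ^ (β - k) := by
        rw [← Real.rpow_natCast, ← Real.rpow_add_of_nonneg (norm_nonneg _) (Nat.cast_nonneg _)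
          (sub_nonneg.2 (floorLT_lt hβ).le)]
        congr 1
        ring
      rw [h5]
      ring)
    1 (Set.right_mem_Icc.2 zero_le_one)
  simpa [lineD_zero, v] using h3

end Holder

/-! ### Exponential moments of localized variables. -/

section MGF

/-- For `0 ≤ x`, insert `exp x ≤ 1 + x * exp x` into itself. For `x ≤ 0`, combine it with `x * exp x
≤ x * (1 + x)`. -/
theorem exp_le_one_add_add_sq_mul_exp_abs (x : ℝ) :
    Real.exp x ≤ 1 + x + x ^ 2 * Real.exp |x| := by
  have h1 : Real.exp x ≤ 1 + x * Real.exp x := by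
    have h2 := Real.add_one_le_exp (-x)
    have h3 : Real.exp (-x) * Real.exp x = 1 := by rw [← Real.exp_add]; simp
    nlinarith [Real.exp_pos x]
  rcases le_total 0 x with hx | hx
  · rw [abs_of_nonneg hx]
    nlinarith [mul_le_mul_of_nonneg_left h1 hx]
  · rw [abs_of_nonpos hx]
    have h2 := Real.add_one_le_exp x
    have h3 : 1 ≤ Real.exp (-x) := Real.one_le_exp (by linarith)
    nlinarith [mul_le_mul_of_nonneg_left h3 (sq_nonneg x)]

theorem sq_le_two_mul_exp_abs (x : ℝ) : x ^ 2 ≤ 2 * Real.exp |x| := by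
  have := Real.quadratic_le_exp_of_nonneg (abs_nonneg x)
  rw [sq_abs] at this
  linarith [abs_nonneg x]

/-- The quadratic remainder lives on `S` only. After integration the variance proxy is therefore
proportional to the mass of `S`, not to 1. -/
theorem exp_mul_le_of_eq_zero_off {Ω : Type*} {V : Ω → ℝ} {S : Set Ω} (hVS : ∀ ω ∉ S, V ω = 0) {t : ℝ}
    (ht : |t| ≤ 1) (ω : Ω) : Real.exp (t * V ω) ≤
      1 + t * V ω + 2 * t ^ 2 * S.indicator (fun ω => Real.exp (2 * |V ω|)) ω := by
  by_cases hω : ω ∈ S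
  · rw [Set.indicator_of_mem hω]
    refine (exp_le_one_add_add_sq_mul_exp_abs _).trans ?_
    have h1 : Real.exp |t * V ω| ≤ Real.exp |V ω| := by
      rw [abs_mul]
      gcongr
      exact mul_le_of_le_one_left (abs_nonneg _) ht
    have h2 : Real.exp (2 * |V ω|) = Real.exp |V ω| * Real.exp |V ω| := by
      rw [← Real.exp_add, two_mul]
    have h3 := sq_le_two_mul_exp_abs (V ω)
    have h4 : (t * V ω) ^ 2 * Real.exp |t * V ω| ≤ t ^ 2 * (2 * Real.exp |V ω|) * Real.exp |V ω| := by
      rw [mul_pow]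
      gcongr
    rw [h2]
    linarith
  · rw [hVS ω hω, Set.indicator_of_notMem hω]
    simp

variable {Ω : Type*} [MeasurableSpace Ω] {P : Measure Ω} [IsProbabilityMeasure P]

theorem integrable_exp_mul_of_eq_zero_off {V : Ω → ℝ} {S : Set Ω} (hS : MeasurableSet S)
    (hV : Measurable V) (hVS : ∀ ω ∉ S, V ω = 0) (hVi : Integrable V P)
    (hexp : IntegrableOn (fun ω => Real.exp (2 * |V ω|)) S P) {t : ℝ} (ht : |t| ≤ 1) :
    Integrable (fun ω => Real.exp (t * V ω)) P := by
  refine Integrable.mono' (((integrable_const 1).add (hVi.const_mul t)).add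
    ((hexp.integrable_indicator hS).const_mul (2 * t ^ 2))) (by fun_prop)
    (Eventually.of_forall fun ω => ?_)
  rw [Real.norm_eq_abs, Real.abs_exp]
  exact exp_mul_le_of_eq_zero_off hVS ht ω

/-- A Bernstein-type bound: integrate the pointwise expansion, then use `1 + y ≤ exp y`. -/
theorem integral_exp_mul_le_of_eq_zero_off {V : Ω → ℝ} {S : Set Ω} (hS : MeasurableSet S)
    (hV : Measurable V) (hVS : ∀ ω ∉ S, V ω = 0) (hVi : Integrable V P)
    (hexp : IntegrableOn (fun ω => Real.exp (2 * |V ω|)) S P) {A : ℝ}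
    (hA : ∫ ω in S, Real.exp (2 * |V ω|) ∂P ≤ A) {t : ℝ} (ht : |t| ≤ 1) :
    ∫ ω, Real.exp (t * V ω) ∂P ≤ Real.exp (t * ∫ ω, V ω ∂P + 2 * A * t ^ 2) := by
  have hi := (hexp.integrable_indicator hS).const_mul (2 * t ^ 2)
  have hi' : Integrable (fun ω => 1 + t * V ω) P := (integrable_const 1).add (hVi.const_mul t)
  calc ∫ ω, Real.exp (t * V ω) ∂P
      ≤ ∫ ω, (1 + t * V ω + 2 * t ^ 2 * S.indicator (fun ω => Real.exp (2 * |V ω|)) ω) ∂P :=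
        integral_mono (integrable_exp_mul_of_eq_zero_off hS hV hVS hVi hexp ht) (hi'.add hi)
          (exp_mul_le_of_eq_zero_off hVS ht)
    _ = 1 + t * ∫ ω, V ω ∂P + 2 * t ^ 2 * ∫ ω in S, Real.exp (2 * |V ω|) ∂P := by
        rw [integral_add hi' hi, integral_add (integrable_const 1) (hVi.const_mul t),
          integral_const_mul, integral_const_mul, integral_indicator hS]
        simp
    _ ≤ t * ∫ ω, V ω ∂P + 2 * A * t ^ 2 + 1 := by nlinarith [sq_nonneg t]
    _ ≤ _ := Real.add_one_le_exp _

/-- Exponential moment of a sum of i.i.d. variables that satisfy a local sub-Gaussian bound. -/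
theorem lintegral_exp_abs_sum_sub_le {V : Ω → ℝ} {a m : ℝ}
    (hi : ∀ t : ℝ, |t| ≤ 1 → Integrable (fun ω => Real.exp (t * V ω)) P)
    (hle : ∀ t : ℝ, |t| ≤ 1 → ∫ ω, Real.exp (t * V ω) ∂P ≤ Real.exp (t * m + a * t ^ 2))
    (n : ℕ) {t : ℝ} (ht0 : 0 ≤ t) (ht : t ≤ 1) :
    ∫⁻ Z, ENNReal.ofReal (Real.exp (t * |∑ i, V (Z i) - n * m|)) ∂(Measure.pi fun _ : Fin n => P)
      ≤ ENNReal.ofReal (2 * Real.exp (n * a * t ^ 2)) := by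
  have key : ∀ s : ℝ, |s| ≤ 1 →
      Integrable (fun Z : Fin n → Ω => Real.exp (s * (∑ i, V (Z i) - n * m)))
        (Measure.pi fun _ => P) ∧
      ∫ Z : Fin n → Ω, Real.exp (s * (∑ i, V (Z i) - n * m)) ∂(Measure.pi fun _ => P) ≤
        Real.exp (n * a * s ^ 2) := by
    intro s hs
    have heq : (fun Z : Fin n → Ω => Real.exp (s * (∑ i, V (Z i) - n * m))) =
        fun Z => Real.exp (-(s * (n * m))) * ∏ i, Real.exp (s * V (Z i)) := by
      funext Z
      rw [← Real.exp_sum, ← Real.exp_add, ← Finset.mul_sum]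
      ring_nf
    constructor
    · rw [heq]
      exact (Integrable.fintype_prod (f := fun _ ω => Real.exp (s * V ω))
        fun _ => hi s hs).const_mul _
    · rw [heq, integral_const_mul,
        integral_fintype_prod_eq_pow (ι := Fin n) (fun ω => Real.exp (s * V ω)), Fintype.card_fin]
      calc _ ≤ Real.exp (-(s * (n * m))) * Real.exp (s * m + a * s ^ 2) ^ n :=
            mul_le_mul_of_nonneg_left (pow_le_pow_left₀
              (integral_nonneg fun ω => (Real.exp_pos _).le) (hle s hs) n) (Real.exp_pos _).le
        _ = _ := by
            rw [← Real.exp_nat_mul, ← Real.exp_add]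
            ring_nf
  have hp := key t (by rwa [abs_of_nonneg ht0])
  have hm := key (-t) (by rwa [abs_neg, abs_of_nonneg ht0])
  calc _ ≤ ∫⁻ Z : Fin n → Ω, ENNReal.ofReal (Real.exp (t * (∑ i, V (Z i) - n * m)) +
          Real.exp (-t * (∑ i, V (Z i) - n * m))) ∂(Measure.pi fun _ => P) := by
        -- The absolute value is removed by `exp (t * |y|) ≤ exp (t * y) + exp (-t * y)`, which
        -- costs the factor 2.
        refine lintegral_mono fun Z => ENNReal.ofReal_le_ofReal ?_
        rcases abs_cases (∑ i, V (Z i) - n * m) with h | h <;> rw [h.1]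
        · exact le_add_of_nonneg_right (Real.exp_pos _).le
        · rw [mul_neg, ← neg_mul]
          exact le_add_of_nonneg_left (Real.exp_pos _).le
    _ ≤ _ := by
        have hsum : Integrable (fun Z : Fin n → Ω => Real.exp (t * (∑ i, V (Z i) - n * m)) +
          Real.exp (-t * (∑ i, V (Z i) - n * m))) (Measure.pi fun _ => P) := hp.1.add hm.1
        rw [← ofReal_integral_eq_lintegral_ofReal hsum
          (Eventually.of_forall fun _ => by positivity)]
        refine ENNReal.ofReal_le_ofReal ?_
        rw [integral_add hp.1 hm.1]
        have := hm.2
        rw [neg_sq] at this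
        linarith [hp.2]

end MGF

/-! ### Design points and residuals under a law of the class. -/

section Observation

variable {d : ℕ} {β Cβ μmin μmax : ℝ} {σ : ℝ≥0} {P : Measure (E d × ℝ)} [IsProbabilityMeasure P]
  {f : E d → ℝ}

/-- The residual `Y - f(X)`, with `f` extended by zero outside of the cube. -/
noncomputable def resid (f : E d → ℝ) (w : E d × ℝ) : ℝ := w.2 - (cube d).indicator f w.1

theorem IsHolder.measurable_indicator (hf : IsHolder β Cβ f) :
    Measurable ((cube d).indicator f) := by
  classical
  rw [← Set.piecewise_eq_indicator]
  exact hf.1.continuousOn.measurable_piecewise continuousOn_const measurableSet_cube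

theorem IsHolder.measurable_resid (hf : IsHolder β Cβ f) : Measurable (resid f) :=
  measurable_snd.sub (hf.measurable_indicator.comp measurable_fst)

theorem InClass.ae_mem_cube (hP : InClass β Cβ μmin μmax σ P f) : ∀ᵐ w ∂P, w.1 ∈ cube d := by
  obtain ⟨p, hp, -, hν⟩ := hP.density
  have h1 : ∀ᵐ x ∂(P.map Prod.fst), x ∈ cube d := by
    rw [hν]
    exact (withDensity_absolutelyContinuous _ _).ae_le (ae_restrict_mem measurableSet_cube)
  exact ae_of_ae_map measurable_fst.aemeasurable h1

theorem InClass.resid_ae_eq (hP : InClass β Cβ μmin μmax σ P f) :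
    (fun w : E d × ℝ => w.2 - f w.1) =ᵐ[P] resid f := by
  filter_upwards [hP.ae_mem_cube] with w hw
  rw [resid, Set.indicator_of_mem hw]

/-- The volume of the unit ball. -/
noncomputable def ballVol (d : ℕ) : ℝ := (volume (Metric.ball (0 : E d) 1)).toReal

/-- Through the bounded density a ball of radius `h` has mass of order `h ^ d`; this makes `n * h ^
d` the local sample size. -/
theorem InClass.measure_closedBall_le (hP : InClass β Cβ μmin μmax σ P f) (hμ : 0 ≤ μmax)
    (u : E d) {R : ℝ} (hR : 0 ≤ R) :
    P.real (Prod.fst ⁻¹' Metric.closedBall u R) ≤ μmax * ballVol d * R ^ d := by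
  obtain ⟨p, hp, hb, hν⟩ := hP.density
  refine ENNReal.toReal_le_of_le_ofReal
    (by unfold ballVol; positivity) ?_
  rw [← Measure.map_apply measurable_fst Metric.isClosed_closedBall.measurableSet, hν,
    withDensity_apply _ Metric.isClosed_closedBall.measurableSet]
  calc _ ≤ ∫⁻ x in Metric.closedBall u R, ENNReal.ofReal μmax ∂(volume.restrict (cube d)) := by
        refine lintegral_mono_ae (ae_restrict_of_ae ?_)
        filter_upwards [ae_restrict_mem measurableSet_cube] with x hx
        exact ENNReal.ofReal_le_ofReal (hb x hx).2.le
    _ = ENNReal.ofReal μmax * (volume.restrict (cube d)) (Metric.closedBall u R) := by simp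
    _ ≤ ENNReal.ofReal μmax * volume (Metric.closedBall u R) := by
        gcongr
        exact Measure.restrict_le_self
    _ = _ := by
        rw [Measure.addHaar_closedBall _ _ hR, ballVol, mul_assoc, ENNReal.ofReal_mul hμ, mul_comm,
          ENNReal.ofReal_mul ENNReal.toReal_nonneg, ENNReal.ofReal_toReal measure_ball_lt_top.ne]
        simp [mul_comm]

theorem InClass.integrable_resid (hP : InClass β Cβ μmin μmax σ P f) (hd : 1 ≤ d) :
    Integrable (resid f) P := by
  refine hP.integrable.sub (Integrable.mono' (integrable_const Cβ)
    (hP.holder.measurable_indicator.comp measurable_fst).aestronglyMeasurable ?_)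
  filter_upwards [hP.ae_mem_cube] with w hw
  rw [Set.indicator_of_mem hw]
  exact hP.holder.abs_le hd hw

/-- The weight is measurable with respect to `X`, so it can be pulled out of the conditional
expectation of the residual, which vanishes. -/
theorem InClass.integral_resid_mul (hP : InClass β Cβ μmin μmax σ P f) (hd : 1 ≤ d)
    {g : E d → ℝ} (hg : Measurable g) {b : ℝ} (hb : ∀ x, |g x| ≤ b) :
    ∫ w, resid f w * g w.1 ∂P = 0 := by
  have hm : sigmaX d ≤ (inferInstance : MeasurableSpace (E d × ℝ)) := measurable_fst.comap_le
  have hsm : ∀ k : E d → ℝ, Measurable k →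
      StronglyMeasurable[sigmaX d] fun w : E d × ℝ => k w.1 := fun k hk =>
    Measurable.stronglyMeasurable (hk.comp (comap_measurable Prod.fst))
  have hfi : Integrable (fun w : E d × ℝ => (cube d).indicator f w.1) P := by
    have := hP.integrable.sub (hP.integrable_resid hd)
    simpa [resid, Pi.sub_def] using this
  have h0 : P[resid f | sigmaX d] =ᵐ[P] 0 := by
    have h1 : P[resid f | sigmaX d] =ᵐ[P]
        P[(fun w : E d × ℝ => w.2) | sigmaX d] -
          P[(fun w : E d × ℝ => (cube d).indicator f w.1) | sigmaX d] :=
      condExp_sub hP.integrable hfi _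
    rw [condExp_of_stronglyMeasurable hm (hsm _ hP.holder.measurable_indicator) hfi] at h1
    filter_upwards [h1, hP.regression, hP.ae_mem_cube] with w h1 h2 h3
    rw [h1, Pi.sub_apply, h2, Set.indicator_of_mem h3]
    simp
  have hint : Integrable ((fun w : E d × ℝ => g w.1) * resid f) P := by
    refine (hP.integrable_resid hd).bdd_mul (c := b) (hg.comp measurable_fst).aestronglyMeasurable
      (Eventually.of_forall fun w => hb w.1)
  have h2 := condExp_mul_of_stronglyMeasurable_left (hsm g hg) hint (hP.integrable_resid hd)
  calc ∫ w, resid f w * g w.1 ∂P = ∫ w, ((fun w : E d × ℝ => g w.1) * resid f) w ∂P := by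
        simp [mul_comm]
    _ = ∫ w, (P[(fun w : E d × ℝ => g w.1) * resid f | sigmaX d]) w ∂P := (integral_condExp hm).symm
    _ = ∫ w, (0 : ℝ) ∂P := by
        refine integral_congr_ae ?_
        filter_upwards [h2, h0] with w h2 h0
        rw [h2, Pi.mul_apply, h0]
        simp
    _ = 0 := by simp

theorem InClass.integrable_exp_mul_resid (hP : InClass β Cβ μmin μmax σ P f) (t : ℝ) :
    Integrable (fun w => Real.exp (t * resid f w)) P := by
  refine (hP.subgaussian.integrable_exp_mul t).congr ?_
  filter_upwards [hP.resid_ae_eq] with w hw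
  rw [hw]

/-- The event depends on `X` only, so the conditional sub-Gaussian bound can be integrated over it
and the factor `P(X ∈ S)` survives. -/
theorem InClass.setIntegral_exp_mul_resid_le (hP : InClass β Cβ μmin μmax σ P f) (t : ℝ)
    {S : Set (E d)} (hS : MeasurableSet S) :
    ∫ w in Prod.fst ⁻¹' S, Real.exp (t * resid f w) ∂P ≤
      Real.exp (σ ^ 2 * t ^ 2 / 2) * P.real (Prod.fst ⁻¹' S) := by
  have hm : sigmaX d ≤ (inferInstance : MeasurableSpace (E d × ℝ)) := measurable_fst.comap_le
  have hS' : MeasurableSet[sigmaX d] (Prod.fst ⁻¹' S : Set (E d × ℝ)) := ⟨S, hS, rfl⟩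
  calc _ = ∫ w in Prod.fst ⁻¹' S, Real.exp (t * (w.2 - f w.1)) ∂P := by
        refine integral_congr_ae (ae_restrict_of_ae ?_)
        filter_upwards [hP.resid_ae_eq] with w hw
        rw [← hw]
    _ = ∫ w in Prod.fst ⁻¹' S, (P[fun w => Real.exp (t * (w.2 - f w.1)) | sigmaX d]) w ∂P :=
        (setIntegral_condExp hm (hP.subgaussian.integrable_exp_mul t) hS').symm
    _ ≤ ∫ w in Prod.fst ⁻¹' S, Real.exp (σ ^ 2 * t ^ 2 / 2) ∂P := by
        refine integral_mono_ae integrable_condExp.integrableOn (integrable_const _)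
          (ae_restrict_of_ae ?_)
        filter_upwards [hP.subgaussian.ae_condExp_le t] with w hw
        simpa using hw
    _ = _ := by simp [mul_comm]

theorem InClass.integrable_exp_mul_abs_resid (hP : InClass β Cβ μmin μmax σ P f) (t : ℝ) :
    Integrable (fun w => Real.exp (t * |resid f w|)) P := by
  refine Integrable.mono' ((hP.integrable_exp_mul_resid t).add (hP.integrable_exp_mul_resid (-t)))
    (Real.measurable_exp.comp ((hP.holder.measurable_resid.abs).const_mul t)).aestronglyMeasurable
    (Eventually.of_forall fun w => ?_)
  rw [Real.norm_eq_abs, Real.abs_exp, Pi.add_apply]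
  rcases abs_cases (resid f w) with h | h <;> rw [h.1]
  · exact le_add_of_nonneg_right (Real.exp_pos _).le
  · rw [mul_neg, ← neg_mul]
    exact le_add_of_nonneg_left (Real.exp_pos _).le

theorem InClass.setIntegral_exp_mul_abs_resid_le (hP : InClass β Cβ μmin μmax σ P f) (t : ℝ)
    {S : Set (E d)} (hS : MeasurableSet S) :
    ∫ w in Prod.fst ⁻¹' S, Real.exp (t * |resid f w|) ∂P ≤
      2 * Real.exp (σ ^ 2 * t ^ 2 / 2) * P.real (Prod.fst ⁻¹' S) := by
  calc _ ≤ ∫ w in Prod.fst ⁻¹' S, (Real.exp (t * resid f w) + Real.exp (-t * resid f w)) ∂P := by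
        refine integral_mono (hP.integrable_exp_mul_abs_resid t).integrableOn
          ((hP.integrable_exp_mul_resid t).add (hP.integrable_exp_mul_resid (-t))).integrableOn
          fun w => ?_
        dsimp only
        rcases abs_cases (resid f w) with h | h <;> rw [h.1]
        · exact le_add_of_nonneg_right (Real.exp_pos _).le
        · rw [mul_neg, ← neg_mul]
          exact le_add_of_nonneg_left (Real.exp_pos _).le
    _ ≤ _ := by
        rw [integral_add (hP.integrable_exp_mul_resid t).integrableOn
          (hP.integrable_exp_mul_resid (-t)).integrableOn]
        have h1 := hP.setIntegral_exp_mul_resid_le t hS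
        have h2 := hP.setIntegral_exp_mul_resid_le (-t) hS
        rw [neg_sq] at h2
        linarith

/-- Exponential moments of weighted residual sums with a localized weight. -/
theorem InClass.lintegral_exp_abs_sum_resid_le (hP : InClass β Cβ μmin μmax σ P f) (hd : 1 ≤ d)
    {g : E d → ℝ} (hg : Measurable g) {b : ℝ} (hb : ∀ x, |g x| ≤ b) {S : Set (E d)}
    (hS : MeasurableSet S) (hgS : ∀ x ∉ S, g x = 0) {v : ℝ}
    (hv : P.real (Prod.fst ⁻¹' S) ≤ v) (n : ℕ) {t : ℝ} (ht0 : 0 ≤ t) (ht : t ≤ 1) :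
    ∫⁻ Z, ENNReal.ofReal (Real.exp (t * |∑ i, resid f (Z i) * g (Z i).1|)) ∂(sampleLaw P n) ≤
      ENNReal.ofReal (2 * Real.exp (n * (4 * Real.exp (2 * σ ^ 2 * b ^ 2) * v) * t ^ 2)) := by
  have hb0 : 0 ≤ b := (abs_nonneg _).trans (hb 0)
  set V : E d × ℝ → ℝ := fun w => resid f w * g w.1 with hV
  have hVm : Measurable V := hP.holder.measurable_resid.mul (hg.comp measurable_fst)
  have hS' : MeasurableSet (Prod.fst ⁻¹' S : Set (E d × ℝ)) := measurable_fst hS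
  have hVS : ∀ w ∉ (Prod.fst ⁻¹' S : Set (E d × ℝ)), V w = 0 := fun w hw => by
    simp [hV, hgS w.1 hw]
  have hVi : Integrable V P := (hP.integrable_resid hd).mul_bdd (c := b)
    (hg.comp measurable_fst).aestronglyMeasurable (Eventually.of_forall fun w => hb w.1)
  have hle : ∀ w, Real.exp (2 * |V w|) ≤ Real.exp (2 * b * |resid f w|) := fun w => by
    have h1 : |V w| ≤ |resid f w| * b := by
      rw [hV, abs_mul]
      exact mul_le_mul_of_nonneg_left (hb _) (abs_nonneg _)
    exact Real.exp_le_exp.2 (by linarith)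
  have hexp : Integrable (fun w => Real.exp (2 * |V w|)) P := by
    refine Integrable.mono' (hP.integrable_exp_mul_abs_resid (2 * b))
      (Real.measurable_exp.comp (hVm.abs.const_mul 2)).aestronglyMeasurable
      (Eventually.of_forall fun w => ?_)
    rw [Real.norm_eq_abs, Real.abs_exp]
    exact hle w
  have hA : ∫ w in Prod.fst ⁻¹' S, Real.exp (2 * |V w|) ∂P ≤
      2 * Real.exp (2 * σ ^ 2 * b ^ 2) * v := by
    refine (integral_mono hexp.integrableOn
      (hP.integrable_exp_mul_abs_resid (2 * b)).integrableOn hle).trans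
      ((hP.setIntegral_exp_mul_abs_resid_le (2 * b) hS).trans ?_)
    rw [show (σ : ℝ) ^ 2 * (2 * b) ^ 2 / 2 = 2 * σ ^ 2 * b ^ 2 by ring]
    gcongr
  have h0 : ∫ w, V w ∂P = 0 := hP.integral_resid_mul hd hg hb
  have := lintegral_exp_abs_sum_sub_le (P := P) (V := V) (m := 0)
    (a := 4 * Real.exp (2 * σ ^ 2 * b ^ 2) * v)
    (fun s hs => integrable_exp_mul_of_eq_zero_off hS' hVm hVS hVi hexp.integrableOn hs)
    (fun s hs => by
      have h2 := integral_exp_mul_le_of_eq_zero_off hS' hVm hVS hVi hexp.integrableOn hA hs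
      rw [h0] at h2
      convert h2 using 2
      ring) n ht0 ht
  simpa using this

/-- Exponential moments of centred sums of a localized bounded function of the design. -/
theorem lintegral_exp_abs_sum_sub_integral_le
    {g : E d → ℝ} (hg : Measurable g) {b : ℝ} (hb : ∀ x, |g x| ≤ b) {S : Set (E d)}
    (hS : MeasurableSet S) (hgS : ∀ x ∉ S, g x = 0) {v : ℝ}
    (hv : P.real (Prod.fst ⁻¹' S) ≤ v) (n : ℕ) {t : ℝ} (ht0 : 0 ≤ t) (ht : t ≤ 1) :
    ∫⁻ Z, ENNReal.ofReal (Real.exp (t * |∑ i, g (Z i).1 - n * ∫ w, g w.1 ∂P|)) ∂(sampleLaw P n) ≤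
      ENNReal.ofReal (2 * Real.exp (n * (2 * Real.exp (2 * b) * v) * t ^ 2)) := by
  set V : E d × ℝ → ℝ := fun w => g w.1 with hV
  have hVm : Measurable V := hg.comp measurable_fst
  have hS' : MeasurableSet (Prod.fst ⁻¹' S : Set (E d × ℝ)) := measurable_fst hS
  have hVS : ∀ w ∉ (Prod.fst ⁻¹' S : Set (E d × ℝ)), V w = 0 := fun w hw => hgS w.1 hw
  have hVi : Integrable V P := Integrable.mono' (integrable_const b) hVm.aestronglyMeasurable
    (Eventually.of_forall fun w => hb w.1)
  have hle : ∀ w, Real.exp (2 * |V w|) ≤ Real.exp (2 * b) := fun w => by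
    gcongr
    exact hb _
  have hexp : Integrable (fun w => Real.exp (2 * |V w|)) P := by
    refine Integrable.mono' (integrable_const (Real.exp (2 * b)))
      (Real.measurable_exp.comp (hVm.abs.const_mul 2)).aestronglyMeasurable
      (Eventually.of_forall fun w => ?_)
    rw [Real.norm_eq_abs, Real.abs_exp]
    exact hle w
  have hA : ∫ w in Prod.fst ⁻¹' S, Real.exp (2 * |V w|) ∂P ≤ Real.exp (2 * b) * v := by
    refine (integral_mono hexp.integrableOn (integrable_const _) hle).trans ?_
    rw [setIntegral_const, smul_eq_mul, mul_comm]
    gcongr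
  exact lintegral_exp_abs_sum_sub_le (P := P) (V := V)
    (fun s hs => integrable_exp_mul_of_eq_zero_off hS' hVm hVS hVi hexp.integrableOn hs)
    (fun s hs => by
      have h2 := integral_exp_mul_le_of_eq_zero_off hS' hVm hVS hVi hexp.integrableOn hA hs
      convert h2 using 2
      ring) n ht0 ht

end Observation

/-- The kernel bounds with named constants. -/
structure IsKernelWith {d : ℕ} (K : E d → ℝ) (Kmin Kmax Δ : ℝ) : Prop where
  measurable : Measurable K
  Kmin_pos : 0 < Kmin
  Kmax_pos : 0 < Kmax
  radius_pos : 0 < Δ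
  nonneg : ∀ x, 0 ≤ K x
  le : ∀ x, K x ≤ Kmax
  eq_zero : ∀ x, 1 < ‖x‖ → K x = 0
  ge : ∀ x, ‖x‖ ≤ Δ → Kmin ≤ K x

theorem IsKernel.exists_isKernelWith {d : ℕ} {K : E d → ℝ} (hK : IsKernel K) :
    ∃ Kmin Kmax Δ, IsKernelWith K Kmin Kmax Δ := by
  obtain ⟨hm, Kmin, Kmax, Δ, h1, h2, h3, -, h5⟩ := hK
  have hmax : 0 < Kmax := h1.trans h2
  have h0 : ∀ x, 0 ≤ K x := fun x =>
    (Set.indicator_nonneg (fun _ _ => h1.le) x).trans (h5 x).1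
  refine ⟨Kmin, Kmax, Δ, hm, h1, hmax, h3, h0, fun x => (h5 x).2.trans ?_, fun x hx => ?_,
    fun x hx => ?_⟩
  · exact Set.indicator_le_self' (fun _ _ => hmax.le) x
  · have := (h5 x).2
    rw [Set.indicator_of_notMem (by simpa using hx)] at this
    exact le_antisymm this (h0 x)
  · have := (h5 x).1
    rwa [Set.indicator_of_mem (by simpa using hx)] at this

/-! ### Size and linear independence of the monomials. -/

section MonoVec

variable {d ℓ : ℕ}

theorem continuous_monoVec (s : MIdx d ℓ) : Continuous fun x : E d => monoVec ℓ x s := by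
  unfold monoVec
  fun_prop

theorem continuous_monoVec_dotProduct (v : MIdx d ℓ → ℝ) :
    Continuous fun x : E d => monoVec ℓ x ⬝ᵥ v := by
  unfold dotProduct
  exact continuous_finsetSum _ fun s _ => (continuous_monoVec s).mul continuous_const

theorem abs_monoVec_le {R : ℝ} (hR : 1 ≤ R) {x : E d} (hx : ‖x‖ ≤ R) (s : MIdx d ℓ) :
    |monoVec ℓ x s| ≤ R ^ ℓ := by
  unfold monoVec
  rw [Finset.abs_prod]
  calc ∏ i, |x i ^ (s.1 i : ℕ) / ((s.1 i : ℕ).factorial : ℝ)| ≤ ∏ i, R ^ (s.1 i : ℕ) := by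
        refine Finset.prod_le_prod (fun _ _ => abs_nonneg _) fun i _ => ?_
        rw [abs_div, abs_pow, Nat.abs_cast]
        refine (div_le_self (by positivity) ?_).trans ?_
        · exact_mod_cast Nat.one_le_iff_ne_zero.2 (Nat.factorial_ne_zero _)
        · gcongr
          exact (PiLp.norm_apply_le x i).trans hx
    _ = R ^ (∑ i, (s.1 i : ℕ)) := Finset.prod_pow_eq_pow_sum _ _ _
    _ ≤ R ^ ℓ := pow_le_pow_right₀ hR s.2

/-- The monomials are linearly independent on every product of infinite sets. -/
theorem eq_zero_of_monoVec_dotProduct_eq_zero {S : Fin d → Set ℝ} (hS : ∀ i, (S i).Infinite)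
    {v : MIdx d ℓ → ℝ} (h : ∀ x : E d, (∀ i, x i ∈ S i) → monoVec ℓ x ⬝ᵥ v = 0) : v = 0 := by
  classical
  let e : MIdx d ℓ → (Fin d →₀ ℕ) := fun s => Finsupp.equivFunOnFinite.symm fun i => (s.1 i : ℕ)
  have he : Function.Injective e := by
    intro s t hst
    have := Finsupp.equivFunOnFinite.symm.injective hst
    ext i
    exact congrFun this i
  set p : MvPolynomial (Fin d) ℝ :=
    ∑ s, MvPolynomial.monomial (e s) (v s / ∏ i, ((s.1 i : ℕ).factorial : ℝ)) with hp
  -- A polynomial that vanishes on a product of infinite sets is zero. Distinct multi-indices give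
  -- distinct exponents, so its coefficients are the entries of `v` up to factorials.
  have hp0 : p = 0 := by
    refine MvPolynomial.funext_set S hS fun x hx => ?_
    rw [map_zero, ← h (WithLp.toLp 2 x) (fun i => hx i (Set.mem_univ i)), hp, map_sum]
    refine Finset.sum_congr rfl fun s _ => ?_
    rw [MvPolynomial.eval_monomial, Finsupp.prod_fintype _ _ (fun _ => pow_zero _)]
    simp only [monoVec, Finset.prod_div_distrib, e, Finsupp.equivFunOnFinite_symm_apply_apply]
    ring
  funext s
  have h1 : MvPolynomial.coeff (e s) p = v s / ∏ i, ((s.1 i : ℕ).factorial : ℝ) := by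
    rw [hp, MvPolynomial.coeff_sum, Finset.sum_eq_single s]
    · simp
    · intro t _ hts
      rw [MvPolynomial.coeff_monomial, if_neg fun h => hts (he h)]
    · simp
  rw [hp0, MvPolynomial.coeff_zero] at h1
  have h2 : (∏ i, ((s.1 i : ℕ).factorial : ℝ)) ≠ 0 :=
    Finset.prod_ne_zero_iff.2 fun i _ => by positivity
  rcases div_eq_zero_iff.1 h1.symm with h3 | h3
  · exact h3
  · exact absurd h3 h2

end MonoVec

/-! ### Coercivity of the monomial Gram matrix on orthant boxes. -/

section Orthants

variable {d ℓ : ℕ}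

/-- The side of the orthant box in one coordinate. -/
def orthantSide (δ : ℝ) (b : Bool) : Set ℝ := if b then Set.Ioo 0 δ else Set.Ioo (-δ) 0

/-- The open box with side lengths `δ` at the origin in the orthant given by the signs `b`. -/
def orthantBox (δ : ℝ) (b : Fin d → Bool) : Set (E d) := {z | ∀ i, z i ∈ orthantSide δ (b i)}

theorem isOpen_orthantBox (δ : ℝ) (b : Fin d → Bool) : IsOpen (orthantBox δ b) := by
  have : orthantBox δ b = ⋂ i, {z : E d | z i ∈ orthantSide δ (b i)} := by
    ext; simp [orthantBox]
  rw [this]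
  refine isOpen_iInter_of_finite fun i => IsOpen.preimage (by fun_prop : Continuous fun z : E d => z i) ?_
  unfold orthantSide
  split_ifs
  · exact isOpen_Ioo
  · exact isOpen_Ioo

theorem infinite_orthantSide {δ : ℝ} (hδ : 0 < δ) (b : Bool) : (orthantSide δ b).Infinite := by
  unfold orthantSide
  split_ifs
  · exact Set.Ioo_infinite hδ
  · exact Set.Ioo_infinite (by linarith)

theorem abs_le_of_mem_orthantSide {δ : ℝ} {b : Bool} {z : ℝ} (hz : z ∈ orthantSide δ b) :
    |z| ≤ δ := by
  unfold orthantSide at hz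
  rw [abs_le]
  split_ifs at hz <;> constructor <;> linarith [hz.1, hz.2]

theorem norm_le_of_mem_orthantBox {δ : ℝ} (hδ : 0 ≤ δ) {b : Fin d → Bool} {z : E d}
    (hz : z ∈ orthantBox δ b) : ‖z‖ ≤ d * δ := by
  rw [EuclideanSpace.norm_eq]
  refine Real.sqrt_le_iff.2 ⟨by positivity, ?_⟩
  calc ∑ i, ‖z i‖ ^ 2 ≤ ∑ _i : Fin d, δ ^ 2 := by
        refine Finset.sum_le_sum fun i _ => ?_
        gcongr
        exact abs_le_of_mem_orthantSide (hz i)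
    _ = d * δ ^ 2 := by simp
    _ ≤ (d * δ) ^ 2 := by
        rw [mul_pow]
        gcongr
        exact_mod_cast Nat.le_self_pow two_ne_zero d

theorem integrableOn_orthantBox {δ : ℝ} (hδ : 0 ≤ δ) (b : Fin d → Bool) {g : E d → ℝ}
    (hg : Continuous g) : IntegrableOn g (orthantBox δ b) :=
  (hg.continuousOn.integrableOn_compact (isCompact_closedBall (0 : E d) (d * δ))).mono_set
    fun z hz => by simpa using norm_le_of_mem_orthantBox hδ hz

/-- The square is continuous, so a zero integral would force the polynomial to vanish on the whole
open box, against linear independence. -/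
theorem setIntegral_sq_pos {δ : ℝ} (hδ : 0 < δ) (b : Fin d → Bool) {v : MIdx d ℓ → ℝ}
    (hv : v ≠ 0) : 0 < ∫ z in orthantBox δ b, (monoVec ℓ z ⬝ᵥ v) ^ 2 := by
  have hc : Continuous fun z : E d => (monoVec ℓ z ⬝ᵥ v) ^ 2 :=
    (continuous_monoVec_dotProduct v).pow 2
  rw [setIntegral_pos_iff_support_of_nonneg_ae (Eventually.of_forall fun z => sq_nonneg _)
    (integrableOn_orthantBox hδ.le b hc)]
  refine IsOpen.measure_pos _ (hc.isOpen_support.inter (isOpen_orthantBox δ b)) ?_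
  by_contra hne
  refine hv (eq_zero_of_monoVec_dotProduct_eq_zero
    (fun i => infinite_orthantSide hδ (b i)) fun z hz => ?_)
  by_contra h0
  exact hne ⟨z, pow_ne_zero 2 h0, hz⟩

/-- The least eigenvalue is attained because the spectrum is finite, and its eigenvector shows that
it is positive. -/
theorem exists_coercive_of_pos {ι : Type*} [Fintype ι] [DecidableEq ι] [Nonempty ι]
    {B : Matrix ι ι ℝ} (hs : B.IsHermitian) (hB : ∀ v, v ≠ 0 → 0 < v ⬝ᵥ B.mulVec v) :
    ∃ c, 0 < c ∧ ∀ v, c * (v ⬝ᵥ v) ≤ v ⬝ᵥ B.mulVec v := by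
  refine ⟨lambdaMin B, ?_, coercive_of_le_lambdaMin hs le_rfl⟩
  have hmem : lambdaMin B ∈ spectrum ℝ B := by
    refine Set.Nonempty.csInf_mem ?_ Matrix.finite_real_spectrum
    rw [hs.spectrum_real_eq_range_eigenvalues]
    exact Set.range_nonempty _
  rw [← Matrix.spectrum_toLin', ← Module.End.hasEigenvalue_iff_mem_spectrum] at hmem
  obtain ⟨v, hv⟩ := hmem.exists_hasEigenvector
  have h1 := hv.apply_eq_smul
  rw [Matrix.toLin'_apply] at h1
  have h2 := hB v hv.2
  rw [h1, dotProduct_smul, smul_eq_mul] at h2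
  exact pos_of_mul_pos_left h2 (Finset.sum_nonneg fun s _ => mul_self_nonneg _)

/-- One constant serves all boxes because there are only finitely many orthants. -/
theorem exists_sq_integral_lower_bound (d ℓ : ℕ) {δ : ℝ} (hδ : 0 < δ) :
    ∃ c, 0 < c ∧ ∀ (b : Fin d → Bool) (v : MIdx d ℓ → ℝ),
      c * (v ⬝ᵥ v) ≤ ∫ z in orthantBox δ b, (monoVec ℓ z ⬝ᵥ v) ^ 2 := by
  have key : ∀ b : Fin d → Bool, ∃ c, 0 < c ∧ ∀ v : MIdx d ℓ → ℝ,
      c * (v ⬝ᵥ v) ≤ ∫ z in orthantBox δ b, (monoVec ℓ z ⬝ᵥ v) ^ 2 := by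
    intro b
    set G : Matrix (MIdx d ℓ) (MIdx d ℓ) ℝ :=
      Matrix.of fun s t => ∫ z in orthantBox δ b, monoVec ℓ z s * monoVec ℓ z t with hG
    have hquad : ∀ v, v ⬝ᵥ G.mulVec v = ∫ z in orthantBox δ b, (monoVec ℓ z ⬝ᵥ v) ^ 2 := by
      intro v
      have hi : ∀ s t, Integrable (fun z : E d => v s * (monoVec ℓ z s * monoVec ℓ z t * v t))
          (volume.restrict (orthantBox δ b)) := fun s t =>
        integrableOn_orthantBox hδ.le b (continuous_const.mul
          (((continuous_monoVec s).mul (continuous_monoVec t)).mul continuous_const))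
      have : ∀ z : E d, (monoVec ℓ z ⬝ᵥ v) ^ 2 =
          ∑ s, ∑ t, v s * (monoVec ℓ z s * monoVec ℓ z t * v t) := by
        intro z
        rw [pow_two, dotProduct, Finset.sum_mul_sum]
        refine Finset.sum_congr rfl fun s _ => Finset.sum_congr rfl fun t _ => by ring
      simp_rw [this]
      rw [integral_finsetSum _ fun s _ => integrable_finsetSum _ fun t _ => hi s t]
      simp only [dotProduct, Matrix.mulVec, hG, Matrix.of_apply]
      refine Finset.sum_congr rfl fun s _ => ?_
      rw [integral_finsetSum _ fun t _ => hi s t, Finset.mul_sum]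
      refine Finset.sum_congr rfl fun t _ => ?_
      rw [integral_const_mul, integral_mul_const]
    have hs : G.IsHermitian := by
      ext s t
      simp [hG, mul_comm]
    obtain ⟨c, hc, h⟩ := exists_coercive_of_pos hs fun v hv => by
      rw [hquad]
      exact setIntegral_sq_pos hδ b hv
    exact ⟨c, hc, fun v => by rw [← hquad]; exact h v⟩
  choose c hc h using key
  obtain ⟨b₀, hb₀⟩ := Finite.exists_min c
  refine ⟨c b₀, hc b₀, fun b v => le_trans ?_ (h b v)⟩
  gcongr
  · exact Finset.sum_nonneg fun s _ => mul_self_nonneg _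
  · exact hb₀ b

end Orthants

/-! ### Uniform coercivity of the expected Gram matrix. -/

section ExpectedGram

variable {d ℓ : ℕ} {β Cβ μmin μmax : ℝ} {σ : ℝ≥0} {K : E d → ℝ} {Kmin Kmax Δ : ℝ}

/-- The kernel-weighted product of two monomials, in the local coordinates at `u`. -/
noncomputable def gramFun (K : E d → ℝ) (h : ℝ) (u : E d) (s t : MIdx d ℓ) (x : E d) : ℝ :=
  K (h⁻¹ • (x - u)) * (monoVec ℓ (h⁻¹ • (x - u)) s * monoVec ℓ (h⁻¹ • (x - u)) t)

/-- The expectation of the matrix `B_{uh}`. -/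
noncomputable def gram (K : E d → ℝ) (ℓ : ℕ) (h : ℝ) (P : Measure (E d × ℝ)) (u : E d) :
    Matrix (MIdx d ℓ) (MIdx d ℓ) ℝ :=
  Matrix.of fun s t => (h ^ d)⁻¹ * ∫ w, gramFun K h u s t w.1 ∂P

theorem IsKernelWith.measurable_gramFun (hK : IsKernelWith K Kmin Kmax Δ) (h : ℝ) (u : E d)
    (s t : MIdx d ℓ) : Measurable (gramFun K h u s t) := by
  have h1 : Measurable fun x : E d => h⁻¹ • (x - u) := by fun_prop
  exact (hK.measurable.comp h1).mul
    (((continuous_monoVec s).measurable.comp h1).mul ((continuous_monoVec t).measurable.comp h1))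

theorem IsKernelWith.abs_mul_monoVec_le (hK : IsKernelWith K Kmin Kmax Δ) (z : E d)
    (s : MIdx d ℓ) : |K z * monoVec ℓ z s| ≤ Kmax := by
  rcases lt_or_ge 1 ‖z‖ with hz | hz
  · rw [hK.eq_zero z hz]
    simpa using hK.Kmax_pos.le
  · have := abs_monoVec_le le_rfl hz s
    rw [one_pow] at this
    rw [abs_mul, abs_of_nonneg (hK.nonneg z)]
    exact (mul_le_of_le_one_right (hK.nonneg z) this).trans (hK.le z)

theorem IsKernelWith.abs_gramFun_le (hK : IsKernelWith K Kmin Kmax Δ) (h : ℝ) (u : E d)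
    (s t : MIdx d ℓ) (x : E d) : |gramFun K h u s t x| ≤ Kmax := by
  unfold gramFun
  set z := h⁻¹ • (x - u)
  rcases lt_or_ge 1 ‖z‖ with hz | hz
  · rw [hK.eq_zero z hz]
    simpa using hK.Kmax_pos.le
  · have := abs_monoVec_le le_rfl hz t
    rw [one_pow] at this
    rw [← mul_assoc, abs_mul]
    exact (mul_le_of_le_one_right (abs_nonneg _) this).trans (hK.abs_mul_monoVec_le z s)

theorem lt_norm_inv_smul_of_notMem {h : ℝ} (hh : 0 < h) {u x : E d}
    (hx : x ∉ Metric.closedBall u h) : 1 < ‖h⁻¹ • (x - u)‖ := by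
  rw [Metric.mem_closedBall, dist_eq_norm, not_le] at hx
  rw [norm_smul, Real.norm_eq_abs, abs_of_pos (inv_pos.2 hh), inv_mul_eq_div, one_lt_div hh]
  exact hx

theorem IsKernelWith.gramFun_eq_zero (hK : IsKernelWith K Kmin Kmax Δ) {h : ℝ} (hh : 0 < h)
    {u : E d} (s t : MIdx d ℓ) {x : E d} (hx : x ∉ Metric.closedBall u h) :
    gramFun K h u s t x = 0 := by
  rw [gramFun, hK.eq_zero _ (lt_norm_inv_smul_of_notMem hh hx), zero_mul]

/-- In each coordinate move away from the nearer face: there is room `1 / 2` on that side, and `h *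
δ ≤ 1 / 2`. -/
theorem exists_orthantBox_add_mem_cube {H δ h : ℝ} (hδ : δ ≤ 1 / (2 * H)) (hh : 0 < h) (hH : h ≤ H)
    {u : E d} (hu : u ∈ cube d) :
    ∃ b : Fin d → Bool, ∀ x : E d, h⁻¹ • (x - u) ∈ orthantBox δ b → x ∈ cube d := by
  refine ⟨fun i => decide (u i ≤ 1 / 2), fun x hx i => ?_⟩
  have hz := hx i
  set z : ℝ := (h⁻¹ • (x - u)) i with hzdef
  have hxz : x i = u i + h * z := by
    simp only [hzdef, PiLp.smul_apply, PiLp.sub_apply, smul_eq_mul]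
    field_simp
    ring
  have hH0 : 0 < H := hh.trans_le hH
  have hhδ : h * δ ≤ 1 / 2 := by
    calc h * δ ≤ h * (1 / (2 * H)) := by gcongr
      _ ≤ H * (1 / (2 * H)) := by gcongr
      _ = 1 / 2 := by field_simp
  have hu' := hu i
  unfold orthantSide at hz
  rw [hxz]
  by_cases hui : u i ≤ 1 / 2
  · simp only [hui, decide_true, if_true] at hz
    have h1 := mul_lt_mul_of_pos_left hz.2 hh
    have h2 := mul_pos hh hz.1
    constructor <;> linarith [hu'.1]
  · simp only [hui, decide_false, Bool.false_eq_true, if_false] at hz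
    have h1 := mul_lt_mul_of_pos_left hz.1 hh
    have h2 := mul_neg_of_pos_of_neg hh hz.2
    constructor <;> linarith [hu'.2, not_le.1 hui]

theorem integral_comp_inv_smul_sub (g : E d → ℝ) {h : ℝ} (hh : 0 < h) (u : E d) :
    ∫ x, g (h⁻¹ • (x - u)) = h ^ d * ∫ z, g z := by
  rw [integral_sub_right_eq_self (fun x => g (h⁻¹ • x)) u,
    Measure.integral_comp_inv_smul_of_nonneg _ _ hh.le]
  simp

theorem HasBoundedDensity.smul_restrict_le {ν : Measure (E d)}
    (hν : HasBoundedDensity μmin μmax ν) :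
    ENNReal.ofReal μmin • volume.restrict (cube d) ≤ ν := by
  obtain ⟨p, hp, hb, rfl⟩ := hν
  rw [← withDensity_const]
  refine withDensity_mono ?_
  filter_upwards [ae_restrict_mem measurableSet_cube] with x hx
  exact ENNReal.ofReal_le_ofReal (hb x hx).1.le

theorem dotProduct_gram_mulVec (hK : IsKernelWith K Kmin Kmax Δ) (h : ℝ) (u : E d)
    (P : Measure (E d × ℝ)) [IsProbabilityMeasure P] (v : MIdx d ℓ → ℝ) :
    v ⬝ᵥ (gram K ℓ h P u).mulVec v = (h ^ d)⁻¹ *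
      ∫ w, K (h⁻¹ • (w.1 - u)) * (monoVec ℓ (h⁻¹ • (w.1 - u)) ⬝ᵥ v) ^ 2 ∂P := by
  have hi : ∀ s t, Integrable (fun w : E d × ℝ => v s * (gramFun K h u s t w.1 * v t)) P :=
    fun s t => ((Integrable.mono' (integrable_const Kmax)
      ((hK.measurable_gramFun h u s t).comp measurable_fst).aestronglyMeasurable
      (Eventually.of_forall fun w => hK.abs_gramFun_le h u s t w.1)).mul_const _).const_mul _
  have : ∀ w : E d × ℝ, K (h⁻¹ • (w.1 - u)) * (monoVec ℓ (h⁻¹ • (w.1 - u)) ⬝ᵥ v) ^ 2 =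
      ∑ s, ∑ t, v s * (gramFun K h u s t w.1 * v t) := by
    intro w
    rw [pow_two, dotProduct, Finset.sum_mul_sum, Finset.mul_sum]
    refine Finset.sum_congr rfl fun s _ => ?_
    rw [Finset.mul_sum]
    refine Finset.sum_congr rfl fun t _ => ?_
    rw [gramFun]
    ring
  simp_rw [this]
  rw [integral_finsetSum _ fun s _ => integrable_finsetSum _ fun t _ => hi s t, Finset.mul_sum]
  simp only [dotProduct, Matrix.mulVec, gram, Matrix.of_apply]
  refine Finset.sum_congr rfl fun s _ => ?_
  rw [integral_finsetSum _ fun t _ => hi s t, Finset.mul_sum, Finset.mul_sum]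
  refine Finset.sum_congr rfl fun t _ => ?_
  rw [integral_const_mul, integral_mul_const]
  ring

/-- The expected Gram matrices are uniformly coercive. -/
theorem exists_gram_coercive (hd : 1 ≤ d) (hK : IsKernelWith K Kmin Kmax Δ) (hμ : 0 < μmin)
    (ℓ : ℕ) {H : ℝ} (hH : 0 < H) : ∃ c, 0 < c ∧
      ∀ (P : Measure (E d × ℝ)) [IsProbabilityMeasure P] (f : E d → ℝ),
        InClass β Cβ μmin μmax σ P f → ∀ (h : ℝ) (u : E d), 0 < h → h ≤ H → u ∈ cube d →
        ∀ v : MIdx d ℓ → ℝ, c * (v ⬝ᵥ v) ≤ v ⬝ᵥ (gram K ℓ h P u).mulVec v := by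
  have hd' : (0 : ℝ) < d := by exact_mod_cast hd
  -- The first term puts the box inside the ball where `K ≥ Kmin`, since its points have norm at
  -- most `d * δ`. The second keeps the rescaled box inside the cube for all `h ≤ H`.
  set δ : ℝ := min (Δ / d) (1 / (2 * H)) with hδ
  have hδ0 : 0 < δ := lt_min (div_pos hK.radius_pos hd') (by positivity)
  obtain ⟨c, hc, hcb⟩ := exists_sq_integral_lower_bound d ℓ hδ0
  refine ⟨μmin * (Kmin * c), mul_pos hμ (mul_pos hK.Kmin_pos hc), ?_⟩
  intro P _ f hP h u hh hhH hu v
  obtain ⟨b, hb⟩ := exists_orthantBox_add_mem_cube (min_le_right _ _) hh hhH hu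
  set F : E d → ℝ := fun x => K (h⁻¹ • (x - u)) * (monoVec ℓ (h⁻¹ • (x - u)) ⬝ᵥ v) ^ 2 with hF
  have hmeas : Measurable F := by
    have h1 : Measurable fun x : E d => h⁻¹ • (x - u) := by fun_prop
    exact (hK.measurable.comp h1).mul
      (((continuous_monoVec_dotProduct v).measurable.comp h1).pow_const 2)
  have hF0 : ∀ x, 0 ≤ F x := fun x => mul_nonneg (hK.nonneg _) (sq_nonneg _)
  have hFb : ∀ x, F x ≤ Kmax * (∑ s, |v s|) ^ 2 := by
    intro x
    simp only [hF]
    set z := h⁻¹ • (x - u)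
    have h0 : 0 ≤ Kmax * (∑ s, |v s|) ^ 2 := mul_nonneg hK.Kmax_pos.le (sq_nonneg _)
    rcases lt_or_ge 1 ‖z‖ with hz | hz
    · rw [hK.eq_zero z hz, zero_mul]
      exact h0
    · refine mul_le_mul (hK.le z) ?_ (sq_nonneg _) hK.Kmax_pos.le
      rw [sq_le_sq, abs_of_nonneg (Finset.sum_nonneg fun s _ => abs_nonneg (v s)) (a := ∑ s, |v s|)]
      refine (Finset.abs_sum_le_sum_abs _ _).trans (Finset.sum_le_sum fun s _ => ?_)
      rw [abs_mul]
      refine mul_le_of_le_one_left (abs_nonneg _) ?_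
      simpa using abs_monoVec_le le_rfl hz s
  have : IsProbabilityMeasure (P.map Prod.fst) :=
    Measure.isProbabilityMeasure_map measurable_fst.aemeasurable
  have hFi : Integrable F (P.map Prod.fst) := Integrable.mono' (integrable_const _)
    hmeas.aestronglyMeasurable (Eventually.of_forall fun x => by
      rw [Real.norm_eq_abs, abs_of_nonneg (hF0 x)]; exact hFb x)
  have hle := hP.density.smul_restrict_le
  have hμ0 : ENNReal.ofReal μmin ≠ 0 := by simpa using hμ
  have hFc : IntegrableOn F (cube d) :=
    (integrable_smul_measure hμ0 ENNReal.ofReal_ne_top).1 (hFi.mono_measure hle)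
  set q : E d → ℝ := (orthantBox δ b).indicator fun z => Kmin * (monoVec ℓ z ⬝ᵥ v) ^ 2 with hq
  have hqF : ∀ x, q (h⁻¹ • (x - u)) ≤ (cube d).indicator F x := by
    intro x
    by_cases hx : h⁻¹ • (x - u) ∈ orthantBox δ b
    · rw [hq, Set.indicator_of_mem hx, Set.indicator_of_mem (hb x hx)]
      refine mul_le_mul_of_nonneg_right (hK.ge _ ?_) (sq_nonneg _)
      refine (norm_le_of_mem_orthantBox hδ0.le hx).trans ?_
      calc d * δ ≤ d * (Δ / d) := by gcongr; exact min_le_left _ _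
        _ = Δ := by field_simp
    · rw [hq, Set.indicator_of_notMem hx]
      exact Set.indicator_nonneg (fun x _ => hF0 x) x
  rw [dotProduct_gram_mulVec hK, mul_assoc, mul_assoc]
  have h1 : h ^ d * (Kmin * (c * (v ⬝ᵥ v))) ≤ ∫ x in cube d, F x := by
    calc h ^ d * (Kmin * (c * (v ⬝ᵥ v))) ≤ h ^ d * ∫ z, q z := by
          rw [hq, integral_indicator (isOpen_orthantBox δ b).measurableSet, integral_const_mul]
          have := hK.Kmin_pos
          gcongr
          exact hcb b v
      _ = ∫ x, q (h⁻¹ • (x - u)) := (integral_comp_inv_smul_sub q hh u).symm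
      _ ≤ ∫ x, (cube d).indicator F x := by
          refine integral_mono_of_nonneg (Eventually.of_forall fun x => ?_)
            (hFc.integrable_indicator measurableSet_cube) (Eventually.of_forall hqF)
          exact Set.indicator_nonneg (fun z _ => mul_nonneg hK.Kmin_pos.le (sq_nonneg _)) _
      _ = _ := integral_indicator measurableSet_cube
  have h2 : μmin * ∫ x in cube d, F x ≤ ∫ w, F w.1 ∂P := by
    calc _ = ∫ x, F x ∂(ENNReal.ofReal μmin • volume.restrict (cube d)) := by
          rw [integral_smul_measure, ENNReal.toReal_ofReal hμ.le, smul_eq_mul]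
      _ ≤ ∫ x, F x ∂(P.map Prod.fst) :=
          integral_mono_measure hle (Eventually.of_forall hF0) hFi
      _ = _ := integral_map measurable_fst.aemeasurable hmeas.aestronglyMeasurable
  rw [← div_eq_inv_mul, le_div_iff₀ (pow_pos hh d)]
  refine le_trans ?_ h2
  calc _ = μmin * (h ^ d * (Kmin * (c * (v ⬝ᵥ v)))) := by ring
    _ ≤ _ := by gcongr

end ExpectedGram

/-! ### Deterministic error bounds for a given sample. -/

section Sample

variable {d ℓ n : ℕ} {β Cβ μmin μmax : ℝ} {σ : ℝ≥0} {K : E d → ℝ} {Kmin Kmax Δ : ℝ}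

/-- The kernel weight of a monomial, in the local coordinates at `u`. -/
noncomputable def weightFun (K : E d → ℝ) (h : ℝ) (u : E d) (s : MIdx d ℓ) (x : E d) : ℝ :=
  K (h⁻¹ • (x - u)) * monoVec ℓ (h⁻¹ • (x - u)) s

/-- The weighted sum of the residuals. -/
noncomputable def noise (f K : E d → ℝ) (h : ℝ) (Z : Fin n → E d × ℝ) (u : E d) (s : MIdx d ℓ) :
    ℝ := ∑ i, resid f (Z i) * weightFun K h u s (Z i).1

/-- The centred and unnormalized entries of the matrix `B_{uh}`. -/
noncomputable def gramDev (K : E d → ℝ) (h : ℝ) (P : Measure (E d × ℝ)) (Z : Fin n → E d × ℝ)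
    (u : E d) (s t : MIdx d ℓ) : ℝ :=
  ∑ i, gramFun K h u s t (Z i).1 - n * ∫ w, gramFun K h u s t w.1 ∂P

theorem IsKernelWith.measurable_weightFun (hK : IsKernelWith K Kmin Kmax Δ) (h : ℝ) (u : E d)
    (s : MIdx d ℓ) : Measurable (weightFun K h u s) := by
  have h1 : Measurable fun x : E d => h⁻¹ • (x - u) := by fun_prop
  exact (hK.measurable.comp h1).mul ((continuous_monoVec s).measurable.comp h1)

theorem IsKernelWith.abs_weightFun_le (hK : IsKernelWith K Kmin Kmax Δ) (h : ℝ) (u : E d)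
    (s : MIdx d ℓ) (x : E d) : |weightFun K h u s x| ≤ Kmax :=
  hK.abs_mul_monoVec_le _ s

theorem IsKernelWith.weightFun_eq_zero (hK : IsKernelWith K Kmin Kmax Δ) {h : ℝ} (hh : 0 < h)
    {u : E d} (s : MIdx d ℓ) {x : E d} (hx : x ∉ Metric.closedBall u h) :
    weightFun K h u s x = 0 := by
  rw [weightFun, hK.eq_zero _ (lt_norm_inv_smul_of_notMem hh hx), zero_mul]

theorem norm_inv_smul_sub_le {h R : ℝ} (hh : 0 < h) {u x : E d} (hx : ‖x - u‖ ≤ R * h) :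
    ‖h⁻¹ • (x - u)‖ ≤ R := by
  rw [norm_smul, Real.norm_eq_abs, abs_of_pos (inv_pos.2 hh), inv_mul_eq_div, div_le_iff₀ hh]
  exact hx

theorem abs_monoVec_dotProduct_le {R : ℝ} (hR : 1 ≤ R) {z : E d} (hz : ‖z‖ ≤ R)
    (v : MIdx d ℓ → ℝ) : |monoVec ℓ z ⬝ᵥ v| ≤ R ^ ℓ * ∑ s, |v s| := by
  rw [Finset.mul_sum]
  refine (Finset.abs_sum_le_sum_abs _ _).trans (Finset.sum_le_sum fun s _ => ?_)
  rw [abs_mul]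
  exact mul_le_mul_of_nonneg_right (abs_monoVec_le hR hz s) (abs_nonneg _)

theorem monoVec_zero_index (z : E d) : monoVec ℓ z ⟨0, by simp⟩ = 1 := by
  simp [monoVec]

/-- Deterministic bound for the regularized estimator: it never explodes faster than `1 / τ`. -/
theorem abs_lpEst_le (hd : 1 ≤ d) (hK : IsKernelWith K Kmin Kmax Δ) {f : E d → ℝ}
    (hf : IsHolder β Cβ f) {R : ℝ} (hR : 1 ≤ R) {h τ : ℝ} (hh : 0 < h) (hτ : 0 < τ)
    {Z : Fin n → E d × ℝ} (hZ : ∀ i, (Z i).1 ∈ cube d) {u x : E d} (hx : ‖x - u‖ ≤ R * h) :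
    |lpEst K ℓ h τ Z u x| ≤ R ^ ℓ * (Fintype.card (MIdx d ℓ) ^ 2 * (Kmax * (1 + Cβ))) *
      (τ⁻¹ * (h ^ d)⁻¹ * (1 + (n : ℝ)⁻¹ * ∑ i, |resid f (Z i)|)) := by
  have hKm := hK.Kmax_pos
  have hC := (hf.exists_bounds hd).1
  have hres : 0 ≤ (n : ℝ)⁻¹ * ∑ i, |resid f (Z i)| :=
    mul_nonneg (by positivity) (Finset.sum_nonneg fun i _ => abs_nonneg _)
  unfold lpEst
  split_ifs with hne
  swap
  · rw [abs_zero]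
    positivity
  set L : ℝ := ((Fintype.card (MIdx d ℓ) : ℕ) : ℝ)
  set a := vecA K ℓ h Z u
  have hcoer := matBReg_coercive (τ := τ) (Z := Z) (u := u) (ℓ := ℓ) hK.nonneg hh
  -- The regularized matrix has coercivity constant `τ` whatever the sample, whence the factor `1 /
  -- τ`.
  have h1 := sum_abs_le_of_coercive hτ hcoer _ a (mulVec_inv_mulVec_of_coercive hτ hcoer a)
  have hn : (0 : ℝ) < n := by
    obtain ⟨i, -⟩ := hne
    exact_mod_cast i.pos
  have ha : ∀ s, |a s| ≤ (h ^ d)⁻¹ * (Kmax * (1 + Cβ)) *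
      (1 + (n : ℝ)⁻¹ * ∑ i, |resid f (Z i)|) := by
    intro s
    have hY : ∀ i, |(Z i).2 * K (h⁻¹ • ((Z i).1 - u)) * monoVec ℓ (h⁻¹ • ((Z i).1 - u)) s| ≤
        Kmax * (Cβ + |resid f (Z i)|) := by
      intro i
      rw [mul_assoc, abs_mul, mul_comm Kmax]
      refine mul_le_mul ?_ (hK.abs_mul_monoVec_le _ s) (abs_nonneg _) (by positivity)
      have : (Z i).2 = f (Z i).1 + resid f (Z i) := by
        rw [resid, Set.indicator_of_mem (hZ i)]
        ring
      rw [this]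
      exact (abs_add_le _ _).trans (add_le_add_left (hf.abs_le hd (hZ i)) _)
    rw [show a s = _ from vecA_apply s, abs_mul, abs_of_nonneg (by positivity)]
    calc _ ≤ 1 / (n * h ^ d) * ∑ i, Kmax * (Cβ + |resid f (Z i)|) := by
          gcongr
          exact (Finset.abs_sum_le_sum_abs _ _).trans (Finset.sum_le_sum fun i _ => hY i)
      _ = (h ^ d)⁻¹ * Kmax * (Cβ + (n : ℝ)⁻¹ * ∑ i, |resid f (Z i)|) := by
          rw [← Finset.mul_sum, Finset.sum_add_distrib]
          simp only [Finset.sum_const, Finset.card_univ, Fintype.card_fin, nsmul_eq_mul]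
          field_simp
      _ ≤ (h ^ d)⁻¹ * Kmax * ((1 + Cβ) * (1 + (n : ℝ)⁻¹ * ∑ i, |resid f (Z i)|)) := by
          gcongr
          nlinarith
      _ = _ := by ring
  calc _ ≤ R ^ ℓ * ∑ s, |((matBReg K ℓ h τ Z u)⁻¹.mulVec a) s| :=
        abs_monoVec_dotProduct_le hR (norm_inv_smul_sub_le hh hx) _
    _ ≤ R ^ ℓ * (L / τ * ∑ s, |a s|) := by gcongr
    _ ≤ R ^ ℓ * (L / τ * ∑ _s : MIdx d ℓ, (h ^ d)⁻¹ * (Kmax * (1 + Cβ)) *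
      (1 + (n : ℝ)⁻¹ * ∑ i, |resid f (Z i)|)) := by
        gcongr with s
        exact ha s
    _ = _ := by
        rw [Finset.sum_const, Finset.card_univ, nsmul_eq_mul]
        ring

/-- The bias and noise decomposition on the event that the empirical Gram matrix is close to its
expectation. -/
theorem abs_lpEst_sub_le (hd : 1 ≤ d) (hβ : 0 < β) (hK : IsKernelWith K Kmin Kmax Δ)
    (hμ : 0 ≤ μmax) (hℓ : floorLT β ≤ ℓ) {P : Measure (E d × ℝ)} [IsProbabilityMeasure P]
    {f : E d → ℝ} (hP : InClass β Cβ μmin μmax σ P f) {R : ℝ} (hR : 1 ≤ R) {h τ c ε : ℝ}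
    (hh : 0 < h) (hc : 0 < c) (hτ : τ ≤ c / 2) (hε : Fintype.card (MIdx d ℓ) * ε ≤ c / 2)
    (hn : 0 < n) {Z : Fin n → E d × ℝ} (hZ : ∀ i, (Z i).1 ∈ cube d) {u x : E d}
    (hu : u ∈ cube d) (hx : x ∈ cube d) (hxu : ‖x - u‖ ≤ R * h)
    (hG : ∀ v : MIdx d ℓ → ℝ, c * (v ⬝ᵥ v) ≤ v ⬝ᵥ (gram K ℓ h P u).mulVec v)
    (hdev : ∀ s t : MIdx d ℓ, |gramDev K h P Z u s t| ≤ ε * (n * h ^ d)) :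
    |lpEst K ℓ h τ Z u x - f x| ≤
      R ^ ℓ * (Fintype.card (MIdx d ℓ) / (c / 2)) *
        ((n * h ^ d)⁻¹ * ∑ s : MIdx d ℓ, |noise f K h Z u s| +
          Fintype.card (MIdx d ℓ) * (d ^ floorLT β * Cβ * h ^ β *
            (Kmax * (μmax * ballVol d) + ε))) +
      d ^ floorLT β * Cβ * R ^ β * h ^ β := by
  have hKm := hK.Kmax_pos
  have hC := (hP.holder.exists_bounds hd).1
  have hn' : (0 : ℝ) < n := by exact_mod_cast hn
  have hN : 0 < n * h ^ d := by positivity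
  set L : ℝ := ((Fintype.card (MIdx d ℓ) : ℕ) : ℝ) with hLdef
  set D : ℝ := (d : ℝ) ^ floorLT β * Cβ with hD
  have hD0 : 0 ≤ D := by positivity
  set B := matB K ℓ h Z u with hB
  set a := vecA K ℓ h Z u with ha
  have hcoer : ∀ v, c / 2 * (v ⬝ᵥ v) ≤ v ⬝ᵥ B.mulVec v := by
    refine coercive_of_entrywise_close hε (fun s t => ?_) hG
    have h1 : B s t - gram K ℓ h P u s t = gramDev K h P Z u s t / (n * h ^ d) := by
      rw [hB, matB_apply, gram, Matrix.of_apply, gramDev]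
      simp only [gramFun]
      field_simp
    rw [h1, abs_div, abs_of_pos hN, div_le_iff₀ hN]
    exact hdev s t
  have hc2 : 0 < c / 2 := by positivity
  -- With no design point in the ball all kernel weights vanish and `B = 0`, against coercivity. The
  -- estimator is thus not in its zero branch.
  have hne : ∃ i, (Z i).1 ∈ Metric.closedBall u h := by
    by_contra! hall
    have h1 := hcoer fun _ => 1
    rw [hB, dotProduct_matB_mulVec, Finset.sum_eq_zero fun i _ => by
      rw [hK.eq_zero _ (lt_norm_inv_smul_of_notMem hh (hall i)), zero_mul]] at h1
    have h2 : (0 : ℝ) < Fintype.card (MIdx d ℓ) := by exact_mod_cast Fintype.card_pos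
    simp only [dotProduct, mul_one, Finset.sum_const, Finset.card_univ, nsmul_eq_mul,
      mul_zero] at h1
    nlinarith
  obtain ⟨θ, hθ⟩ := hP.holder.exists_taylor hd hβ hℓ hh hu
  rw [lpEst, if_pos hne, matBReg_eq_matB hτ hcoer]
  set w := B⁻¹.mulVec a with hw
  have hBw : B.mulVec w = a := mulVec_inv_mulVec_of_coercive hc2 hcoer a
  have h1 := sum_abs_le_of_coercive hc2 hcoer (w - θ) (a - B.mulVec θ)
    (by rw [Matrix.mulVec_sub, hBw])
  -- the sum of the kernel weights
  have hKsum : ∑ i, K (h⁻¹ • ((Z i).1 - u)) ≤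
      (Kmax * (μmax * ballVol d) + ε) * (n * h ^ d) := by
    -- For the zero multi-index the monomials equal 1, so this entry of the Gram matrix is the sum
    -- of the kernel weights itself.
    have h2 := (abs_le.1 (hdev ⟨0, by simp⟩ ⟨0, by simp⟩)).2
    have h3 : ∫ w, gramFun K h u (⟨0, by simp⟩ : MIdx d ℓ) ⟨0, by simp⟩ w.1 ∂P ≤
        Kmax * (μmax * ballVol d * h ^ d) := by
      calc _ ≤ ∫ w, (Prod.fst ⁻¹' Metric.closedBall u h : Set (E d × ℝ)).indicator
            (fun _ => Kmax) w ∂P := by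
            refine integral_mono_of_nonneg (Eventually.of_forall fun w => ?_) ?_
              (Eventually.of_forall fun w => ?_)
            · simp only [gramFun, monoVec_zero_index, mul_one]
              exact hK.nonneg _
            · exact (integrable_const _).indicator
                (measurable_fst Metric.isClosed_closedBall.measurableSet)
            · by_cases hw : w.1 ∈ Metric.closedBall u h
              · rw [Set.indicator_of_mem (by exact hw)]
                exact (le_abs_self _).trans (hK.abs_gramFun_le h u _ _ _)
              · rw [Set.indicator_of_notMem (by exact hw)]
                exact (hK.gramFun_eq_zero hh _ _ hw).le
        _ = Kmax * P.real (Prod.fst ⁻¹' Metric.closedBall u h) := by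
            rw [integral_indicator_const _
              (measurable_fst Metric.isClosed_closedBall.measurableSet), smul_eq_mul, mul_comm]
        _ ≤ _ := by
            gcongr
            exact hP.measure_closedBall_le hμ u hh.le
    unfold gramDev at h2
    simp only [gramFun, monoVec_zero_index, mul_one] at h2 h3
    have h4 := mul_le_mul_of_nonneg_left h3 hn'.le
    linarith
  -- the linear system for the error of the coefficients
  have he : ∀ s, |(a - B.mulVec θ) s| ≤ (n * h ^ d)⁻¹ * |noise f K h Z u s| +
      D * h ^ β * (Kmax * (μmax * ballVol d) + ε) := by
    intro s
    -- On writing `Y` as `f(X)` plus the residual, the polynomial part of `f` cancels exactly; only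
    -- noise and Taylor remainders are left.
    have h2 : (a - B.mulVec θ) s = (n * h ^ d)⁻¹ * (noise f K h Z u s +
        ∑ i, (f (Z i).1 - monoVec ℓ (h⁻¹ • ((Z i).1 - u)) ⬝ᵥ θ) *
          weightFun K h u s (Z i).1) := by
      rw [noise, ← Finset.sum_add_distrib, Pi.sub_apply, ha, vecA_apply, Matrix.mulVec, dotProduct]
      simp_rw [hB, matB_apply, mul_assoc (1 / ((n : ℝ) * h ^ d)), Finset.sum_mul]
      rw [← Finset.mul_sum, Finset.sum_comm, ← mul_sub, ← Finset.sum_sub_distrib, one_div]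
      congr 1
      refine Finset.sum_congr rfl fun i _ => ?_
      rw [resid, Set.indicator_of_mem (hZ i), weightFun, dotProduct, sub_mul, sub_mul,
        Finset.sum_mul]
      simp only [mul_assoc]
      rw [sub_add_sub_cancel]
      congr 1
      refine Finset.sum_congr rfl fun t _ => by ring
    have h3 : |∑ i, (f (Z i).1 - monoVec ℓ (h⁻¹ • ((Z i).1 - u)) ⬝ᵥ θ) *
          weightFun K h u s (Z i).1| ≤ D * h ^ β * ∑ i, K (h⁻¹ • ((Z i).1 - u)) := by
      rw [Finset.mul_sum]
      refine (Finset.abs_sum_le_sum_abs _ _).trans (Finset.sum_le_sum fun i _ => ?_)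
      by_cases hi : (Z i).1 ∈ Metric.closedBall u h
      · rw [abs_mul]
        have hi' : ‖(Z i).1 - u‖ ≤ h := by rwa [Metric.mem_closedBall, dist_eq_norm] at hi
        refine mul_le_mul ?_ ?_ (abs_nonneg _) (by positivity)
        · refine (hθ _ (hZ i)).trans ?_
          rw [hD, mul_assoc]
          gcongr
        · rw [weightFun, abs_mul, abs_of_nonneg (hK.nonneg _)]
          refine mul_le_of_le_one_right (hK.nonneg _) ?_
          simpa using abs_monoVec_le le_rfl
            (norm_inv_smul_sub_le (R := 1) hh (by rwa [one_mul])) s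
      · rw [hK.weightFun_eq_zero hh s hi, mul_zero, abs_zero]
        exact mul_nonneg (by positivity) (hK.nonneg _)
    rw [h2, abs_mul, abs_of_pos (inv_pos.2 hN)]
    calc _ ≤ (n * h ^ d)⁻¹ * (|noise f K h Z u s| +
          D * h ^ β * ((Kmax * (μmax * ballVol d) + ε) * (n * h ^ d))) := by
          gcongr
          refine (abs_add_le _ _).trans (add_le_add_right (h3.trans ?_) _)
          gcongr
      _ = _ := by field_simp
  have h5 : |monoVec ℓ (h⁻¹ • (x - u)) ⬝ᵥ (w - θ)| ≤ R ^ ℓ * (L / (c / 2)) *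
        ((n * h ^ d)⁻¹ * ∑ s : MIdx d ℓ, |noise f K h Z u s| +
          L * (D * h ^ β * (Kmax * (μmax * ballVol d) + ε))) := by
    refine (abs_monoVec_dotProduct_le hR (norm_inv_smul_sub_le hh hxu) _).trans ?_
    rw [mul_assoc]
    gcongr
    refine h1.trans ?_
    gcongr
    refine (Finset.sum_le_sum fun s _ => he s).trans_eq ?_
    rw [Finset.sum_add_distrib, ← Finset.mul_sum, Finset.sum_const, Finset.card_univ, nsmul_eq_mul]
  have h6 : |f x - monoVec ℓ (h⁻¹ • (x - u)) ⬝ᵥ θ| ≤ D * R ^ β * h ^ β := by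
    refine (hθ x hx).trans ?_
    rw [hD, mul_assoc, mul_assoc, ← Real.mul_rpow (by positivity) hh.le]
    gcongr
  have h7 : monoVec ℓ (h⁻¹ • (x - u)) ⬝ᵥ w - f x =
      monoVec ℓ (h⁻¹ • (x - u)) ⬝ᵥ (w - θ) - (f x - monoVec ℓ (h⁻¹ • (x - u)) ⬝ᵥ θ) := by
    rw [dotProduct_sub]
    ring
  rw [h7]
  exact (abs_sub _ _).trans (add_le_add h5 h6)

end Sample

/-! ### Expectations of the random terms. -/

section Expectations

variable {d ℓ n : ℕ} {β Cβ μmin μmax : ℝ} {σ : ℝ≥0} {K : E d → ℝ} {Kmin Kmax Δ : ℝ}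
  {P : Measure (E d × ℝ)} {f : E d → ℝ}

/-- An exponential majorant for the indicator of the event that the empirical Gram matrix is far
from its expectation. -/
noncomputable def gramExc (K : E d → ℝ) (ℓ : ℕ) (h : ℝ) (P : Measure (E d × ℝ)) (t ε : ℝ)
    (Z : Fin n → E d × ℝ) (u : E d) : ℝ :=
  ∑ s : MIdx d ℓ, ∑ s' : MIdx d ℓ, Real.exp (t * (|gramDev K h P Z u s s'| - ε * (n * h ^ d)))

theorem IsKernelWith.measurable_gramDev (hK : IsKernelWith K Kmin Kmax Δ) (h : ℝ) (u : E d)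
    (s t : MIdx d ℓ) : Measurable fun Z : Fin n → E d × ℝ => gramDev K h P Z u s t := by
  unfold gramDev
  refine (Finset.measurable_fun_sum _ fun i _ => ?_).sub_const _
  exact (hK.measurable_gramFun h u s t).comp (measurable_fst.comp (measurable_pi_apply i))

theorem IsKernelWith.measurable_gramExc (hK : IsKernelWith K Kmin Kmax Δ) (h t ε : ℝ) (u : E d) :
    Measurable fun Z : Fin n → E d × ℝ => gramExc K ℓ h P t ε Z u := by
  unfold gramExc
  refine Finset.measurable_fun_sum _ fun s _ => Finset.measurable_fun_sum _ fun s' _ => ?_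
  exact Real.measurable_exp.comp
    (((hK.measurable_gramDev h u s s').abs.sub_const _).const_mul t)

theorem IsKernelWith.measurable_noise (hK : IsKernelWith K Kmin Kmax Δ) (hf : IsHolder β Cβ f)
    (h : ℝ) (u : E d) (s : MIdx d ℓ) :
    Measurable fun Z : Fin n → E d × ℝ => noise f K h Z u s := by
  unfold noise
  refine Finset.measurable_fun_sum _ fun i _ => ?_
  exact (hf.measurable_resid.comp (measurable_pi_apply i)).mul
    ((hK.measurable_weightFun h u s).comp (measurable_fst.comp (measurable_pi_apply i)))

theorem gramExc_nonneg (h t ε : ℝ) (Z : Fin n → E d × ℝ) (u : E d) :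
    0 ≤ gramExc K ℓ h P t ε Z u :=
  Finset.sum_nonneg fun _ _ => Finset.sum_nonneg fun _ _ => (Real.exp_pos _).le

theorem one_le_gramExc {h t ε : ℝ} (ht : 0 ≤ t) {Z : Fin n → E d × ℝ} {u : E d} {s s' : MIdx d ℓ}
    (hs : ε * (n * h ^ d) < |gramDev K h P Z u s s'|) : 1 ≤ gramExc K ℓ h P t ε Z u := by
  calc (1 : ℝ) ≤ Real.exp (t * (|gramDev K h P Z u s s'| - ε * (n * h ^ d))) :=
        Real.one_le_exp (mul_nonneg ht (by linarith))
    _ ≤ ∑ s'' : MIdx d ℓ, Real.exp (t * (|gramDev K h P Z u s s''| - ε * (n * h ^ d))) :=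
        Finset.single_le_sum (f := fun s'' =>
          Real.exp (t * (|gramDev K h P Z u s s''| - ε * (n * h ^ d))))
          (fun _ _ => (Real.exp_pos _).le) (Finset.mem_univ s')
    _ ≤ _ := Finset.single_le_sum (f := fun s => ∑ s'' : MIdx d ℓ,
          Real.exp (t * (|gramDev K h P Z u s s''| - ε * (n * h ^ d))))
          (fun _ _ => Finset.sum_nonneg fun _ _ => (Real.exp_pos _).le) (Finset.mem_univ s)

variable [IsProbabilityMeasure P]

/-- The weight is bounded by `Kmax` and vanishes off a ball of radius `h`, so the variance proxy is
`n * h ^ d` and not `n`. -/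
theorem InClass.lintegral_exp_noise_le (hP : InClass β Cβ μmin μmax σ P f) (hd : 1 ≤ d)
    (hK : IsKernelWith K Kmin Kmax Δ) (hμ : 0 ≤ μmax) {h : ℝ} (hh : 0 < h) (u : E d)
    (s : MIdx d ℓ) (n : ℕ) {t : ℝ} (ht0 : 0 ≤ t) (ht : t ≤ 1) :
    ∫⁻ Z, ENNReal.ofReal (Real.exp (t * |noise f K h Z u s|)) ∂(sampleLaw P n) ≤
      ENNReal.ofReal (2 * Real.exp (4 * Real.exp (2 * σ ^ 2 * Kmax ^ 2) * (μmax * ballVol d) *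
        (n * h ^ d) * t ^ 2)) := by
  refine (hP.lintegral_exp_abs_sum_resid_le hd (hK.measurable_weightFun h u s)
    (hK.abs_weightFun_le h u s) Metric.isClosed_closedBall.measurableSet
    (fun x hx => hK.weightFun_eq_zero hh s hx) (hP.measure_closedBall_le hμ u hh.le) n ht0
    ht).trans_eq ?_
  congr 3
  ring

/-- Chernoff's method at a fixed level `t`: by `htε` the quadratic term uses up at most half of the
gain `t * ε`. -/
theorem InClass.lintegral_gramExc_le (hP : InClass β Cβ μmin μmax σ P f)
    (hK : IsKernelWith K Kmin Kmax Δ) (hμ : 0 ≤ μmax) {h ε : ℝ} (hh : 0 < h) (u : E d)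
    (n : ℕ) {t : ℝ} (ht0 : 0 ≤ t) (ht : t ≤ 1)
    (htε : 2 * Real.exp (2 * Kmax) * (μmax * ballVol d) * t ≤ ε / 2) :
    ∫⁻ Z, ENNReal.ofReal (gramExc K ℓ h P t ε Z u) ∂(sampleLaw P n) ≤
      ENNReal.ofReal (2 * Fintype.card (MIdx d ℓ) ^ 2 *
        Real.exp (-(t * ε / 2 * (n * h ^ d)))) := by
  have key : ∀ s s' : MIdx d ℓ,
      ∫⁻ Z, ENNReal.ofReal (Real.exp (t * (|gramDev K h P Z u s s'| - ε * (n * h ^ d))))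
        ∂(sampleLaw P n) ≤ ENNReal.ofReal (2 * Real.exp (-(t * ε / 2 * (n * h ^ d)))) := by
    intro s s'
    have h1 := lintegral_exp_abs_sum_sub_integral_le (P := P) (hK.measurable_gramFun h u s s')
      (hK.abs_gramFun_le h u s s') Metric.isClosed_closedBall.measurableSet
      (fun x hx => hK.gramFun_eq_zero hh s s' hx) (hP.measure_closedBall_le hμ u hh.le) n ht0 ht
    have h2 : ∀ Z : Fin n → E d × ℝ,
        ENNReal.ofReal (Real.exp (t * (|gramDev K h P Z u s s'| - ε * (n * h ^ d)))) =
        ENNReal.ofReal (Real.exp (-(t * ε * (n * h ^ d)))) *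
          ENNReal.ofReal (Real.exp (t * |gramDev K h P Z u s s'|)) := fun Z => by
      rw [← ENNReal.ofReal_mul (Real.exp_pos _).le, ← Real.exp_add]
      ring_nf
    simp_rw [h2]
    rw [lintegral_const_mul' _ _ ENNReal.ofReal_ne_top]
    refine (mul_le_mul_right h1 _).trans ?_
    rw [← ENNReal.ofReal_mul (Real.exp_pos _).le]
    refine ENNReal.ofReal_le_ofReal ?_
    rw [mul_left_comm, ← Real.exp_add]
    gcongr
    have h3 : 2 * Real.exp (2 * Kmax) * (μmax * ballVol d) * t * (t * (n * h ^ d)) ≤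
        ε / 2 * (t * (n * h ^ d)) := by gcongr
    linarith
  unfold gramExc
  have hnn : ∀ (Z : Fin n → E d × ℝ) (s s' : MIdx d ℓ),
      0 ≤ Real.exp (t * (|gramDev K h P Z u s s'| - ε * (n * h ^ d))) :=
    fun _ _ _ => (Real.exp_pos _).le
  have hmeas : ∀ s s' : MIdx d ℓ, Measurable fun Z : Fin n → E d × ℝ =>
      ENNReal.ofReal (Real.exp (t * (|gramDev K h P Z u s s'| - ε * (n * h ^ d)))) :=
    fun s s' => ENNReal.measurable_ofReal.comp (Real.measurable_exp.comp
      (((hK.measurable_gramDev h u s s').abs.sub_const _).const_mul t))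
  have hsum : ∀ Z : Fin n → E d × ℝ, ENNReal.ofReal (∑ s : MIdx d ℓ, ∑ s' : MIdx d ℓ,
      Real.exp (t * (|gramDev K h P Z u s s'| - ε * (n * h ^ d)))) = ∑ s : MIdx d ℓ,
      ∑ s' : MIdx d ℓ,
        ENNReal.ofReal (Real.exp (t * (|gramDev K h P Z u s s'| - ε * (n * h ^ d)))) := by
    intro Z
    rw [ENNReal.ofReal_sum_of_nonneg fun s _ => Finset.sum_nonneg fun s' _ => hnn Z s s']
    exact Finset.sum_congr rfl fun s _ => ENNReal.ofReal_sum_of_nonneg fun s' _ => hnn Z s s'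
  simp_rw [hsum]
  rw [lintegral_finsetSum _ fun s _ => Finset.measurable_fun_sum _ fun s' _ => hmeas s s']
  simp_rw [lintegral_finsetSum _ fun s' _ => hmeas _ s']
  calc _ ≤ ∑ _s : MIdx d ℓ, ∑ _s' : MIdx d ℓ,
        ENNReal.ofReal (2 * Real.exp (-(t * ε / 2 * (n * h ^ d)))) :=
        Finset.sum_le_sum fun s _ => Finset.sum_le_sum fun s' _ => key s s'
    _ = _ := by
        simp only [Finset.sum_const, Finset.card_univ, nsmul_eq_mul]
        rw [← ENNReal.ofReal_natCast, ← ENNReal.ofReal_mul (by positivity),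
          ← ENNReal.ofReal_mul (by positivity)]
        ring_nf

/-- The mean of the exponentials of the absolute residuals. -/
noncomputable def expMean (f : E d → ℝ) (Z : Fin n → E d × ℝ) : ℝ :=
  (n : ℝ)⁻¹ * ∑ i, Real.exp |resid f (Z i)|

theorem expMean_nonneg (f : E d → ℝ) (Z : Fin n → E d × ℝ) : 0 ≤ expMean f Z :=
  mul_nonneg (by positivity) (Finset.sum_nonneg fun _ _ => (Real.exp_pos _).le)

theorem IsHolder.measurable_expMean (hf : IsHolder β Cβ f) :
    Measurable fun Z : Fin n → E d × ℝ => expMean f Z := by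
  unfold expMean
  refine (Finset.measurable_fun_sum _ fun i _ => ?_).const_mul _
  exact Real.measurable_exp.comp (hf.measurable_resid.comp (measurable_pi_apply i)).abs

theorem InClass.lintegral_expMean_le (hP : InClass β Cβ μmin μmax σ P f) (n : ℕ) :
    ∫⁻ Z, ENNReal.ofReal (expMean f Z) ∂(sampleLaw P n) ≤
      ENNReal.ofReal (2 * Real.exp (σ ^ 2 / 2)) := by
  have h1 : ∫⁻ w, ENNReal.ofReal (Real.exp |resid f w|) ∂P ≤
      ENNReal.ofReal (2 * Real.exp (σ ^ 2 / 2)) := by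
    have h2 := hP.integrable_exp_mul_abs_resid 1
    have h3 := hP.setIntegral_exp_mul_abs_resid_le 1 MeasurableSet.univ
    simp only [one_mul, Set.preimage_univ, Measure.restrict_univ, probReal_univ, one_pow,
      mul_one] at h2 h3
    rw [← ofReal_integral_eq_lintegral_ofReal h2 (Eventually.of_forall fun _ => (Real.exp_pos _).le)]
    exact ENNReal.ofReal_le_ofReal h3
  have hm : Measurable fun w => ENNReal.ofReal (Real.exp |resid f w|) :=
    ENNReal.measurable_ofReal.comp (Real.measurable_exp.comp hP.holder.measurable_resid.abs)
  have hmi : ∀ i : Fin n, Measurable fun Z : Fin n → E d × ℝ =>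
      ENNReal.ofReal (Real.exp |resid f (Z i)|) := fun i => hm.comp (measurable_pi_apply i)
  unfold expMean
  simp_rw [ENNReal.ofReal_mul (inv_nonneg.2 (Nat.cast_nonneg (α := ℝ) n)),
    fun Z : Fin n → E d × ℝ => ENNReal.ofReal_sum_of_nonneg (s := Finset.univ)
    (fun i (_ : i ∈ (Finset.univ : Finset (Fin n))) => (Real.exp_pos |resid f (Z i)|).le)]
  rw [lintegral_const_mul' _ _ ENNReal.ofReal_ne_top,
    lintegral_finsetSum _ fun i _ => hmi i]
  have h4 : ∀ i : Fin n, ∫⁻ Z, ENNReal.ofReal (Real.exp |resid f (Z i)|) ∂(sampleLaw P n) =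
      ∫⁻ w, ENNReal.ofReal (Real.exp |resid f w|) ∂P := fun i =>
    (measurePreserving_eval (fun _ : Fin n => P) i).lintegral_comp hm
  simp_rw [h4]
  rw [Finset.sum_const, Finset.card_univ, Fintype.card_fin, nsmul_eq_mul, ← mul_assoc]
  refine (mul_le_of_le_one_left (zero_le) ?_).trans h1
  rw [← ENNReal.ofReal_natCast, ← ENNReal.ofReal_mul (by positivity)]
  refine ENNReal.ofReal_le_one.2 ?_
  rcases Nat.eq_zero_or_pos n with rfl | hn
  · simp
  · rw [inv_mul_cancel₀ (by positivity)]

end Expectations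

/-! ### Elementary inequalities. -/

section Elementary

/-- Lets every moment be estimated by an exponential moment. -/
theorem exists_rpow_le_mul_exp (p : ℝ) : ∃ C, 0 < C ∧ ∀ z : ℝ, 0 ≤ z →
    (1 + z) ^ p ≤ C * Real.exp z := by
  obtain ⟨m, hm⟩ := exists_nat_ge p
  refine ⟨m.factorial * Real.exp 1, by positivity, fun z hz => ?_⟩
  calc (1 + z) ^ p ≤ (1 + z) ^ (m : ℝ) := Real.rpow_le_rpow_of_exponent_le (by linarith) hm
    _ = (1 + z) ^ m := Real.rpow_natCast _ _
    _ ≤ m.factorial * Real.exp (1 + z) := by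
        have := Real.pow_div_factorial_le_exp (1 + z) (by linarith) m
        rwa [div_le_iff₀ (by positivity), mul_comm] at this
    _ = _ := by rw [Real.exp_add]; ring

theorem exp_mean_le {n : ℕ} (hn : 0 < n) (y : Fin n → ℝ) :
    Real.exp ((n : ℝ)⁻¹ * ∑ i, y i) ≤ (n : ℝ)⁻¹ * ∑ i, Real.exp (y i) := by
  have hn' : (n : ℝ) ≠ 0 := by positivity
  have := convexOn_exp.map_sum_le (t := Finset.univ) (w := fun _ : Fin n => (n : ℝ)⁻¹) (p := y)
    (fun _ _ => by positivity) (by simp [hn']) (fun _ _ => Set.mem_univ _)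
  simpa [Finset.mul_sum] using this

theorem add_add_rpow_le {a b c p : ℝ} (ha : 0 ≤ a) (hb : 0 ≤ b) (hc : 0 ≤ c) (hp : 1 ≤ p) :
    (a + b + c) ^ p ≤ 3 ^ (p - 1) * (a ^ p + b ^ p + c ^ p) := by
  have := Real.rpow_sum_le_const_mul_sum_rpow_of_nonneg (s := Finset.univ) (f := ![a, b, c]) hp
    (by intro i _; fin_cases i <;> simpa)
  simpa [Fin.sum_univ_three, add_assoc] using this

end Elementary

/-! ### Good and bad samples at one base point. -/

section Pointwise

variable {d : ℕ} {β Cβ μmin μmax : ℝ} {σ : ℝ≥0} {K : E d → ℝ} {Kmin Kmax Δ : ℝ}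

/-- Either the empirical Gram matrix is close to its expectation, and the error of the estimator is
of the size of the bias and the noise; or it is not, and there is a crude bound for the error. -/
theorem exists_error_dichotomy (hd : 1 ≤ d) (hβ : 0 < β) (hK : IsKernelWith K Kmin Kmax Δ)
    (hμmin : 0 < μmin) (hμ : 0 ≤ μmax) (hCβ : 0 < Cβ) {ℓ : ℕ} (hℓ : floorLT β ≤ ℓ) {H R : ℝ} (hH : 0 < H)
    (hR : 1 ≤ R) : ∃ C ε τ₀ : ℝ, 0 < C ∧ 0 < ε ∧ 0 < τ₀ ∧
      ∀ (P : Measure (E d × ℝ)) [IsProbabilityMeasure P] (f : E d → ℝ),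
      InClass β Cβ μmin μmax σ P f → ∀ (n : ℕ) (h τ ρ : ℝ) (u x x' : E d) (Z : Fin n → E d × ℝ),
      0 < n → 0 < h → h ≤ H → 0 < τ → τ ≤ τ₀ → (∀ i, (Z i).1 ∈ cube d) → u ∈ cube d →
      x ∈ cube d → x' ∈ cube d → ‖x' - u‖ ≤ R * h → ‖x' - x‖ ≤ ρ →
      |lpEst K ℓ h τ Z u x' - f x| ≤ C * (ρ ^ min 1 β + h ^ β +
        (n * h ^ d)⁻¹ * ∑ s : MIdx d ℓ, |noise f K h Z u s|) ∨
      (∃ s s' : MIdx d ℓ, ε * (n * h ^ d) < |gramDev K h P Z u s s'|) ∧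
      |lpEst K ℓ h τ Z u x' - f x| ≤
        C * ((1 + τ⁻¹ * (h ^ d)⁻¹) * (1 + (n : ℝ)⁻¹ * ∑ i, |resid f (Z i)|)) := by
  obtain ⟨c, hc, hcg⟩ := exists_gram_coercive (β := β) (Cβ := Cβ) (μmax := μmax) (σ := σ)
    hd hK hμmin ℓ hH
  have hKm := hK.Kmax_pos
  have hbv : 0 ≤ ballVol d := ENNReal.toReal_nonneg
  set L : ℝ := ((Fintype.card (MIdx d ℓ) : ℕ) : ℝ) with hL
  have hL0 : 0 < L := by rw [hL]; exact_mod_cast Fintype.card_pos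
  -- The largest entrywise deviation for which the empirical matrix keeps half of the coercivity
  -- constant.
  set ε := c / 2 / L with hε
  have hε0 : 0 < ε := by positivity
  set C₁ := R ^ ℓ * (L ^ 2 * (Kmax * (1 + Cβ))) with hC₁
  set C₂ := R ^ ℓ * (L / (c / 2)) with hC₂
  set C₃ := C₂ * (L * ((d : ℝ) ^ floorLT β * Cβ * (Kmax * (μmax * ballVol d) + ε))) +
    (d : ℝ) ^ floorLT β * Cβ * R ^ β with hC₃
  have h1 : 0 < C₁ := by positivity
  have h2 : 0 < C₂ := by positivity
  have h3 : 0 ≤ C₃ := by positivity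
  refine ⟨C₁ + C₂ + C₃ + d * Cβ + Cβ, ε, c / 2, by positivity, hε0, by positivity, ?_⟩
  intro P _ f hP n h τ ρ u x x' Z hn hh hhH hτ hτ₀ hZ hu hx hx' hxu hxx
  have hρ : 0 ≤ ρ := (norm_nonneg _).trans hxx
  have hdC : 0 ≤ d * Cβ := by positivity
  have hnoise : 0 ≤ (n * h ^ d)⁻¹ * ∑ s : MIdx d ℓ, |noise f K h Z u s| :=
    mul_nonneg (by positivity) (Finset.sum_nonneg fun _ _ => abs_nonneg _)
  have hres : 0 ≤ (n : ℝ)⁻¹ * ∑ i, |resid f (Z i)| :=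
    mul_nonneg (by positivity) (Finset.sum_nonneg fun i _ => abs_nonneg _)
  have hhβ : 0 ≤ h ^ β := Real.rpow_nonneg hh.le _
  have hρβ : 0 ≤ ρ ^ min 1 β := Real.rpow_nonneg hρ _
  by_cases hdev : ∀ s s' : MIdx d ℓ, |gramDev K h P Z u s s'| ≤ ε * (n * h ^ d)
  · left
    have h4 := abs_lpEst_sub_le hd hβ hK hμ hℓ hP hR hh hc hτ₀
      (by rw [hε]; exact (mul_div_cancel₀ _ hL0.ne').le) hn hZ hu hx' hxu
      (hcg P f hP h u hh hhH hu) hdev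
    have h5 : |f x' - f x| ≤ d * Cβ * ρ ^ min 1 β := by
      refine (hP.holder.abs_sub_le hd hx' hx).trans ?_
      have : 0 ≤ min 1 β := le_min zero_le_one hβ.le
      gcongr
    have h6 : |lpEst K ℓ h τ Z u x' - f x| ≤ |lpEst K ℓ h τ Z u x' - f x'| + |f x' - f x| :=
      abs_sub_le _ _ _
    have h7 : R ^ ℓ * (L / (c / 2)) *
        ((n * h ^ d)⁻¹ * ∑ s : MIdx d ℓ, |noise f K h Z u s| +
          L * (d ^ floorLT β * Cβ * h ^ β * (Kmax * (μmax * ballVol d) + ε))) +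
        d ^ floorLT β * Cβ * R ^ β * h ^ β =
        C₂ * ((n * h ^ d)⁻¹ * ∑ s : MIdx d ℓ, |noise f K h Z u s|) + C₃ * h ^ β := by
      rw [hC₃, hC₂]
      ring
    rw [← hL, h7] at h4
    set S := (n * h ^ d)⁻¹ * ∑ s : MIdx d ℓ, |noise f K h Z u s|
    calc _ ≤ C₂ * S + C₃ * h ^ β + d * Cβ * ρ ^ min 1 β := by linarith
      _ ≤ (C₁ + C₂ + C₃ + d * Cβ + Cβ) * S + (C₁ + C₂ + C₃ + d * Cβ + Cβ) * h ^ β +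
          (C₁ + C₂ + C₃ + d * Cβ + Cβ) * ρ ^ min 1 β := by
          gcongr <;> linarith
      _ = _ := by ring
  · right
    push Not at hdev
    refine ⟨hdev, ?_⟩
    have h4 := abs_lpEst_le (ℓ := ℓ) hd hK hP.holder hR hh hτ hZ hxu
    rw [← hL, ← hC₁] at h4
    have h5 := hP.holder.abs_le hd hx
    set Q := τ⁻¹ * (h ^ d)⁻¹ with hQ
    have hQ0 : 0 ≤ Q := by positivity
    set S := (n : ℝ)⁻¹ * ∑ i, |resid f (Z i)|
    -- The summands 1 let the product also absorb `|f x| ≤ Cβ`.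
    have h6 : 1 ≤ (1 + Q) * (1 + S) := by nlinarith [mul_nonneg hQ0 hres]
    calc _ ≤ C₁ * (Q * (1 + S)) + Cβ * 1 := by
          rw [mul_one]
          exact (abs_sub _ _).trans (add_le_add h4 h5)
      _ ≤ (C₁ + C₂ + C₃ + d * Cβ) * ((1 + Q) * (1 + S)) + Cβ * ((1 + Q) * (1 + S)) := by
          gcongr <;> linarith
      _ = _ := by ring

end Pointwise

/-! ### Calculus of upper expectations. -/

section UpperExpectation

variable {α : Type*} [MeasurableSpace α] {μ : Measure α}

/-- `upperExp` asks for a majorant at every point; adding `⊤` on a measurable null set that contains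
the exceptional points costs nothing. -/
theorem upperExp_le_of_ae {F G : α → ℝ≥0∞} (hG : Measurable G) (h : ∀ᵐ a ∂μ, F a ≤ G a) :
    upperExp μ F ≤ ∫⁻ a, G a ∂μ := by
  set S := toMeasurable μ {a | ¬ F a ≤ G a} with hS
  have hS0 : μ S = 0 := by rw [hS, measure_toMeasurable]; exact h
  have hSm : MeasurableSet S := measurableSet_toMeasurable _ _
  refine iInf_le_of_le (fun a => G a + S.indicator (fun _ => ⊤) a)
    (iInf_le_of_le (hG.add (measurable_const.indicator hSm)) (iInf_le_of_le (fun a => ?_) ?_))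
  · by_cases ha : F a ≤ G a
    · exact ha.trans le_self_add
    · have haS : a ∈ S := subset_toMeasurable μ {a | ¬ F a ≤ G a} ha
      simp [haS]
  · rw [lintegral_add_left hG, lintegral_indicator_const hSm, hS0]
    simp

/-- The integral of the positive part of the measurable function `F` is at most `a`. -/
structure MeanLE (μ : Measure α) (F : α → ℝ) (a : ℝ) : Prop where
  measurable : Measurable F
  nonneg : 0 ≤ a
  le : ∫⁻ x, ENNReal.ofReal (F x) ∂μ ≤ ENNReal.ofReal a

theorem MeanLE.const [IsProbabilityMeasure μ] {c : ℝ} (hc : 0 ≤ c) : MeanLE μ (fun _ => c) c :=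
  ⟨measurable_const, hc, by simp⟩

theorem MeanLE.add {F G : α → ℝ} {a b : ℝ} (hF : MeanLE μ F a) (hG : MeanLE μ G b) :
    MeanLE μ (fun x => F x + G x) (a + b) := by
  refine ⟨hF.measurable.add hG.measurable, add_nonneg hF.nonneg hG.nonneg, ?_⟩
  calc _ ≤ ∫⁻ x, (ENNReal.ofReal (F x) + ENNReal.ofReal (G x)) ∂μ :=
        lintegral_mono fun x => ENNReal.ofReal_add_le
    _ = _ := lintegral_add_left (ENNReal.measurable_ofReal.comp hF.measurable) _
    _ ≤ _ := by
        rw [ENNReal.ofReal_add hF.nonneg hG.nonneg]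
        exact add_le_add hF.le hG.le

theorem MeanLE.const_mul {F : α → ℝ} {a c : ℝ} (hc : 0 ≤ c) (hF : MeanLE μ F a) :
    MeanLE μ (fun x => c * F x) (c * a) := by
  refine ⟨hF.measurable.const_mul c, mul_nonneg hc hF.nonneg, ?_⟩
  simp_rw [ENNReal.ofReal_mul hc]
  rw [lintegral_const_mul' _ _ ENNReal.ofReal_ne_top]
  exact mul_le_mul_right hF.le _

theorem MeanLE.mono {F : α → ℝ} {a b : ℝ} (hF : MeanLE μ F a) (hab : a ≤ b) : MeanLE μ F b :=
  ⟨hF.measurable, hF.nonneg.trans hab, hF.le.trans (ENNReal.ofReal_le_ofReal hab)⟩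

theorem MeanLE.sum {ι : Type*} {s : Finset ι} {F : ι → α → ℝ} {a : ι → ℝ}
    (h : ∀ i ∈ s, MeanLE μ (F i) (a i)) : MeanLE μ (fun x => ∑ i ∈ s, F i x) (∑ i ∈ s, a i) := by
  classical
  induction s using Finset.induction_on with
  | empty => exact ⟨by simp, by simp, by simp⟩
  | insert i s hi ih =>
    simp only [Finset.sum_insert hi]
    exact (h i (Finset.mem_insert_self i s)).add
      (ih fun j hj => h j (Finset.mem_insert_of_mem hj))

end UpperExpectation

/-! ### Powers of the error under exponential majorants. -/

section PowerBounds

variable {d : ℕ} {β Cβ μmin μmax : ℝ} {σ : ℝ≥0} {K : E d → ℝ} {Kmin Kmax Δ : ℝ}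

/-- A substitute for Cauchy–Schwarz: it separates the probability of the bad event from the second
moment of the crude bound, with a weight `A` to be optimized later. -/
theorem le_add_inv_mul_sq {A W : ℝ} (hA : 0 < A) (hW : 0 ≤ W) : W ≤ A + A⁻¹ * W ^ 2 := by
  rcases le_total W A with h | h
  · have : 0 ≤ A⁻¹ * W ^ 2 := by positivity
    linarith
  · have : W ≤ A⁻¹ * W ^ 2 := by
      rw [← div_eq_inv_mul, le_div_iff₀ hA]
      nlinarith
    linarith

/-- Bound for powers of the error, with smooth majorants in place of indicators. -/
theorem exists_rpow_error_bound (hd : 1 ≤ d) (hβ : 0 < β) (hK : IsKernelWith K Kmin Kmax Δ)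
    (hμmin : 0 < μmin) (hμ : 0 ≤ μmax) (hCβ : 0 < Cβ) {ℓ : ℕ} (hℓ : floorLT β ≤ ℓ) {H R : ℝ}
    (hH : 0 < H) (hR : 1 ≤ R) {p : ℝ} (hp : 1 ≤ p) : ∃ C ε τ₀ : ℝ, 0 < C ∧ 0 < ε ∧ 0 < τ₀ ∧
      ∀ (P : Measure (E d × ℝ)) [IsProbabilityMeasure P] (f : E d → ℝ),
      InClass β Cβ μmin μmax σ P f → ∀ (n : ℕ) (h τ ρ : ℝ) (u x x' : E d) (Z : Fin n → E d × ℝ),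
      0 < n → 0 < h → h ≤ H → 0 < τ → τ ≤ τ₀ → (∀ i, (Z i).1 ∈ cube d) → u ∈ cube d →
      x ∈ cube d → x' ∈ cube d → ‖x' - u‖ ≤ R * h → ‖x' - x‖ ≤ ρ → ∀ (t A : ℝ), 0 ≤ t → 0 < A →
      |lpEst K ℓ h τ Z u x' - f x| ^ p ≤ C * (ρ ^ (p * min 1 β) + h ^ (p * β) +
        ((n * h ^ d)⁻¹ * ∑ s : MIdx d ℓ, |noise f K h Z u s|) ^ p +
        A * gramExc K ℓ h P t ε Z u +
        A⁻¹ * (1 + τ⁻¹ * (h ^ d)⁻¹) ^ (2 * p) * expMean f Z) := by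
  obtain ⟨C, ε, τ₀, hC, hε, hτ₀, hdich⟩ := exists_error_dichotomy (μmax := μmax) (σ := σ)
    hd hβ hK hμmin hμ hCβ hℓ hH hR
  obtain ⟨Ce, hCe, hexp⟩ := exists_rpow_le_mul_exp (2 * p)
  refine ⟨C ^ p * (3 ^ (p - 1) + 1 + Ce), ε, τ₀, by positivity, hε, hτ₀, ?_⟩
  intro P _ f hP n h τ ρ u x x' Z hn hh hhH hτ hττ hZ hu hx hx' hxu hxx t A ht hA
  have hp0 : 0 ≤ p := by linarith
  have hρ : 0 ≤ ρ := (norm_nonneg _).trans hxx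
  set S := (n * h ^ d)⁻¹ * ∑ s : MIdx d ℓ, |noise f K h Z u s| with hS
  have hS0 : 0 ≤ S := mul_nonneg (by positivity) (Finset.sum_nonneg fun _ _ => abs_nonneg _)
  set Q := 1 + τ⁻¹ * (h ^ d)⁻¹ with hQ
  have hQ0 : 0 < Q := by positivity
  set V := (n : ℝ)⁻¹ * ∑ i, |resid f (Z i)| with hV
  have hV0 : 0 ≤ V := mul_nonneg (by positivity) (Finset.sum_nonneg fun i _ => abs_nonneg _)
  have hg := gramExc_nonneg (ℓ := ℓ) (K := K) (P := P) h t ε Z u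
  have he := expMean_nonneg f Z
  have hρβ : 0 ≤ ρ ^ min 1 β := Real.rpow_nonneg hρ _
  have hhβ : 0 ≤ h ^ β := Real.rpow_nonneg hh.le _
  have e1 : (ρ ^ min 1 β) ^ p = ρ ^ (p * min 1 β) := by rw [← Real.rpow_mul hρ, mul_comm]
  have e2 : (h ^ β) ^ p = h ^ (p * β) := by rw [← Real.rpow_mul hh.le, mul_comm]
  set X := ρ ^ (p * min 1 β) + h ^ (p * β) + S ^ p with hX
  have hX0 : 0 ≤ X := by positivity
  set Y := A * gramExc K ℓ h P t ε Z u with hY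
  have hY0 : 0 ≤ Y := by positivity
  set W := A⁻¹ * Q ^ (2 * p) * expMean f Z with hW
  have hW0 : 0 ≤ W := by positivity
  have hCp : 0 < C ^ p := by positivity
  have h3p : (0 : ℝ) < 3 ^ (p - 1) := by positivity
  rcases hdich P f hP n h τ ρ u x x' Z hn hh hhH hτ hττ hZ hu hx hx' hxu hxx with h1 | ⟨h1, h2⟩
  · calc _ ≤ (C * (ρ ^ min 1 β + h ^ β + S)) ^ p := by gcongr
      _ = C ^ p * (ρ ^ min 1 β + h ^ β + S) ^ p := by
          rw [Real.mul_rpow hC.le (by positivity)]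
      _ ≤ C ^ p * (3 ^ (p - 1) * X) := by
          rw [hX, ← e1, ← e2]
          gcongr
          exact add_add_rpow_le hρβ hhβ hS0 hp
      _ ≤ C ^ p * ((3 ^ (p - 1) + 1 + Ce) * (X + Y + W)) := by
          gcongr
          · linarith
          · linarith
      _ = _ := by ring
  · obtain ⟨s, s', hs⟩ := h1
    have h3 : A ≤ Y := le_mul_of_one_le_right hA.le (one_le_gramExc ht hs)
    set B := (Q * (1 + V)) ^ p with hB
    have hB0 : 0 ≤ B := by positivity
    -- The power of the mean residual is at most a multiple of its exponential, and by Jensen of the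
    -- mean exponential, whose expectation is bounded.
    have h4 : B ^ 2 ≤ Q ^ (2 * p) * (Ce * expMean f Z) := by
      have : B ^ 2 = Q ^ (2 * p) * (1 + V) ^ (2 * p) := by
        rw [hB, ← Real.rpow_natCast, ← Real.rpow_mul (by positivity),
          ← Real.mul_rpow hQ0.le (by positivity)]
        congr 1
        push_cast
        ring
      rw [this]
      gcongr
      refine (hexp V hV0).trans ?_
      gcongr
      exact exp_mean_le hn _
    calc _ ≤ (C * (Q * (1 + V))) ^ p := by gcongr
      _ = C ^ p * B := by rw [Real.mul_rpow hC.le (by positivity)]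
      _ ≤ C ^ p * (A + A⁻¹ * B ^ 2) := by
          gcongr
          exact le_add_inv_mul_sq hA hB0
      _ ≤ C ^ p * (Y + A⁻¹ * (Q ^ (2 * p) * (Ce * expMean f Z))) := by gcongr
      _ = C ^ p * (1 * Y + Ce * W) := by rw [hW]; ring
      _ ≤ C ^ p * ((3 ^ (p - 1) + 1 + Ce) * Y + (3 ^ (p - 1) + 1 + Ce) * W) := by
          gcongr <;> linarith
      _ ≤ C ^ p * ((3 ^ (p - 1) + 1 + Ce) * (X + Y + W)) := by
          gcongr
          rw [← mul_add]
          gcongr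
          linarith
      _ = _ := by ring

/-- Extract the noise scale `N ^ (-1/2)` before passing from powers to exponentials. The `+ 1` in
the constant keeps it positive when `ι` is empty. -/
theorem exists_sum_rpow_le_sum_exp (ι : Type*) [Fintype ι] {p : ℝ} (hp : 1 ≤ p) :
    ∃ C, 0 < C ∧ ∀ (y : ι → ℝ) (N : ℝ), (∀ i, 0 ≤ y i) → 0 < N →
      (N⁻¹ * ∑ i, y i) ^ p ≤ C * (N ^ (-(p / 2)) * ∑ i, Real.exp (N ^ (-(1 / 2 : ℝ)) * y i)) := by
  obtain ⟨Ce, hCe, hexp⟩ := exists_rpow_le_mul_exp p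
  have hp0 : 0 ≤ p := by linarith
  refine ⟨((Fintype.card ι : ℝ) + 1) ^ (p - 1) * Ce, by positivity, fun y N hy hN => ?_⟩
  set z : ι → ℝ := fun i => N ^ (-(1 / 2 : ℝ)) * y i with hz
  have hz0 : ∀ i, 0 ≤ z i := fun i => mul_nonneg (by positivity) (hy i)
  have h1 : N⁻¹ * ∑ i, y i = N ^ (-(1 / 2 : ℝ)) * ∑ i, z i := by
    rw [← Finset.mul_sum, ← mul_assoc, ← Real.rpow_add hN, ← Real.rpow_neg_one]
    norm_num
  have h2 : (∑ i, z i) ^ p ≤ ((Fintype.card ι : ℝ) + 1) ^ (p - 1) * (Ce * ∑ i, Real.exp (z i)) := by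
    refine (Real.rpow_sum_le_const_mul_sum_rpow_of_nonneg _ hp fun i _ => hz0 i).trans ?_
    rw [Finset.card_univ]
    refine mul_le_mul (Real.rpow_le_rpow (by positivity) (by linarith) (by linarith)) ?_
      (Finset.sum_nonneg fun i _ => Real.rpow_nonneg (hz0 i) _) (by positivity)
    rw [Finset.mul_sum]
    exact Finset.sum_le_sum fun i _ =>
      (Real.rpow_le_rpow (hz0 i) (by linarith) hp0).trans (hexp _ (hz0 i))
  rw [h1, Real.mul_rpow (by positivity) (Finset.sum_nonneg fun i _ => hz0 i),
    ← Real.rpow_mul hN.le, show -(1 / 2 : ℝ) * p = -(p / 2) by ring]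
  calc _ ≤ N ^ (-(p / 2)) * (((Fintype.card ι : ℝ) + 1) ^ (p - 1) *
        (Ce * ∑ i, Real.exp (z i))) := by gcongr
    _ = _ := by ring

/-- Each term obeys `y ≤ a + t⁻¹ * exp (t * (y - a))`. With `a` at the level of the expected
maximum, the exponentials can be summed over all grid points. -/
theorem sum_le_of_exp {ι : Type*} [Fintype ι] (y : ι → ℝ) {t a : ℝ} (ht : 0 < t) :
    ∑ i, y i ≤ Fintype.card ι * a + t⁻¹ * ∑ i, Real.exp (-(t * a)) * Real.exp (t * y i) := by
  have h : ∀ i, y i ≤ a + t⁻¹ * (Real.exp (-(t * a)) * Real.exp (t * y i)) := by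
    intro i
    rw [← Real.exp_add]
    have h1 := Real.add_one_le_exp (-(t * a) + t * y i)
    have h2 : y i - a ≤ t⁻¹ * Real.exp (-(t * a) + t * y i) := by
      rw [← div_eq_inv_mul, le_div_iff₀ ht]
      linarith
    linarith
  refine (Finset.sum_le_sum fun i _ => h i).trans_eq ?_
  rw [Finset.sum_add_distrib, ← Finset.mul_sum, Finset.sum_const, Finset.card_univ, nsmul_eq_mul]

end PowerBounds

/-! ### The grid: distance to the nearest point and number of cells. -/

section Grid

variable {d M : ℕ}

/-- The grid point with index `k`. -/
noncomputable def gridPt (M : ℕ) (k : Fin d → Fin M) : E d :=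
  WithLp.toLp 2 fun i => (2 * ((k i : ℕ) : ℝ) + 1) / (2 * M)

theorem gridPt_mem_cube (k : Fin d → Fin M) : gridPt M k ∈ cube d := by
  intro i
  have hk : ((k i : ℕ) : ℝ) + 1 ≤ M := by exact_mod_cast (k i).isLt
  have hM : (0 : ℝ) < M := by
    have : (0 : ℝ) ≤ (k i : ℕ) := Nat.cast_nonneg _
    linarith
  simp only [gridPt]
  constructor
  · positivity
  · rw [div_le_one (by positivity)]
    linarith

/-- The index in each coordinate is `⌊M * x i⌋₊`, except at `x i = 1`, where this equals `M` and the
last cell is taken. -/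
theorem exists_gridPt_near (hM : 1 ≤ M) {x : E d} (hx : x ∈ cube d) :
    ∃ k : Fin d → Fin M, ‖x - gridPt M k‖ ≤ d * (1 / M) := by
  have hM0 : (0 : ℝ) < M := by exact_mod_cast hM
  have key : ∀ i, ∃ k : Fin M, |x i - (2 * ((k : ℕ) : ℝ) + 1) / (2 * M)| ≤ 1 / M := by
    intro i
    obtain ⟨h0, h1⟩ := hx i
    have hfl := Nat.floor_le (mul_nonneg hM0.le h0)
    have hlt := Nat.lt_floor_add_one ((M : ℝ) * x i)
    have hMx : (M : ℝ) * x i ≤ M := mul_le_of_le_one_right hM0.le h1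
    have e : ∀ y : ℝ, x i - (2 * y + 1) / (2 * M) = (2 * (M * x i) - (2 * y + 1)) / (2 * M) := by
      intro y
      field_simp
    have e' : (1 : ℝ) / M = 2 / (2 * M) := by field_simp
    rcases lt_or_ge ⌊(M : ℝ) * x i⌋₊ M with h | h
    · refine ⟨⟨⌊(M : ℝ) * x i⌋₊, h⟩, ?_⟩
      rw [e, e', abs_div, abs_of_pos (by positivity : (0 : ℝ) < 2 * M)]
      gcongr
      rw [abs_le]
      constructor <;> dsimp only <;> linarith
    · have h2 : (M : ℝ) ≤ ⌊(M : ℝ) * x i⌋₊ := by exact_mod_cast h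
      refine ⟨⟨M - 1, by omega⟩, ?_⟩
      rw [e, e', abs_div, abs_of_pos (by positivity : (0 : ℝ) < 2 * M)]
      gcongr
      rw [abs_le]
      push_cast [hM]
      constructor <;> linarith
  choose k hk using key
  refine ⟨k, ?_⟩
  rw [EuclideanSpace.norm_eq]
  refine Real.sqrt_le_iff.2 ⟨by positivity, ?_⟩
  calc ∑ i, ‖(x - gridPt M k) i‖ ^ 2 ≤ ∑ _i : Fin d, (1 / (M : ℝ)) ^ 2 := by
        refine Finset.sum_le_sum fun i _ => ?_
        gcongr
        exact hk i
    _ = d * (1 / (M : ℝ)) ^ 2 := by simp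
    _ ≤ (d * (1 / (M : ℝ))) ^ 2 := by
        rw [mul_pow]
        gcongr
        exact_mod_cast Nat.le_self_pow two_ne_zero d

theorem exists_nearest_eq_gridPt (hM : 1 ≤ M) {x : E d} (hx : x ∈ cube d) :
    ∃ k : Fin d → Fin M, nearest M x = gridPt M k ∧ ‖x - gridPt M k‖ ≤ d * (1 / M) := by
  obtain ⟨hmem, hmin, -⟩ := nearest_spec hM x
  obtain ⟨k, hk⟩ := hmem
  obtain ⟨k', hk'⟩ := exists_gridPt_near hM hx
  refine ⟨k, hk.symm, ?_⟩
  have hk2 : nearest M x = gridPt M k := hk.symm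
  rw [← hk2]
  exact (hmin _ ⟨k', rfl⟩).trans hk'

/-- The number of cells compensates the mass of order `h ^ d` of one ball. -/
theorem card_grid_mul_le {h c : ℝ} (hh : 0 < h) (hMh : M * h ≤ c) :
    (Fintype.card (Fin d → Fin M) : ℝ) * h ^ d ≤ c ^ d := by
  rw [Fintype.card_fun, Fintype.card_fin, Fintype.card_fin, Nat.cast_pow, ← mul_pow]
  gcongr

end Grid

/-! ### Non-asymptotic risk bounds. -/

section Risk

variable {d : ℕ} {β Cβ μmin μmax : ℝ} {σ : ℝ≥0} {K : E d → ℝ} {Kmin Kmax Δ : ℝ}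

theorem InClass.ae_sample_mem_cube {P : Measure (E d × ℝ)} [IsProbabilityMeasure P] {f : E d → ℝ}
    (hP : InClass β Cβ μmin μmax σ P f) (n : ℕ) :
    ∀ᵐ Z ∂(sampleLaw P n), ∀ i, (Z i).1 ∈ cube d :=
  ae_all_iff.2 fun i =>
    (measurePreserving_eval (fun _ : Fin n => P) i).quasiMeasurePreserving.ae hP.ae_mem_cube

/-- A level at which the exponential moments of the Gram deviations are under control. -/
theorem exists_level (B : ℝ) (hB : 0 ≤ B) {ε : ℝ} (hε : 0 < ε) :
    ∃ t : ℝ, 0 < t ∧ t ≤ 1 ∧ B * t ≤ ε / 2 := by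
  refine ⟨min 1 (ε / (2 * (B + 1))), lt_min one_pos (by positivity), min_le_left _ _, ?_⟩
  calc B * min 1 (ε / (2 * (B + 1))) ≤ (B + 1) * (ε / (2 * (B + 1))) := by
        gcongr
        · linarith
        · exact min_le_right _ _
    _ = ε / 2 := by field_simp

theorem meanLE_exp_noise {P : Measure (E d × ℝ)} [IsProbabilityMeasure P] {f : E d → ℝ}
    (hP : InClass β Cβ μmin μmax σ P f) (hd : 1 ≤ d) (hK : IsKernelWith K Kmin Kmax Δ)
    (hμ : 0 ≤ μmax) {h : ℝ} (hh : 0 < h) (u : E d) {ℓ : ℕ} (s : MIdx d ℓ) (n : ℕ) {t : ℝ}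
    (ht0 : 0 ≤ t) (ht : t ≤ 1) :
    MeanLE (sampleLaw P n) (fun Z => Real.exp (t * |noise f K h Z u s|))
      (2 * Real.exp (4 * Real.exp (2 * σ ^ 2 * Kmax ^ 2) * (μmax * ballVol d) *
        (n * h ^ d) * t ^ 2)) :=
  ⟨Real.measurable_exp.comp ((hK.measurable_noise hP.holder h u s).abs.const_mul t), by positivity,
    hP.lintegral_exp_noise_le hd hK hμ hh u s n ht0 ht⟩

/-- The two remainder terms for the event that the Gram matrix is far from its expectation. -/
theorem meanLE_remainder {P : Measure (E d × ℝ)} [IsProbabilityMeasure P] {f : E d → ℝ}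
    (hP : InClass β Cβ μmin μmax σ P f) (hK : IsKernelWith K Kmin Kmax Δ)
    (hμ : 0 ≤ μmax) {h : ℝ} (hh : 0 < h) (ℓ : ℕ) {ι : Type*} [Fintype ι] (u : ι → E d) (n : ℕ)
    {t ε : ℝ} (ht0 : 0 ≤ t) (ht : t ≤ 1)
    (htε : 2 * Real.exp (2 * Kmax) * (μmax * ballVol d) * t ≤ ε / 2) {Q : ℝ} (hQ : 0 ≤ Q) :
    MeanLE (sampleLaw P n) (fun Z =>
        Real.exp (t * ε / 4 * (n * h ^ d)) * ∑ k, gramExc K ℓ h P t ε Z (u k) +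
        (Real.exp (t * ε / 4 * (n * h ^ d)))⁻¹ * Q * expMean f Z)
      ((2 * Fintype.card (MIdx d ℓ) ^ 2 + 2 * Real.exp (σ ^ 2 / 2)) *
        (Real.exp (-(t * ε / 4 * (n * h ^ d))) * (Fintype.card ι + Q))) := by
  have h1 : ∀ k ∈ Finset.univ, MeanLE (sampleLaw P n) (fun Z => gramExc K ℓ h P t ε Z (u k))
      (2 * Fintype.card (MIdx d ℓ) ^ 2 * Real.exp (-(t * ε / 2 * (n * h ^ d)))) := fun k _ =>
    ⟨hK.measurable_gramExc h t ε (u k), by positivity,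
      hP.lintegral_gramExc_le hK hμ hh (u k) n ht0 ht htε⟩
  have h2 : MeanLE (sampleLaw P n) (fun Z => expMean f Z) (2 * Real.exp (σ ^ 2 / 2)) :=
    ⟨hP.holder.measurable_expMean, by positivity, hP.lintegral_expMean_le n⟩
  have h3 := ((MeanLE.sum h1).const_mul (Real.exp_pos (t * ε / 4 * (n * h ^ d))).le).add
    (h2.const_mul (mul_nonneg (inv_nonneg.2 (Real.exp_pos (t * ε / 4 * (n * h ^ d))).le) hQ))
  refine h3.mono ?_
  rw [Finset.sum_const, Finset.card_univ, nsmul_eq_mul, ← Real.exp_neg]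
  -- The weight `A = exp (t * ε * N / 4)`, where `N = n * h ^ d`, is the balance point: `A * exp
  -- (-(t * ε * N / 2))` and `A⁻¹` coincide.
  have e : Real.exp (-(t * ε / 4 * (n * h ^ d))) =
      Real.exp (t * ε / 4 * (n * h ^ d)) * Real.exp (-(t * ε / 2 * (n * h ^ d))) := by
    rw [← Real.exp_add]
    ring_nf
  set L2 : ℝ := 2 * (Fintype.card (MIdx d ℓ) : ℝ) ^ 2
  have hL2 : 0 ≤ L2 := by positivity
  set e₁ := Real.exp (-(t * ε / 4 * (n * h ^ d)))
  have he₁ : 0 ≤ e₁ := (Real.exp_pos _).le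
  set s₁ := 2 * Real.exp ((σ : ℝ) ^ 2 / 2)
  have hs₁ : 0 ≤ s₁ := by positivity
  have e2 : Real.exp (t * ε / 4 * (n * h ^ d)) *
      (Fintype.card ι * (L2 * Real.exp (-(t * ε / 2 * (n * h ^ d))))) =
      L2 * (e₁ * Fintype.card ι) := by
    rw [e]
    ring
  rw [e2]
  have h4 : 0 ≤ L2 * (e₁ * Q) := by positivity
  have h5 : 0 ≤ s₁ * (e₁ * Fintype.card ι) := by positivity
  nlinarith

theorem one_le_toReal {q : ℝ≥0∞} (hq : 1 ≤ q) (hq' : q ≠ ⊤) : 1 ≤ q.toReal := by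
  simpa using ENNReal.toReal_mono hq' hq

/-- Non-asymptotic bound for the adversarial `L_q`-risk, `q < ∞`. -/
theorem exists_advRisk_le_of_ne_top (hd : 1 ≤ d) (hβ : 0 < β) (hK : IsKernelWith K Kmin Kmax Δ)
    (hμmin : 0 < μmin) (hμ : 0 ≤ μmax) (hCβ : 0 < Cβ) {ℓ : ℕ} (hℓ : floorLT β ≤ ℓ) {H a b b' : ℝ}
    (hH : 0 < H) (ha : 0 < a) {q : ℝ≥0∞} (hq : 1 ≤ q) (hq' : q ≠ ⊤) :
    ∃ C c τ₀ : ℝ, 0 < C ∧ 0 < c ∧ 0 < τ₀ ∧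
      ∀ (P : Measure (E d × ℝ)) [IsProbabilityMeasure P] (f : E d → ℝ),
      InClass β Cβ μmin μmax σ P f → ∀ (A : E d → Set (E d)) (n M : ℕ) (h τ ρ : ℝ),
      IsAttack ρ A → 0 ≤ ρ → 0 < n → 1 ≤ M → 0 < h → h ≤ H → 1 / M ≤ b * h → M * h ≤ b' →
      ρ ≤ a * h → 1 ≤ n * h ^ d → 0 < τ → τ ≤ τ₀ →
      advRisk q P A (fun (Z : Fin n → E d × ℝ) => ppEst K M ℓ h τ Z) f ≤
        ENNReal.ofReal (C * (ρ ^ (q.toReal * min 1 β) + h ^ (q.toReal * β) +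
          (n * h ^ d) ^ (-(q.toReal / 2)) + Real.exp (-(c * (n * h ^ d))) *
          (n + (1 + τ⁻¹ * (h ^ d)⁻¹) ^ (2 * q.toReal)))) := by
  set p := q.toReal with hpdef
  have hp : 1 ≤ p := one_le_toReal hq hq'
  have hp0 : 0 < p := by linarith
  set R := max 1 (d * b) with hR
  obtain ⟨C, ε, τ₀, hC, hε, hτ₀, hbound⟩ := exists_rpow_error_bound (μmax := μmax) (σ := σ)
    hd hβ hK hμmin hμ hCβ hℓ hH (le_max_left 1 (d * b)) hp
  obtain ⟨Cs, hCs, hsum⟩ := exists_sum_rpow_le_sum_exp (MIdx d ℓ) hp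
  have hbv : 0 ≤ ballVol d := ENNReal.toReal_nonneg
  obtain ⟨t, ht0, ht1, htε⟩ := exists_level (2 * Real.exp (2 * Kmax) * (μmax * ballVol d))
    (by positivity) hε
  set L : ℝ := ((Fintype.card (MIdx d ℓ) : ℕ) : ℝ) with hL
  set D₁ : ℝ := Cs * (L * (2 * Real.exp (4 * Real.exp (2 * σ ^ 2 * Kmax ^ 2) *
    (μmax * ballVol d)))) with hD₁
  set D₂ : ℝ := 2 * L ^ 2 + 2 * Real.exp ((σ : ℝ) ^ 2 / 2) with hD₂
  have hD₁0 : 0 ≤ D₁ := by positivity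
  have hD₂0 : 0 < D₂ := by positivity
  set D := C * (1 + D₁ + D₂) with hD
  have hD0 : 0 < D := by positivity
  -- Number of cells times mass of a ball, both up to powers of `h`. The final constant uses `B + 1`
  -- to be strictly positive.
  set B : ℝ := |b'| ^ d * (μmax * ballVol d * (a + R) ^ d) with hB
  have hR1 : 1 ≤ R := le_max_left _ _
  have hB0 : 0 ≤ B := by positivity
  refine ⟨(B + 1) * D, t * ε / 4, τ₀, by positivity, by positivity, hτ₀, ?_⟩
  intro P _ f hP A n M h τ ρ hA hρ hn hM hh hhH hMb hMb' hρa hN hτ hττ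
  set N : ℝ := n * h ^ d with hNdef
  have hN0 : 0 < N := by linarith
  set Q := (1 + τ⁻¹ * (h ^ d)⁻¹) ^ (2 * p) with hQ
  have hQ0 : 0 ≤ Q := by positivity
  -- the local majorant
  set T : E d → (Fin n → E d × ℝ) → ℝ := fun u Z =>
    C * (ρ ^ (p * min 1 β) + h ^ (p * β) +
      Cs * (N ^ (-(p / 2)) * ∑ s : MIdx d ℓ, Real.exp (N ^ (-(1 / 2 : ℝ)) * |noise f K h Z u s|)) +
      (Real.exp (t * ε / 4 * N) * ∑ _k : Fin 1, gramExc K ℓ h P t ε Z u +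
        (Real.exp (t * ε / 4 * N))⁻¹ * Q * expMean f Z)) with hT
  set bound := ρ ^ (p * min 1 β) + h ^ (p * β) + N ^ (-(p / 2)) +
    Real.exp (-(t * ε / 4 * N)) * (n + Q) with hbd
  have hbd0 : 0 ≤ bound := by positivity
  have hTmean : ∀ u, MeanLE (sampleLaw P n) (T u) (D * bound) := by
    intro u
    have hs1 : N ^ (-(1 / 2 : ℝ)) ≤ 1 := Real.rpow_le_one_of_one_le_of_nonpos hN (by norm_num)
    -- At `t = N ^ (-1/2)` the exponent `N * t ^ 2` equals 1, so the exponential moments of the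
    -- noise are bounded by a constant.
    have hs2 : N * (N ^ (-(1 / 2 : ℝ))) ^ 2 = 1 := by
      rw [← Real.rpow_natCast, ← Real.rpow_mul hN0.le]
      norm_num
      rw [Real.rpow_neg_one, mul_inv_cancel₀ hN0.ne']
    have h1 : MeanLE (sampleLaw P n)
        (fun Z => ∑ s : MIdx d ℓ, Real.exp (N ^ (-(1 / 2 : ℝ)) * |noise f K h Z u s|))
        (L * (2 * Real.exp (4 * Real.exp (2 * σ ^ 2 * Kmax ^ 2) * (μmax * ballVol d)))) := by
      refine (MeanLE.sum fun s _ => meanLE_exp_noise hP hd hK hμ hh u s n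
        (by positivity : 0 ≤ N ^ (-(1 / 2 : ℝ))) hs1).mono (le_of_eq ?_)
      rw [← hNdef]
      simp only [mul_assoc (4 * Real.exp (2 * (σ : ℝ) ^ 2 * Kmax ^ 2) * (μmax * ballVol d)), hs2,
        mul_one, Finset.sum_const, Finset.card_univ, nsmul_eq_mul, hL]
    have h2 := meanLE_remainder hP hK hμ hh ℓ (fun _ : Fin 1 => u) n ht0.le ht1 htε hQ0
    have h3 := ((((MeanLE.const (by positivity : 0 ≤ ρ ^ (p * min 1 β) + h ^ (p * β))).add
      ((h1.const_mul (by positivity : 0 ≤ N ^ (-(p / 2)))).const_mul hCs.le)).add h2).const_mul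
      hC.le)
    refine h3.mono ?_
    rw [hD, mul_assoc C]
    refine mul_le_mul_of_nonneg_left ?_ hC.le
    have e : Cs * (N ^ (-(p / 2)) *
        (L * (2 * Real.exp (4 * Real.exp (2 * σ ^ 2 * Kmax ^ 2) * (μmax * ballVol d))))) =
        D₁ * N ^ (-(p / 2)) := by rw [hD₁]; ring
    rw [e, ← hNdef, ← hL, ← hD₂]
    have hn1 : (1 : ℝ) ≤ n := by exact_mod_cast hn
    calc _ ≤ 1 * (ρ ^ (p * min 1 β) + h ^ (p * β)) + D₁ * N ^ (-(p / 2)) +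
          D₂ * (Real.exp (-(t * ε / 4 * N)) * (n + Q)) := by
          rw [one_mul]
          gcongr
          simpa using hn1
      _ ≤ (1 + D₁ + D₂) * (ρ ^ (p * min 1 β) + h ^ (p * β)) + (1 + D₁ + D₂) * N ^ (-(p / 2)) +
          (1 + D₁ + D₂) * (Real.exp (-(t * ε / 4 * N)) * (n + Q)) := by
          gcongr <;> linarith
      _ = _ := by rw [hbd]; ring
  -- the global majorant
  set ball : (Fin d → Fin M) → Set (E d) := fun k => Metric.closedBall (gridPt M k) ((a + R) * h)
    with hball
  have hballm : ∀ k, MeasurableSet (ball k) := fun k => Metric.isClosed_closedBall.measurableSet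
  -- The indicator sees only `X` and `T` only the sample, so by independence each term integrates to
  -- a product. A sum over cells weighted by their masses replaces a maximum and avoids the
  -- logarithm.
  set G : (E d × ℝ) × (Fin n → E d × ℝ) → ℝ≥0∞ := fun w => ∑ k : Fin d → Fin M,
    (Prod.fst ⁻¹' ball k : Set (E d × ℝ)).indicator (fun _ => (1 : ℝ≥0∞)) w.1 *
      ENNReal.ofReal (T (gridPt M k) w.2) with hG
  have hm1 : ∀ k, Measurable ((Prod.fst ⁻¹' ball k : Set (E d × ℝ)).indicator
      (fun _ => (1 : ℝ≥0∞))) := fun k => measurable_const.indicator (measurable_fst (hballm k))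
  have hm2 : ∀ k : Fin d → Fin M, Measurable fun Z => ENNReal.ofReal (T (gridPt M k) Z) :=
    fun k => ENNReal.measurable_ofReal.comp (hTmean _).measurable
  have hm3 : ∀ k : Fin d → Fin M, Measurable fun w : (E d × ℝ) × (Fin n → E d × ℝ) =>
      (Prod.fst ⁻¹' ball k : Set (E d × ℝ)).indicator (fun _ => (1 : ℝ≥0∞)) w.1 *
        ENNReal.ofReal (T (gridPt M k) w.2) :=
    fun k => ((hm1 k).comp measurable_fst).mul ((hm2 k).comp measurable_snd)
  have hGm : Measurable G := Finset.measurable_fun_sum _ fun k _ => hm3 k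
  rw [advRisk, if_neg hq']
  refine (upperExp_le_of_ae hGm ?_).trans ?_
  · filter_upwards [(Measure.quasiMeasurePreserving_fst (μ := P) (ν := sampleLaw P n)).ae
      hP.ae_mem_cube, (Measure.quasiMeasurePreserving_snd (μ := P) (ν := sampleLaw P n)).ae
      (hP.ae_sample_mem_cube n)] with w hw hZ
    refine iSup₂_le fun x' hx' => ?_
    obtain ⟨-, -, hAc, hAr⟩ := hA w.1.1 hw
    obtain ⟨k, hk, hxk⟩ := exists_nearest_eq_gridPt hM (hAc hx')
    have hxk' : ‖x' - gridPt M k‖ ≤ R * h := by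
      refine hxk.trans ?_
      calc d * (1 / (M : ℝ)) ≤ d * (b * h) := by gcongr
        _ = d * b * h := by ring
        _ ≤ R * h := by gcongr; exact le_max_right _ _
    -- This uses `ρ ≤ a * h`: the attacked point falls only into cells within order `h` of `X`.
    have hmem : w.1 ∈ (Prod.fst ⁻¹' ball k : Set (E d × ℝ)) := by
      simp only [hball, Set.mem_preimage, Metric.mem_closedBall, dist_eq_norm]
      have h1 := hAr x' hx'
      rw [norm_sub_rev] at h1
      calc ‖w.1.1 - gridPt M k‖ ≤ ‖w.1.1 - x'‖ + ‖x' - gridPt M k‖ := norm_sub_le_norm_sub_add_norm_sub ..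
        _ ≤ a * h + R * h := add_le_add (h1.trans hρa) hxk'
        _ = _ := by ring
    refine le_trans ?_ (Finset.single_le_sum (f := fun k : Fin d → Fin M =>
      (Prod.fst ⁻¹' ball k : Set (E d × ℝ)).indicator (fun _ => (1 : ℝ≥0∞)) w.1 *
        ENNReal.ofReal (T (gridPt M k) w.2)) (fun _ _ => zero_le) (Finset.mem_univ k))
    rw [Set.indicator_of_mem hmem, one_mul]
    refine ENNReal.ofReal_le_ofReal ?_
    rw [ppEst, hk]
    refine (hbound P f hP n h τ ρ (gridPt M k) w.1.1 x' w.2 hn hh hhH hτ hττ hZ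
      (gridPt_mem_cube k) hw (hAc hx') hxk' (hAr x' hx') t (Real.exp (t * ε / 4 * N)) ht0.le
      (Real.exp_pos _)).trans ?_
    simp only [hT]
    have h2 := hsum (fun s => |noise f K h w.2 (gridPt M k) s|) N (fun _ => abs_nonneg _) hN0
    rw [add_assoc (_ + _ + _)]
    simp only [Finset.sum_const, Finset.card_univ, Fintype.card_fin, one_smul]
    gcongr
  · rw [hG, lintegral_finsetSum _ fun k _ => hm3 k]
    calc _ = ∑ k : Fin d → Fin M, P (Prod.fst ⁻¹' ball k) *
          ∫⁻ Z, ENNReal.ofReal (T (gridPt M k) Z) ∂(sampleLaw P n) := by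
          refine Finset.sum_congr rfl fun k _ => ?_
          rw [lintegral_prod_mul (hm1 k).aemeasurable (hm2 k).aemeasurable,
            lintegral_indicator_const (measurable_fst (hballm k)), one_mul]
      _ ≤ ∑ _k : Fin d → Fin M, ENNReal.ofReal (μmax * ballVol d * ((a + R) * h) ^ d) *
          ENNReal.ofReal (D * bound) := by
          refine Finset.sum_le_sum fun k _ => mul_le_mul' ?_ (hTmean _).le
          rw [← ENNReal.ofReal_toReal (measure_ne_top P _)]
          exact ENNReal.ofReal_le_ofReal (hP.measure_closedBall_le hμ _ (by positivity))
      _ = ENNReal.ofReal ((Fintype.card (Fin d → Fin M) : ℝ) *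
          ((μmax * ballVol d * ((a + R) * h) ^ d) * (D * bound))) := by
          rw [Finset.sum_const, Finset.card_univ, nsmul_eq_mul, ← ENNReal.ofReal_mul (by positivity),
            ← ENNReal.ofReal_natCast, ← ENNReal.ofReal_mul (by positivity)]
      _ ≤ _ := by
          refine ENNReal.ofReal_le_ofReal ?_
          have h1 := card_grid_mul_le (d := d) hh (hMb'.trans (le_abs_self b'))
          calc _ = ((Fintype.card (Fin d → Fin M) : ℝ) * h ^ d) *
                (μmax * ballVol d * (a + R) ^ d) * (D * bound) := by
                rw [mul_pow]
                ring
            _ ≤ |b'| ^ d * (μmax * ballVol d * (a + R) ^ d) * (D * bound) := by gcongr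
            _ ≤ (B + 1) * (D * bound) := by
                rw [← hB]
                gcongr
                linarith
            _ = _ := by ring

/-- A smooth majorant for the maximum of the noise terms over finitely many base points. -/
theorem meanLE_max_noise {P : Measure (E d × ℝ)} [IsProbabilityMeasure P] {f : E d → ℝ}
    (hP : InClass β Cβ μmin μmax σ P f) (hd : 1 ≤ d) (hK : IsKernelWith K Kmin Kmax Δ)
    (hμ : 0 ≤ μmax) {h : ℝ} (hh : 0 < h) (ℓ : ℕ) {ι : Type*} [Fintype ι] (u : ι → E d) {n : ℕ}
    (hn : 0 < n) {b₁ N s m Cσ : ℝ} (hcard : (Fintype.card ι : ℝ) ≤ b₁ * n)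
    (hlog : 1 ≤ Real.log n) (hN : N = n * h ^ d) (hs0 : 0 < s) (hs1 : s ≤ 1)
    (hs2 : N * s ^ 2 = Real.log n) (hm : s * m = (Cσ + 1) * Real.log n)
    (hCσ : Cσ = 4 * Real.exp (2 * σ ^ 2 * Kmax ^ 2) * (μmax * ballVol d)) :
    MeanLE (sampleLaw P n) (fun Z => N⁻¹ * (Fintype.card (MIdx d ℓ) * m) +
      N⁻¹ * (s⁻¹ * ∑ k, ∑ i : MIdx d ℓ,
        Real.exp (-(s * m)) * Real.exp (s * |noise f K h Z (u k) i|)))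
      ((Fintype.card (MIdx d ℓ) * (Cσ + 1) + 2 * Fintype.card (MIdx d ℓ) * b₁) * s) := by
  have hbv : 0 ≤ ballVol d := ENNReal.toReal_nonneg
  have hn0 : (0 : ℝ) < n := by exact_mod_cast hn
  have hN0 : 0 < N := by rw [hN]; positivity
  have hCσ0 : 0 ≤ Cσ := by rw [hCσ]; positivity
  have hb₁ : 0 ≤ b₁ := nonneg_of_mul_nonneg_left ((Nat.cast_nonneg _).trans hcard) hn0
  have hm0 : 0 ≤ m := by
    have : 0 ≤ s * m := by rw [hm]; positivity
    exact nonneg_of_mul_nonneg_right this hs0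
  have hs3 : N⁻¹ * (s⁻¹ * Real.log n) = s := by
    rw [← hs2]
    field_simp
  have h1 : MeanLE (sampleLaw P n) (fun Z => ∑ k, ∑ i : MIdx d ℓ,
      Real.exp (-(s * m)) * Real.exp (s * |noise f K h Z (u k) i|))
      (2 * Fintype.card (MIdx d ℓ) * b₁) := by
    refine (MeanLE.sum fun k _ => MeanLE.sum fun i _ =>
      (meanLE_exp_noise hP hd hK hμ hh (u k) i n hs0.le hs1).const_mul
        (Real.exp_pos (-(s * m))).le).mono ?_
    rw [← hCσ, ← hN, mul_assoc Cσ, hs2]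
    -- The threshold `m` brings each term down to `2 / n`, which pays for summing over at most `b₁ *
    -- n` base points.
    have h3 : Real.exp (-(s * m)) * (2 * Real.exp (Cσ * Real.log n)) = 2 * (n : ℝ)⁻¹ := by
      rw [hm, mul_left_comm, ← Real.exp_add,
        show -((Cσ + 1) * Real.log n) + Cσ * Real.log n = -Real.log n by ring, Real.exp_neg,
        Real.exp_log hn0]
    rw [h3]
    simp only [Finset.sum_const, Finset.card_univ, nsmul_eq_mul]
    calc _ ≤ b₁ * n * (Fintype.card (MIdx d ℓ) * (2 * (n : ℝ)⁻¹)) := by gcongr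
      _ = _ := by field_simp
  refine ((MeanLE.const (by positivity : 0 ≤ N⁻¹ * (Fintype.card (MIdx d ℓ) * m))).add
    ((h1.const_mul (inv_nonneg.2 hs0.le)).const_mul (inv_nonneg.2 hN0.le))).mono ?_
  have e1 : N⁻¹ * (Fintype.card (MIdx d ℓ) * m) = Fintype.card (MIdx d ℓ) * (Cσ + 1) * s := by
    have : m = (Cσ + 1) * (s⁻¹ * Real.log n) := by
      rw [mul_left_comm, ← hm]
      field_simp
    rw [this]
    calc _ = Fintype.card (MIdx d ℓ) * (Cσ + 1) * (N⁻¹ * (s⁻¹ * Real.log n)) := by ring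
      _ = _ := by rw [hs3]
  have e2 : N⁻¹ * (s⁻¹ * (2 * Fintype.card (MIdx d ℓ) * b₁)) ≤
      2 * Fintype.card (MIdx d ℓ) * b₁ * s := by
    calc _ = 2 * Fintype.card (MIdx d ℓ) * b₁ * (N⁻¹ * (s⁻¹ * 1)) := by ring
      _ ≤ 2 * Fintype.card (MIdx d ℓ) * b₁ * (N⁻¹ * (s⁻¹ * Real.log n)) := by gcongr
      _ = _ := by rw [hs3]
  rw [e1]
  linarith

/-- Non-asymptotic bound for the adversarial sup-risk. -/
theorem exists_advRisk_top_le (hd : 1 ≤ d) (hβ : 0 < β) (hK : IsKernelWith K Kmin Kmax Δ)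
    (hμmin : 0 < μmin) (hμ : 0 ≤ μmax) (hCβ : 0 < Cβ) {ℓ : ℕ} (hℓ : floorLT β ≤ ℓ) {H b b' : ℝ}
    (hH : 0 < H) :
    ∃ C c τ₀ : ℝ, 0 < C ∧ 0 < c ∧ 0 < τ₀ ∧
      ∀ (P : Measure (E d × ℝ)) [IsProbabilityMeasure P] (f : E d → ℝ),
      InClass β Cβ μmin μmax σ P f → ∀ (A : E d → Set (E d)) (n M : ℕ) (h τ ρ : ℝ),
      IsAttack ρ A → 0 ≤ ρ → 0 < n → 1 ≤ M → 0 < h → h ≤ H → 1 / M ≤ b * h → M * h ≤ b' →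
      1 ≤ n * h ^ d → 1 ≤ Real.log n → Real.log n ≤ n * h ^ d → 0 < τ → τ ≤ τ₀ →
      advRisk ⊤ P A (fun (Z : Fin n → E d × ℝ) => ppEst K M ℓ h τ Z) f ≤
        ENNReal.ofReal (C * (ρ ^ min 1 β + h ^ β +
          √(Real.log n / (n * h ^ d)) + Real.exp (-(c * (n * h ^ d))) *
          (n + (1 + τ⁻¹ * (h ^ d)⁻¹) ^ (2 : ℝ)))) := by
  set R := max 1 (d * b) with hR
  obtain ⟨C, ε, τ₀, hC, hε, hτ₀, hbound⟩ := exists_rpow_error_bound (μmax := μmax) (σ := σ)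
    hd hβ hK hμmin hμ hCβ hℓ hH (le_max_left 1 (d * b)) le_rfl
  have hbv : 0 ≤ ballVol d := ENNReal.toReal_nonneg
  obtain ⟨t, ht0, ht1, htε⟩ := exists_level (2 * Real.exp (2 * Kmax) * (μmax * ballVol d))
    (by positivity) hε
  set L : ℝ := ((Fintype.card (MIdx d ℓ) : ℕ) : ℝ) with hL
  set Cσ : ℝ := 4 * Real.exp (2 * σ ^ 2 * Kmax ^ 2) * (μmax * ballVol d) with hCσ
  have hCσ0 : 0 ≤ Cσ := by positivity
  set b₁ : ℝ := |b'| ^ d with hb₁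
  set D₁ : ℝ := L * (Cσ + 1) + 2 * L * b₁ with hD₁
  set D₂ : ℝ := (2 * L ^ 2 + 2 * Real.exp ((σ : ℝ) ^ 2 / 2)) * (b₁ + 1) with hD₂
  have hb₁0 : 0 ≤ b₁ := by positivity
  have hD₁0 : 0 ≤ D₁ := by positivity
  have hD₂0 : 0 < D₂ := by positivity
  refine ⟨C * (1 + D₁ + D₂), t * ε / 4, τ₀, by positivity, by positivity, hτ₀, ?_⟩
  intro P _ f hP A n M h τ ρ hA hρ hn hM hh hhH hMb hMb' hN hlog hlogN hτ hττ
  set N : ℝ := n * h ^ d with hNdef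
  have hN0 : 0 < N := by linarith
  set Λ := Real.log n with hΛ
  have hn0 : (0 : ℝ) < n := by exact_mod_cast hn
  have hcard : (Fintype.card (Fin d → Fin M) : ℝ) ≤ b₁ * n := by
    have h1 := card_grid_mul_le (d := d) hh (hMb'.trans (le_abs_self b'))
    have hhd : 0 < h ^ d := pow_pos hh d
    have h2 : (Fintype.card (Fin d → Fin M) : ℝ) * h ^ d ≤ b₁ * n * h ^ d := by
      refine h1.trans ?_
      rw [mul_assoc, ← hNdef]
      exact le_mul_of_one_le_right hb₁0 hN
    exact le_of_mul_le_mul_right h2 hhd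
  set Q := (1 + τ⁻¹ * (h ^ d)⁻¹) ^ (2 : ℝ) with hQ
  have hQ0 : 0 ≤ Q := by positivity
  -- With `N * s ^ 2 = log n` the variance term in the exponent is of the order of the logarithm of
  -- the number of cells. The condition `log n ≤ N` gives `s ≤ 1`, as the local moment bound
  -- demands.
  set s := √(Λ / N) with hs
  have hs0 : 0 < s := Real.sqrt_pos.2 (by positivity)
  have hs1 : s ≤ 1 := Real.sqrt_le_one.2 ((div_le_one hN0).2 hlogN)
  have hs2 : N * s ^ 2 = Λ := by
    rw [hs, Real.sq_sqrt (by positivity)]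
    field_simp
  obtain ⟨m, hm⟩ : ∃ m, s * m = (Cσ + 1) * Λ := ⟨(Cσ + 1) * Λ / s, by field_simp⟩
  have hmax := meanLE_max_noise hP hd hK hμ hh ℓ (fun k : Fin d → Fin M => gridPt M k) hn hcard
    hlog hNdef hs0 hs1 hs2 hm hCσ
  have hrem := meanLE_remainder hP hK hμ hh ℓ (fun k : Fin d → Fin M => gridPt M k) n ht0.le ht1
    htε hQ0
  have hX : 0 ≤ ρ ^ min 1 β + h ^ β := by positivity
  have hTmean := (((MeanLE.const (μ := sampleLaw P n) hX).add hmax).add hrem).const_mul hC.le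
  rw [← hNdef, ← hL] at hTmean
  replace hTmean := hTmean.mono (b := C * (1 + D₁ + D₂) * (ρ ^ min 1 β + h ^ β +
      s + Real.exp (-(t * ε / 4 * N)) * (n + Q))) (by
    rw [mul_assoc C]
    refine mul_le_mul_of_nonneg_left ?_ hC.le
    have he0 : 0 ≤ Real.exp (-(t * ε / 4 * N)) := (Real.exp_pos _).le
    generalize Real.exp (-(t * ε / 4 * N)) = e at he0 ⊢
    have e3 : (2 * L ^ 2 + 2 * Real.exp ((σ : ℝ) ^ 2 / 2)) *
        (e * (Fintype.card (Fin d → Fin M) + Q)) ≤ D₂ * (e * (n + Q)) := by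
      rw [hD₂, mul_assoc]
      refine mul_le_mul_of_nonneg_left ?_ (by positivity)
      calc e * (Fintype.card (Fin d → Fin M) + Q) ≤ e * (b₁ * n + Q) := by gcongr
        _ ≤ e * ((b₁ + 1) * (n + Q)) := by
            gcongr
            nlinarith [mul_nonneg hb₁0 hQ0]
        _ = _ := by ring
    have hY : 0 ≤ e * (n + Q) := by positivity
    calc _ ≤ 1 * (ρ ^ min 1 β + h ^ β) + D₁ * s + D₂ * (e * (n + Q)) := by
          rw [hD₁]
          linarith
      _ ≤ (1 + D₁ + D₂) * (ρ ^ min 1 β + h ^ β) + (1 + D₁ + D₂) * s +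
          (1 + D₁ + D₂) * (e * (n + Q)) := by
          gcongr <;> linarith
      _ = _ := by ring)
  rw [advRisk, if_pos rfl]
  refine (upperExp_le_of_ae (ENNReal.measurable_ofReal.comp hTmean.measurable) ?_).trans hTmean.le
  filter_upwards [hP.ae_sample_mem_cube n] with Z hZ
  refine iSup₂_le fun x hx => iSup₂_le fun x' hx' => ENNReal.ofReal_le_ofReal ?_
  obtain ⟨-, -, hAc, hAr⟩ := hA x hx
  obtain ⟨k, hk, hxk⟩ := exists_nearest_eq_gridPt hM (hAc hx')
  have hxk' : ‖x' - gridPt M k‖ ≤ R * h := by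
    refine hxk.trans ?_
    calc d * (1 / (M : ℝ)) ≤ d * (b * h) := by gcongr
      _ = d * b * h := by ring
      _ ≤ R * h := by gcongr; exact le_max_right _ _
  have h1 := hbound P f hP n h τ ρ (gridPt M k) x x' Z hn hh hhH hτ hττ hZ
    (gridPt_mem_cube k) hx (hAc hx') hxk' (hAr x' hx') t (Real.exp (t * ε / 4 * N)) ht0.le
    (Real.exp_pos _)
  simp only [Real.rpow_one, one_mul, mul_one] at h1
  rw [ppEst, hk]
  refine h1.trans ?_
  dsimp only
  rw [add_assoc (_ + _ + _), ← mul_add N⁻¹]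
  have h2 := sum_le_of_exp (fun i : MIdx d ℓ => |noise f K h Z (gridPt M k) i|) (a := m) hs0
  have h3 : ∑ i : MIdx d ℓ, Real.exp (-(s * m)) *
      Real.exp (s * |noise f K h Z (gridPt M k) i|) ≤ ∑ k : Fin d → Fin M, ∑ i : MIdx d ℓ,
        Real.exp (-(s * m)) * Real.exp (s * |noise f K h Z (gridPt M k) i|) :=
    Finset.single_le_sum (f := fun k : Fin d → Fin M => ∑ i : MIdx d ℓ,
      Real.exp (-(s * m)) * Real.exp (s * |noise f K h Z (gridPt M k) i|))
      (fun _ _ => Finset.sum_nonneg fun _ _ => by positivity) (Finset.mem_univ k)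
  have h4 : gramExc K ℓ h P t ε Z (gridPt M k) ≤
      ∑ k : Fin d → Fin M, gramExc K ℓ h P t ε Z (gridPt M k) :=
    Finset.single_le_sum (f := fun k : Fin d → Fin M => gramExc K ℓ h P t ε Z (gridPt M k))
      (fun _ _ => gramExc_nonneg _ _ _ _ _) (Finset.mem_univ k)
  gcongr
  refine h2.trans ?_
  gcongr

end Risk

/-! ### From the risk bounds to the rate. -/

section Asymptotics

theorem tendsto_natCast_rpow_mul_exp (a : ℝ) {c δ : ℝ} (hc : 0 < c) (hδ : 0 < δ) :
    Tendsto (fun n : ℕ => (n : ℝ) ^ a * Real.exp (-(c * (n : ℝ) ^ δ))) atTop (𝓝 0) := by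
  have h1 := (tendsto_rpow_mul_exp_neg_mul_atTop_nhds_zero (a / δ) c hc).comp
    ((tendsto_rpow_atTop hδ).comp tendsto_natCast_atTop_atTop)
  refine h1.congr fun n => ?_
  simp only [Function.comp_apply]
  rw [← Real.rpow_mul (Nat.cast_nonneg n), mul_div_cancel₀ _ hδ.ne', neg_mul]

/-- The remainder from bad samples: a stretched exponential beats the polynomial growth of `τ⁻¹` and
`(h ^ d)⁻¹`. -/
theorem eventually_exp_mul_poly_le {c δ γ p : ℝ} (hc : 0 < c) (hδ : 0 < δ) (hγ : 0 < γ)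
    (hp : 1 ≤ p) : ∀ᶠ n : ℕ in atTop, Real.exp (-(c * (n : ℝ) ^ δ)) *
      (n + (1 + (n : ℝ) ^ γ * n) ^ (2 * p)) ≤ (n : ℝ) ^ (-p) := by
  have h1 := (tendsto_natCast_rpow_mul_exp (1 + p) hc hδ).add
    ((tendsto_natCast_rpow_mul_exp ((γ + 1) * (2 * p) + p) hc hδ).const_mul (2 ^ (2 * p)))
  rw [mul_zero, add_zero] at h1
  filter_upwards [h1.eventually (Iio_mem_nhds zero_lt_one), eventually_ge_atTop 1] with n hn hn1
  have hn0 : (0 : ℝ) < n := by exact_mod_cast hn1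
  have hn1' : (1 : ℝ) ≤ n := by exact_mod_cast hn1
  rw [Real.rpow_add hn0, Real.rpow_add hn0, Real.rpow_one] at hn
  rw [Real.rpow_neg hn0.le, ← one_div, le_div_iff₀ (by positivity)]
  have h2 : (1 + (n : ℝ) ^ γ * n) ^ (2 * p) ≤ 2 ^ (2 * p) * (n : ℝ) ^ ((γ + 1) * (2 * p)) := by
    rw [Real.rpow_mul hn0.le, ← Real.mul_rpow (by norm_num) (by positivity),
      Real.rpow_add hn0, Real.rpow_one]
    have h3 : 1 ≤ (n : ℝ) ^ γ * n :=
      one_le_mul_of_one_le_of_one_le (Real.one_le_rpow hn1' hγ.le) hn1'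
    refine Real.rpow_le_rpow (by positivity) (by linarith) (by linarith)
  calc _ ≤ Real.exp (-(c * (n : ℝ) ^ δ)) *
        (n + 2 ^ (2 * p) * (n : ℝ) ^ ((γ + 1) * (2 * p))) * (n : ℝ) ^ p := by gcongr
    _ = _ := by ring
    _ ≤ 1 := hn.le

/-- With `w = x ^ (-(1 / (2 * β + d)))` this says `x * w ^ d = w ^ (-2 * β)`: at the critical
bandwidth the squared noise and the squared bias agree. -/
theorem mul_rpow_pow_eq {d : ℕ} {β : ℝ} (hβ : 0 < β) {x : ℝ} (hx : 0 < x) :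
    x * (x ^ (-(1 / (2 * β + d)))) ^ d = x ^ (2 * β / (2 * β + d)) := by
  have h0 : 2 * β + d ≠ 0 := by positivity
  nth_rewrite 1 [← Real.rpow_one x]
  rw [← Real.rpow_natCast, ← Real.rpow_mul hx.le, ← Real.rpow_add hx]
  congr 1
  field_simp
  ring

theorem critBandwidth_nonneg (d : ℕ) (β : ℝ) (q : ℝ≥0∞) (n : ℕ) : 0 ≤ critBandwidth d β q n := by
  unfold critBandwidth
  split_ifs
  · exact Real.rpow_nonneg (div_nonneg (Nat.cast_nonneg n) (Real.log_natCast_nonneg n)) _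
  · exact Real.rpow_nonneg (Nat.cast_nonneg n) _

theorem natCast_rpow_le_critBandwidth {d : ℕ} {β : ℝ} (hβ : 0 < β) (q : ℝ≥0∞) {n : ℕ} (hn : 0 < n)
    (hlog : 1 ≤ Real.log n) : (n : ℝ) ^ (-(1 / (2 * β + d))) ≤ critBandwidth d β q n := by
  have hn0 : (0 : ℝ) < n := by exact_mod_cast hn
  unfold critBandwidth
  split_ifs
  · refine Real.rpow_le_rpow_of_nonpos (by positivity) (div_le_self hn0.le hlog) ?_
    have : 0 < 1 / (2 * β + d) := by positivity
    linarith
  · exact le_rfl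

/-- The bias part of the risk is of the order of the rate. -/
theorem rpow_le_of_le_max {β p : ℝ} (hβ : 0 < β) (hp : 1 ≤ p) {r h w c r₀ : ℝ} (hr : 0 ≤ r)
    (hw : 0 ≤ w) (hh : 0 < h) (hc : 0 < c) (hle : h ≤ c * max r w) (hr₀ : r ≤ r₀) :
    h ^ (p * β) ≤ c ^ (p * β) * (max 1 r₀ ^ (p * (β - min 1 β)) + 1) *
      (r ^ (p * min 1 β) + w ^ (p * β)) := by
  have hpβ : 0 < p * β := by positivity
  have hm : 0 < min 1 β := lt_min one_pos hβ
  have h1 : max r w ^ (p * β) ≤ r ^ (p * β) + w ^ (p * β) := by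
    rcases max_cases r w with h | h <;> rw [h.1]
    · exact le_add_of_nonneg_right (Real.rpow_nonneg hw _)
    · exact le_add_of_nonneg_left (Real.rpow_nonneg hr _)
  have hexp : 0 ≤ p * (β - min 1 β) := mul_nonneg (by linarith) (sub_nonneg.2 (min_le_right _ _))
  -- The surplus exponent `p * (β - min 1 β)` falls on a bounded quantity.
  have h2 : r ^ (p * β) ≤ max 1 r₀ ^ (p * (β - min 1 β)) * r ^ (p * min 1 β) := by
    have e : p * β = p * (β - min 1 β) + p * min 1 β := by ring
    rw [e, Real.rpow_add_of_nonneg hr hexp (by positivity)]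
    gcongr
    exact hr₀.trans (le_max_right _ _)
  set D := max 1 r₀ ^ (p * (β - min 1 β))
  have hD : 0 ≤ D := Real.rpow_nonneg (zero_le_one.trans (le_max_left _ _)) _
  have hr' : 0 ≤ r ^ (p * min 1 β) := Real.rpow_nonneg hr _
  have hw' : 0 ≤ w ^ (p * β) := Real.rpow_nonneg hw _
  calc h ^ (p * β) ≤ (c * max r w) ^ (p * β) := by gcongr
    _ = c ^ (p * β) * max r w ^ (p * β) := Real.mul_rpow hc.le (hr.trans (le_max_left _ _))
    _ ≤ c ^ (p * β) * ((D + 1) * (r ^ (p * min 1 β) + w ^ (p * β))) := by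
        gcongr
        nlinarith [mul_nonneg hD hw']
    _ = _ := by ring

/-- Turns the order relations into inequalities with fixed constants. Boundedness of `h` comes from
`1 ≤ M n` and `M n * h n ≤ b'`; then `r n ≤ a * h n` bounds `r` too. -/
theorem bandwidth_eventually {d : ℕ} {β : ℝ} (hβ : 0 < β) {q : ℝ≥0∞} {r h τ : ℕ → ℝ} {M : ℕ → ℕ}
    {γ : ℝ} (hh : ∀ n, 0 < h n) (hτ : ∀ n, 0 < τ n) (hM : ∀ n, 1 ≤ M n)
    (hh_order : h =Θ[atTop] fun n => max (r n) (critBandwidth d β q n))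
    (hM_order : (fun n => (M n : ℝ)) =Θ[atTop] fun n => 1 / h n)
    (hτ_poly : Tendsto (fun n : ℕ => (n : ℝ) ^ γ * τ n) atTop atTop) :
    ∃ a a' b b' : ℝ, 0 < a ∧ 0 < a' ∧ 0 < b ∧ 0 < b' ∧ ∀ᶠ n : ℕ in atTop,
      0 < n ∧ 1 ≤ Real.log n ∧
      h n ≤ a' * max (r n) (critBandwidth d β q n) ∧ r n ≤ a * h n ∧
      critBandwidth d β q n ≤ a * h n ∧ 1 / (M n : ℝ) ≤ b * h n ∧ M n * h n ≤ b' ∧ h n ≤ b' ∧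
      (a ^ d)⁻¹ * (n * critBandwidth d β q n ^ d) ≤ n * h n ^ d ∧
      (a ^ d)⁻¹ * (n : ℝ) ^ (2 * β / (2 * β + d)) ≤ n * h n ^ d ∧
      1 ≤ n * h n ^ d ∧ Real.log n ≤ n * h n ^ d ∧ (τ n)⁻¹ ≤ (n : ℝ) ^ γ := by
  obtain ⟨a', ha', h1⟩ := hh_order.1.exists_pos
  obtain ⟨a, ha, h2⟩ := hh_order.2.exists_pos
  obtain ⟨b', hb', h3⟩ := hM_order.1.exists_pos
  obtain ⟨b, hb, h4⟩ := hM_order.2.exists_pos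
  refine ⟨a, a', b, b', ha, ha', hb, hb', ?_⟩
  have hδ : 0 < 2 * β / (2 * β + d) := by positivity
  have hlogtop : Tendsto (fun n : ℕ => Real.log n) atTop atTop :=
    Real.tendsto_log_atTop.comp tendsto_natCast_atTop_atTop
  have hpow : Tendsto (fun n : ℕ => (a ^ d)⁻¹ * (n : ℝ) ^ (2 * β / (2 * β + d))) atTop atTop :=
    ((tendsto_rpow_atTop hδ).comp tendsto_natCast_atTop_atTop).const_mul_atTop (by positivity)
  have hlogo : ∀ᶠ n : ℕ in atTop, Real.log n ≤ (a ^ d)⁻¹ * (n : ℝ) ^ (2 * β / (2 * β + d)) := by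
    have := ((isLittleO_log_rpow_atTop hδ).comp_tendsto tendsto_natCast_atTop_atTop).bound
      (c := (a ^ d)⁻¹) (by positivity)
    filter_upwards [this] with n hn
    simp only [Function.comp_apply] at hn
    rw [Real.norm_of_nonneg (Real.log_natCast_nonneg n),
      Real.norm_of_nonneg (Real.rpow_nonneg (Nat.cast_nonneg n) _)] at hn
    exact hn
  filter_upwards [h1.bound, h2.bound, h3.bound, h4.bound, eventually_gt_atTop 0,
    hlogtop.eventually_ge_atTop 1, hpow.eventually_ge_atTop 1, hlogo,
    hτ_poly.eventually_ge_atTop 1] with n h1 h2 h3 h4 hn hlog hp1 hplog hτn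
  have hn0 : (0 : ℝ) < n := by exact_mod_cast hn
  have hcr := critBandwidth_nonneg d β q n
  have hhn := hh n
  have hM0 : (1 : ℝ) ≤ M n := by exact_mod_cast hM n
  have hmax : 0 ≤ max (r n) (critBandwidth d β q n) := hcr.trans (le_max_right _ _)
  rw [Real.norm_of_nonneg hhn.le, Real.norm_of_nonneg hmax] at h1 h2
  rw [Real.norm_of_nonneg (by positivity), Real.norm_of_nonneg (by positivity)] at h3 h4
  have hMh : M n * h n ≤ b' := by
    rwa [mul_one_div, le_div_iff₀ hhn] at h3
  have hcrit : critBandwidth d β q n ≤ a * h n := (le_max_right _ _).trans h2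
  have hN : (a ^ d)⁻¹ * (n * critBandwidth d β q n ^ d) ≤ n * h n ^ d := by
    rw [inv_mul_le_iff₀ (by positivity)]
    calc n * critBandwidth d β q n ^ d ≤ n * (a * h n) ^ d := by gcongr
      _ = _ := by rw [mul_pow]; ring
  have hN' : (a ^ d)⁻¹ * (n : ℝ) ^ (2 * β / (2 * β + d)) ≤ n * h n ^ d := by
    refine le_trans ?_ hN
    rw [← mul_rpow_pow_eq hβ hn0]
    have := natCast_rpow_le_critBandwidth (d := d) hβ q hn hlog
    gcongr
  refine ⟨hn, hlog, h1, (le_max_left _ _).trans h2, hcrit, ?_, hMh,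
    (le_mul_of_one_le_left hhn.le hM0).trans hMh, hN, hN', hp1.trans hN', hplog.trans hN', ?_⟩
  · rw [div_le_iff₀ (by positivity)]
    rw [div_le_iff₀ hhn] at h4
    linarith
  · rw [inv_le_comm₀ (hτ n) (by positivity), inv_le_iff_one_le_mul₀ (by positivity)]
    linarith

/-- From the non-asymptotic risk bound to the rate. -/
theorem eventually_bound_le_rate {d : ℕ} {β : ℝ} (hβ : 0 < β) {p : ℝ} (hp : 1 ≤ p) {q : ℝ≥0∞}
    {γ : ℝ} (hγ : 0 < γ) {a a' b' c D : ℝ} (ha : 0 < a) (ha' : 0 < a')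
    (hc : 0 < c) (hD : 0 < D) :
    ∃ C, 0 < C ∧ ∀ᶠ n : ℕ in atTop, ∀ r h τ X : ℝ, 0 ≤ r → 0 < h → 0 < τ →
      1 ≤ Real.log n →
      h ≤ a' * max r (critBandwidth d β q n) → r ≤ a * h → h ≤ b' →
      (a ^ d)⁻¹ * (n : ℝ) ^ (2 * β / (2 * β + d)) ≤ n * h ^ d → 1 ≤ n * h ^ d →
      τ⁻¹ ≤ (n : ℝ) ^ γ → X ≤ D * critBandwidth d β q n ^ (p * β) →
      r ^ (p * min 1 β) + h ^ (p * β) + X + Real.exp (-(c * (n * h ^ d))) *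
        (n + (1 + τ⁻¹ * (h ^ d)⁻¹) ^ (2 * p)) ≤
      C * (r ^ (p * min 1 β) + critBandwidth d β q n ^ (p * β)) := by
  set C₁ := a' ^ (p * β) * (max 1 (a * b') ^ (p * (β - min 1 β)) + 1) with hC₁
  have hC₁0 : 0 < C₁ := by
    have : 0 < max 1 (a * b') := lt_max_of_lt_left one_pos
    positivity
  have hδ : 0 < 2 * β / (2 * β + d) := by positivity
  refine ⟨1 + C₁ + D + 1, by positivity, ?_⟩
  filter_upwards [eventually_exp_mul_poly_le (c := c * (a ^ d)⁻¹) (by positivity) hδ hγ hp,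
    eventually_gt_atTop 0] with n hexp hn
  intro r h τ X hr hh hτ hlog hle hra hhb hN hN1 hτγ hX
  have hn0 : (0 : ℝ) < n := by exact_mod_cast hn
  have hn1 : (1 : ℝ) ≤ n := by exact_mod_cast hn
  set w := critBandwidth d β q n with hw
  have hw0 : 0 ≤ w := critBandwidth_nonneg d β q n
  have h1 := rpow_le_of_le_max hβ hp hr hw0 hh ha' hle
    (hra.trans (mul_le_mul_of_nonneg_left hhb ha.le))
  rw [← hC₁] at h1
  have h2 : Real.exp (-(c * (n * h ^ d))) * (n + (1 + τ⁻¹ * (h ^ d)⁻¹) ^ (2 * p)) ≤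
      w ^ (p * β) := by
    have h3 : (h ^ d)⁻¹ ≤ n := by
      rw [inv_le_iff_one_le_mul₀ (by positivity)]
      exact hN1
    calc _ ≤ Real.exp (-(c * (a ^ d)⁻¹ * (n : ℝ) ^ (2 * β / (2 * β + d)))) *
          (n + (1 + (n : ℝ) ^ γ * n) ^ (2 * p)) := by
          have h4 : c * (a ^ d)⁻¹ * (n : ℝ) ^ (2 * β / (2 * β + d)) ≤ c * (n * h ^ d) := by
            rw [mul_assoc]
            gcongr
          gcongr
      _ ≤ (n : ℝ) ^ (-p) := hexp
      -- Since `β ≤ 2 * β + d`, the remainder `n ^ (-p)` is no larger than the rate.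
      _ ≤ (n : ℝ) ^ (-(1 / (2 * β + d)) * (p * β)) := by
          refine Real.rpow_le_rpow_of_exponent_le hn1 ?_
          have h4 : 1 / (2 * β + d) * (p * β) ≤ p := by
            rw [one_div, inv_mul_le_iff₀ (by positivity)]
            have hd0 : (0 : ℝ) ≤ d := Nat.cast_nonneg d
            nlinarith [mul_nonneg hd0 (by linarith : (0 : ℝ) ≤ p)]
          linarith
      _ = ((n : ℝ) ^ (-(1 / (2 * β + d)))) ^ (p * β) := Real.rpow_mul hn0.le _ _
      _ ≤ w ^ (p * β) := by
          have := natCast_rpow_le_critBandwidth (d := d) hβ q hn hlog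
          gcongr
  have hr' : 0 ≤ r ^ (p * min 1 β) := Real.rpow_nonneg hr _
  have hw' : 0 ≤ w ^ (p * β) := Real.rpow_nonneg hw0 _
  nlinarith [mul_nonneg hC₁0.le hr', mul_nonneg hD.le hr']

end Asymptotics

end AdvReg

/-! ### The minimax upper bound. -/

theorem theorem2 (d : ℕ) (hd : 1 ≤ d) (β Cβ μmin μmax : ℝ) (σ : ℝ≥0)
    (hβ : 0 < β) (hCβ : 0 < Cβ) (hμmin : 0 < μmin) (hμ : μmin < μmax)
    (K : AdvReg.E d → ℝ) (hK : AdvReg.IsKernel K)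
    (q : ℝ≥0∞) (hq : 1 ≤ q)
    (ℓ : ℕ) (hℓ : AdvReg.floorLT β ≤ ℓ)
    (r h τ : ℕ → ℝ) (M : ℕ → ℕ) (γ : ℝ)
    (hr : ∀ n, 0 ≤ r n) (hh : ∀ n, 0 < h n) (hτ : ∀ n, 0 < τ n) (hM : ∀ n, 1 ≤ M n)
    (hγ : 0 < γ)
    (hh_order : h =Θ[atTop] fun n => max (r n) (AdvReg.critBandwidth d β q n))
    (hM_order : (fun n => (M n : ℝ)) =Θ[atTop] fun n => 1 / h n)
    (hτ_zero : Tendsto τ atTop (𝓝 0))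
    (hτ_poly : Tendsto (fun n : ℕ => (n : ℝ) ^ γ * τ n) atTop atTop) :
    ∃ C : ℝ, 0 < C ∧ ∃ N : ℕ, ∀ n ≥ N,
      ∀ (P : Measure (AdvReg.E d × ℝ)) [IsProbabilityMeasure P] (f : AdvReg.E d → ℝ),
        AdvReg.InClass β Cβ μmin μmax σ P f →
      ∀ A : AdvReg.E d → Set (AdvReg.E d), AdvReg.IsAttack (r n) A →
        AdvReg.advRisk q P A
            (fun (Z : Fin n → AdvReg.E d × ℝ) => AdvReg.ppEst K (M n) ℓ (h n) (τ n) Z) f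
          ≤ ENNReal.ofReal (C * AdvReg.rate d β q (r n) n) := by
  obtain ⟨Kmin, Kmax, Δ, hKw⟩ := hK.exists_isKernelWith
  have hμ0 : 0 ≤ μmax := (hμmin.trans hμ).le
  obtain ⟨a, a', b, b', ha, ha', hb, hb', hev⟩ :=
    AdvReg.bandwidth_eventually hβ hh hτ hM hh_order hM_order hτ_poly
  by_cases hq' : q = ⊤
  · subst hq'
    obtain ⟨C, c, τ₀, hC, hc, hτ₀, hrisk⟩ := AdvReg.exists_advRisk_top_le (b := b) (b' := b')
      (μmax := μmax) (σ := σ) hd hβ hKw hμmin hμ0 hCβ hℓ hb'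
    obtain ⟨C', hC', hbd⟩ := AdvReg.eventually_bound_le_rate (d := d) hβ le_rfl (q := ⊤) hγ ha ha' hc
      (Real.sqrt_pos.2 (by positivity : 0 < a ^ d))
    refine ⟨C * C', by positivity, ?_⟩
    obtain ⟨N, hN⟩ := eventually_atTop.1
      (hev.and (hbd.and (hτ_zero.eventually (Iic_mem_nhds hτ₀))))
    refine ⟨N, fun n hn P _ f hP A hA => ?_⟩
    obtain ⟨⟨hn0, hlog, e1, e2, e3, e4, e5, e6, e7, e8, e9, e10, e11⟩, hbd, hτn⟩ := hN n hn
    refine (hrisk P f hP A n (M n) (h n) (τ n) (r n) hA (hr n) hn0 (hM n) (hh n) e6 e4 e5 e9 hlog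
      e10 (hτ n) hτn).trans (ENNReal.ofReal_le_ofReal ?_)
    have hn0' : (0 : ℝ) < n := by exact_mod_cast hn0
    have hx : 0 < (n : ℝ) / Real.log n := by positivity
    -- By `e7` the bandwidth may be replaced by the critical one `w` up to a factor `a ^ d`, and
    -- `log n / (n * w ^ d) = w ^ (2 * β)`.
    have hX : √(Real.log n / (n * h n ^ d)) ≤
        √(a ^ d) * AdvReg.critBandwidth d β ⊤ n ^ (1 * β) := by
      have h1 : Real.log n / (n * h n ^ d) ≤
          a ^ d * (AdvReg.critBandwidth d β ⊤ n ^ (1 * β)) ^ 2 := by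
        have hcrit : AdvReg.critBandwidth d β ⊤ n =
          ((n : ℝ) / Real.log n) ^ (-(1 / (2 * β + d))) := if_pos rfl
        have h2 := AdvReg.mul_rpow_pow_eq (d := d) hβ hx
        rw [← hcrit] at h2
        have h3 : (AdvReg.critBandwidth d β ⊤ n ^ (1 * β)) ^ 2 =
            (((n : ℝ) / Real.log n) ^ (2 * β / (2 * β + d)))⁻¹ := by
          rw [hcrit, ← Real.rpow_natCast, ← Real.rpow_mul hx.le, ← Real.rpow_mul hx.le,
            ← Real.rpow_neg hx.le]
          congr 1
          push_cast
          ring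
        have h4 : 0 < ((n : ℝ) / Real.log n) ^ (2 * β / (2 * β + d)) := Real.rpow_pos_of_pos hx _
        rw [h3, ← div_eq_mul_inv, div_le_div_iff₀ (by linarith) h4, ← h2]
        rw [inv_mul_le_iff₀ (by positivity)] at e7
        calc _ = n * AdvReg.critBandwidth d β ⊤ n ^ d := by field_simp
          _ ≤ _ := e7
      calc _ ≤ √(a ^ d * (AdvReg.critBandwidth d β ⊤ n ^ (1 * β)) ^ 2) := Real.sqrt_le_sqrt h1
        _ = _ := by
          rw [Real.sqrt_mul (by positivity), Real.sqrt_sq]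
          exact Real.rpow_nonneg (AdvReg.critBandwidth_nonneg _ _ _ _) _
    have h5 := hbd (r n) (h n) (τ n) _ (hr n) (hh n) (hτ n) hlog e1 e2 e6 e8 e9 e11 hX
    have h6 : AdvReg.rate d β ⊤ (r n) n =
        r n ^ (1 * min 1 β) + AdvReg.critBandwidth d β ⊤ n ^ (1 * β) := by
      rw [AdvReg.rate, if_pos rfl, AdvReg.critBandwidth, if_pos rfl, ← Real.rpow_mul hx.le, one_mul]
      congr 2
      ring
    rw [h6, mul_assoc]
    simp only [one_mul, mul_one] at h5 ⊢
    exact mul_le_mul_of_nonneg_left h5 hC.le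
  · have hp := AdvReg.one_le_toReal hq hq'
    obtain ⟨C, c, τ₀, hC, hc, hτ₀, hrisk⟩ := AdvReg.exists_advRisk_le_of_ne_top (a := a) (b := b)
      (b' := b') (μmax := μmax) (σ := σ) hd hβ hKw hμmin hμ0 hCβ hℓ hb' ha hq hq'
    obtain ⟨C', hC', hbd⟩ := AdvReg.eventually_bound_le_rate (d := d) hβ hp (q := q) hγ ha ha' hc
      (by positivity : 0 < ((a ^ d)⁻¹) ^ (-(q.toReal / 2)))
    refine ⟨C * C', by positivity, ?_⟩
    obtain ⟨N, hN⟩ := eventually_atTop.1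
      (hev.and (hbd.and (hτ_zero.eventually (Iic_mem_nhds hτ₀))))
    refine ⟨N, fun n hn P _ f hP A hA => ?_⟩
    obtain ⟨⟨hn0, hlog, e1, e2, e3, e4, e5, e6, e7, e8, e9, e10, e11⟩, hbd, hτn⟩ := hN n hn
    refine (hrisk P f hP A n (M n) (h n) (τ n) (r n) hA (hr n) hn0 (hM n) (hh n) e6 e4 e5 e2 e9
      (hτ n) hτn).trans (ENNReal.ofReal_le_ofReal ?_)
    have hn0' : (0 : ℝ) < n := by exact_mod_cast hn0
    have hcrit : AdvReg.critBandwidth d β q n = (n : ℝ) ^ (-(1 / (2 * β + d))) := if_neg hq'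
    -- The power is decreasing, so the lower bound `e8` on the local sample size bounds the noise by
    -- the critical bandwidth to the power `q.toReal * β`.
    have hX : (n * h n ^ d) ^ (-(q.toReal / 2)) ≤ ((a ^ d)⁻¹) ^ (-(q.toReal / 2)) *
        AdvReg.critBandwidth d β q n ^ (q.toReal * β) := by
      have h2 := AdvReg.mul_rpow_pow_eq (d := d) hβ hn0'
      have h3 : AdvReg.critBandwidth d β q n ^ (q.toReal * β) =
          ((n : ℝ) ^ (2 * β / (2 * β + d))) ^ (-(q.toReal / 2)) := by
        rw [hcrit, ← Real.rpow_mul hn0'.le, ← Real.rpow_mul hn0'.le]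
        congr 1
        ring
      rw [h3, ← Real.mul_rpow (by positivity) (by positivity)]
      exact Real.rpow_le_rpow_of_nonpos (by positivity) e8 (by linarith)
    have h5 := hbd (r n) (h n) (τ n) _ (hr n) (hh n) (hτ n) hlog e1 e2 e6 e8 e9 e11 hX
    have h6 : AdvReg.rate d β q (r n) n =
        r n ^ (q.toReal * min 1 β) + AdvReg.critBandwidth d β q n ^ (q.toReal * β) := by
      rw [AdvReg.rate, if_neg hq', hcrit, ← Real.rpow_mul hn0'.le]
      congr 2
      ring
    rw [h6, mul_assoc]
    exact mul_le_mul_of_nonneg_left h5 hC.le
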